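/- Let $K$ be a separable complex Hilbert space and $\mathcal H=L^2(\mathbb R_x;K)$ (for instance $L^2(\mathbb R^2;\mathbb C^n)$ with $K=L^2(\mathbb R_y;\mathbb C^n)$), and let $\mathcal F$ be the Fourier transform in $x$, with dual variable $\xi$ (plane waves $e^{ix\xi}$). Let $H$ be an unbounded self-adjoint operator on $\mathcal H$ that commutes with all translations in $x$. Let $\Delta=(\alpha,\beta)$ with $\alpha<\beta$, and assume that there are finitely many smooth functions (branches) $E_j:\mathbb R\to\mathbb R$, $1\le j\le J$, each with $\{\xi: E_j(\xi)\in\Delta\}$ bounded, and rank-one orthogonal projectors $\tilde\Pi_j(\xi)$ on $K$, measurable in $\xi$, such that for every $\Phi\in C^\infty_c(\Delta)$ $$\mathcal F\,\Phi(H)\,\mathcal F^{-1}=\sum_{j=1}^J\int^\oplus_{\mathbb R}\Phi(E_j(\xi))\,\tilde\Pi_j(\xi)\,d\xi .$$ Let $E_j^{\pm}=\alpha$ if $E_j(\xi)\le\alpha$ for all $\xi$ near $\pm\infty$, and $E_j^\pm=\beta$ otherwise (in which case $E_j(\xi)\geq\beta$ near $\pm\infty$). Let $\varphi\in C^\infty(\mathbb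 R;\mathbb R)$ with $\varphi=0$ on $(-\infty,\alpha]$, $\varphi=1$ on $(\beta,\infty)$ and $\operatorname{supp}\varphi'\subset\Delta$. Let $P$ be multiplication by a bounded measurable real function $P(x)$ with $P(x)=0$ for $x\le c$ and $P(x)=1$ for $x>d$, for some $c\le d$. Assume that $[\Psi(H),P]\Phi(H)$ is trace-class for all $\Psi,\Phi\in C_c^\infty(\Delta)$, and that $i[H,P]\varphi'(H)$ is well defined on $\mathcal H$ (that is, $P\varphi'(H)$ maps $\mathcal H$ into the domain of $H$) and trace-class; set $\sigma_I=\operatorname{Tr} i[H,P]\varphi'(H)$. Then $$2\pi\sigma_I=\sum_j\int_{\mathbb R}\frac{d}{d\xi}(\varphi\circ E_j)(\xi)\,d\xi=\sum_j\big[\varphi(E_j^+)-\varphi(E_j^-)\big]=\#\{j: E_j^-=\alpha,\ E_j^+=\beta\}-\#\{j: E_j^-=\beta,\ E_j^+=\alpha\}\in\mathbb Z .$$ Moreover, let $\mathrm P$ be multiplication by the Heaviside function $1_{x>x_0}$ for some $x_0\in\mathbb R$ and let $U=e^{2\pi i\varphi(H)}$. If $[U,\mathrm P]$ is trace-class with vanishing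 trace, then $\mathrm PU\mathrm P$ is a Fredholm operator on $\operatorname{Ran}\mathrm P$ and $$\operatorname{Index}\,\mathrm PU\mathrm P=\sum_j w_1\big[e^{2\pi i\varphi\circ E_j}\big]=2\pi\sigma_I,\qquad w_1[f]=\frac1{2\pi i}\int_{\mathbb R}\overline{f(\xi)}\,f'(\xi)\,d\xi ,$$ where $\operatorname{Index}$ is the dimension of the kernel minus that of the cokernel. -/

import Mathlib

open MeasureTheory Filter Topology
open scoped ContDiff FourierTransform ENNReal InnerProductSpace

noncomputable section

namespace SpectralFlow

/-! ### Trace-class operators and the trace -/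

section Trace

variable {E : Type*} [NormedAddCommGroup E] [InnerProductSpace ℂ E] [CompleteSpace E]

/-- `T` is trace-class: it is compact with summable singular values, i.e. it has a singular value
decomposition `T x = ∑ sᵢ ⟨vᵢ, x⟩ uᵢ` with `(uᵢ)`, `(vᵢ)` orthonormal, `sᵢ > 0` and
`∑ sᵢ < ∞`. -/
def IsTraceClass (T : E →L[ℂ] E) : Prop :=
  ∃ (ι : Type) (s : ι → ℝ) (u v : ι → E),
    (∀ i, 0 < s i) ∧ Summable s ∧ Orthonormal ℂ u ∧ Orthonormal ℂ v ∧
      ∀ x : E, HasSum (fun i => ((s i : ℂ) * ⟪v i, x⟫_ℂ) • u i) (T x)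

/-- An orthonormal (Hilbert) basis of `E`, as a set of vectors. -/
def basisSet (E : Type*) [NormedAddCommGroup E] [InnerProductSpace ℂ E] [CompleteSpace E] :
    Set E :=
  (exists_hilbertBasis ℂ E).choose

/-- The Hilbert basis of `E` with underlying set `basisSet E`. -/
def hilbBasis (E : Type*) [NormedAddCommGroup E] [InnerProductSpace ℂ E] [CompleteSpace E] :
    HilbertBasis (basisSet E) ℂ E :=
  (exists_hilbertBasis ℂ E).choose_spec.choose

/-- The trace `∑ ⟨eᵢ, T eᵢ⟩` over a Hilbert basis (meaningful for trace-class `T`). -/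
def opTrace (T : E →L[ℂ] E) : ℂ :=
  ∑' i, ⟪hilbBasis E i, T (hilbBasis E i)⟫_ℂ

/-- The commutator `[A, B]` of bounded operators. -/
def opComm (A B : E →L[ℂ] E) : E →L[ℂ] E := A ∘L B - B ∘L A

/-- The operator `P U P` restricted to the range of `P`. -/
def compression (P U : E →L[ℂ] E) :
    LinearMap.range (P : E →ₗ[ℂ] E) →L[ℂ] LinearMap.range (P : E →ₗ[ℂ] E) :=
  (P ∘L U ∘L (LinearMap.range (P : E →ₗ[ℂ] E)).subtypeL).codRestrict
    (LinearMap.range (P : E →ₗ[ℂ] E)) (fun v => ⟨U v, rfl⟩)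

/-- The index `dim ker T - dim coker T` of a Fredholm operator. -/
def fredholmIndex {F : Type*} [NormedAddCommGroup F] [NormedSpace ℂ F] (T : F →L[ℂ] F) : ℤ :=
  LinearMap.index (T : F →ₗ[ℂ] F)

end Trace

/-! ### Functions of an unbounded self-adjoint operator -/

section Calculus

variable {E : Type*} [NormedAddCommGroup E] [InnerProductSpace ℂ E] [CompleteSpace E]

/-- `R = (H - z)⁻¹` for the unbounded operator `H`: a bounded two-sided inverse of
`H - z : dom H → E`. -/
def IsResolventAt (H : E →ₗ.[ℂ] E) (z : ℂ) (R : E →L[ℂ] E) : Prop :=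
  (∀ v : E, ∃ h : R v ∈ H.domain, H ⟨R v, h⟩ - z • R v = v) ∧
    ∀ u : H.domain, R (H u - z • (u : E)) = u

open Classical in
/-- The resolvent `(H - z)⁻¹` (unique when it exists; it exists for self-adjoint `H` and
non-real `z`). -/
def resolventAt (H : E →ₗ.[ℂ] E) (z : ℂ) : E →L[ℂ] E :=
  if h : ∃ R, IsResolventAt H z R then h.choose else 0

/-- The functional calculus `f(H)` of an unbounded self-adjoint operator `H`, for continuous
`f : ℝ → ℂ` with one common limit at `±∞` (in particular `f` continuous with compact support).
It is the continuous functional calculus of the bounded normal operator `R = (H + i)⁻¹`: if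
`w = 1 / (t + i)` then `t = 1 / w - i`, and `w = 0` corresponds to `t = ±∞`. -/
def funCalc (H : E →ₗ.[ℂ] E) (f : ℝ → ℂ) : E →L[ℂ] E :=
  cfc (fun w : ℂ => if w = 0 then limUnder (cocompact ℝ) f else f (w⁻¹ - Complex.I).re)
    (resolventAt H (-Complex.I))

/-- `T = i [H, P] B` as an everywhere defined bounded operator: the ranges of `B` and `P B` lie in
the domain of `H`, and `T v = i (H P B v - P H B v)`. -/
def IsCurrentOperator (H : E →ₗ.[ℂ] E) (P B T : E →L[ℂ] E) : Prop :=
  ∀ v : E, ∃ (h₁ : B v ∈ H.domain) (h₂ : P (B v) ∈ H.domain),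
    T v = Complex.I • (H ⟨P (B v), h₂⟩ - P (H ⟨B v, h₁⟩))

end Calculus

/-! ### Switch functions -/

/-- Switch functions: `f` is bounded, `f = a` on `(-∞, c]` and `f = b` on `(d, ∞)`. -/
structure IsSwitch (a b c d : ℝ) (f : ℝ → ℝ) : Prop where
  bounded : ∃ C, ∀ x, |f x| ≤ C
  left : ∀ x, x ≤ c → f x = a
  right : ∀ x, d < x → f x = b

/-- The Heaviside function with jump at `x₀`. -/
def heaviside (x₀ : ℝ) (x : ℝ) : ℝ := if x₀ < x then 1 else 0

/-! ### The Hilbert space `L²(ℝ_x; K)` -/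

section L2

/-- The space `L²(ℝ; K)`, where `K` is the Hilbert space of the transverse variables. For instance
`L²(ℝ²; ℂⁿ) = L²(ℝ_x; K)` with `K = L²(ℝ_y; ℂⁿ)`. -/
abbrev L2 (K : Type*) [NormedAddCommGroup K] := Lp (α := ℝ) K 2 (volume : Measure ℝ)

variable {K : Type*} [NormedAddCommGroup K] [InnerProductSpace ℂ K]

open Classical in
/-- Multiplication by the (essentially bounded, measurable) function `g(x)` on `L²(ℝ; K)`. -/
def mulOp (K : Type*) [NormedAddCommGroup K] [InnerProductSpace ℂ K] (g : ℝ → ℝ) :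
    L2 K →L[ℂ] L2 K :=
  if h : MemLp (fun x => (g x : ℂ)) ∞ (volume : Measure ℝ) then
    (ContinuousLinearMap.lsmul ℂ ℂ : ℂ →L[ℂ] K →L[ℂ] K).holderL volume ∞ 2 2 (h.toLp _)
  else 0

theorem mulOp_ae (g : ℝ → ℝ) (h : MemLp (fun x => (g x : ℂ)) ∞ (volume : Measure ℝ))
    (f : L2 K) : ∀ᵐ x, mulOp K g f x = (g x : ℂ) • f x := by
  have e : mulOp K g f =
      (ContinuousLinearMap.lsmul ℂ ℂ : ℂ →L[ℂ] K →L[ℂ] K).holder 2 (h.toLp _) f := by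
    simp only [mulOp, dif_pos h]
    rfl
  rw [e]
  filter_upwards [(ContinuousLinearMap.lsmul ℂ ℂ : ℂ →L[ℂ] K →L[ℂ] K).coeFn_holder
    (r := 2) (h.toLp _) f, h.coeFn_toLp] with x hx hx'
  rw [hx, hx']
  rfl

/-- The translation `f ↦ f (· + a)` on `L²(ℝ; K)`. -/
def translate (a : ℝ) : L2 K →ₗᵢ[ℂ] L2 K :=
  Lp.compMeasurePreservingₗᵢ ℂ (fun x : ℝ => x + a) (measurePreserving_add_right volume a)

/-- `H` is invariant by translation along the `x`-axis: it commutes with all translations. -/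
def TranslationInvariant (H : L2 K →ₗ.[ℂ] L2 K) : Prop :=
  ∀ (a : ℝ) (u : H.domain), ∃ h : translate a (u : L2 K) ∈ H.domain,
    H ⟨translate a (u : L2 K), h⟩ = translate a (H u)

/-- Smooth complex functions with compact support in the open interval `(α, β)`. -/
structure IsTest (α β : ℝ) (f : ℝ → ℂ) : Prop where
  smooth : ContDiff ℝ ∞ f
  compact : HasCompactSupport f
  support : tsupport f ⊆ Set.Ioo α β

/-- The spectral decomposition of `H` over the energy interval `Δ = (α, β)`, with finitely many
smooth branches `E j` crossing `Δ` on a compact domain, and rank-one orthogonal projectors `Pr j ξ`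
on `K`, measurable in `ξ`: for `Φ` smooth with compact support in `Δ`,
`(F Φ(H) F⁻¹ g)(ξ) = ∑ⱼ Φ (E j ξ) • Pr j ξ (g ξ)`.
The variable `ξ` is dual to `x` through `exp (i x ξ)`; Mathlib's Fourier transform `𝓕` uses
`exp (-2 π i x w)`, so that `ξ = 2 π w`. -/
structure HasBranches [CompleteSpace K] (H : L2 K →ₗ.[ℂ] L2 K) (α β : ℝ) {J : ℕ}
    (E : Fin J → ℝ → ℝ) (Pr : Fin J → ℝ → K →L[ℂ] K) : Prop where
  smooth : ∀ j, ContDiff ℝ ∞ (E j)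
  bounded_crossing : ∀ j, Bornology.IsBounded {ξ : ℝ | E j ξ ∈ Set.Ioo α β}
  projector : ∀ j ξ, IsStarProjection (Pr j ξ)
  rank_one : ∀ j ξ, Module.finrank ℂ (LinearMap.range (Pr j ξ : K →ₗ[ℂ] K)) = 1
  measurable : ∀ j (v : K), AEStronglyMeasurable (fun ξ => Pr j ξ v) volume
  decomposition : ∀ Φ : ℝ → ℂ, IsTest α β Φ → ∀ f : L2 K, ∀ᵐ w : ℝ,
    (𝓕 (funCalc H Φ f) : L2 K) w =
      ∑ j, Φ (E j (2 * Real.pi * w)) • Pr j (2 * Real.pi * w) ((𝓕 f : L2 K) w)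

end L2

/-! ### Ends of branches and winding numbers -/

open Classical in
/-- `α` or `β`, according to whether the branch `e` has left `(α, β)` through `α` or through `β`
along the filter `l` (`atTop` for `ξ → +∞`, `atBot` for `ξ → -∞`). -/
def branchEnd (α β : ℝ) (e : ℝ → ℝ) (l : Filter ℝ) : ℝ :=
  if ∀ᶠ ξ in l, e ξ ≤ α then α else β

/-- The winding number `w₁[f] = (1 / 2πi) ∫ f* df`. -/
def winding (f : ℝ → ℂ) : ℂ :=
  1 / (2 * Real.pi * Complex.I) * ∫ ξ : ℝ, (starRingEnd ℂ) (f ξ) * deriv f ξ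

/-- The function `h ↦ exp (2 π i φ(h))`. -/
def expFun (φ : ℝ → ℝ) (h : ℝ) : ℂ := Complex.exp (2 * Real.pi * Complex.I * φ h)

end SpectralFlow

end

open SpectralFlow

set_option linter.unusedSectionVars false

/-! For a test function `f` on `Δ`, the operator `f(H)` is a Fourier multiplier whose finite-rank
symbol is `m_f(w) = ∑ⱼ f(Eⱼ) Πⱼ` at `ξ = 2πw`. Both the conductivity and the index follow from one
trace formula, `HasBranches.opTrace_opComm`: `2πi Tr [f(H), P] g(H) = ∑ⱼ ∫ f' g`, with each integral
running from `Eⱼ⁻` to `Eⱼ⁺`.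

The projectors are only measurable in `ξ`, so the symbols cannot be differentiated pointwise.
Instead, the derivative at `η = 0` of the correlation `C(η) = ∫ tr (m_g(w) m_f(w + η)) dw` is
computed in two ways.

In position space, `[f(H), P]` has a convolution kernel multiplied by an increment of `P`. Since `∫
(P(y + t) - P(y)) dy = t`, its trace against `g(H)` is a first moment of a product of kernels, which
is `C'(0)` up to the factor `2πi` (`IsMult.hasDerivAt_integral_hsInner`).

In frequency space, regularity comes from the trace-class hypothesis. The commutators are
Hilbert-Schmidt, so `|t|^{1/2}` times each kernel is square integrable and `∫ ‖m_f(w + η) - m_f(w)‖²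
dw = o(η)` in Hilbert-Schmidt norm (`IsMult.tendsto_lintegral_hsSq_sub`). Errors quadratic in such
differences are therefore negligible. With `vₖ` unit vectors of the projectors and `Θ' = f' g`, the
weights `|⟨vₖ(w), vⱼ(w + η)⟩|²` form a doubly substochastic coupling of the levels, and up to a
quadratic error `tr (m_g(w) m_f(w + η))` equals `∑ (g f)(Eₖ(w))` plus the increments of `Θ` along
the branches (`enorm_hsInner_sub_le`). These increments integrate to exactly `η ∑ (Θ(Eₖ⁺) -
Θ(Eₖ⁻))`. The orthonormality of the `vₖ` behind this is not assumed: it comes from the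
multiplicativity of the functional calculus.

For the conductivity, a plateau function `χ` equal to `1` where `φ'` does not vanish, together with
cyclicity of the trace, replaces `H` by bounded functions of `H`. The two resulting boundary
integrals combine into `∫ φ'`. For the index, Fedosov's formula gives `Tr U*[U, P]`. With `u = U -
1` and the vanishing of `Tr [U, P]` this is `Tr [u, P] u*`, to which the trace formula applies. -/

namespace SpectralFlow

/-! ### Nuclear operators and their trace -/

section Nuclear

variable {E F G : Type*} [NormedAddCommGroup E] [InnerProductSpace ℂ E] [CompleteSpace E]
  [NormedAddCommGroup F] [InnerProductSpace ℂ F] [CompleteSpace F]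
  [NormedAddCommGroup G] [InnerProductSpace ℂ G] [CompleteSpace G]

/-- A nuclear representation `T x = ∑ ⟨vᵢ, x⟩ uᵢ` with `∑ ‖uᵢ‖ ‖vᵢ‖ < ∞`. -/
structure NuclearRep (T : E →L[ℂ] F) {ι : Type} (u : ι → F) (v : ι → E) : Prop where
  summable : Summable fun i => ‖u i‖ * ‖v i‖
  hasSum : ∀ x, HasSum (fun i => ⟪v i, x⟫_ℂ • u i) (T x)

/-- Nuclear operators between Hilbert spaces. -/
def IsNuclear (T : E →L[ℂ] F) : Prop :=
  ∃ (ι : Type) (u : ι → F) (v : ι → E), NuclearRep T u v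

/-- Giving up orthonormality of the two families makes sums, adjoints and products with bounded
operators act directly on representations, and the trace can still be computed from them. -/
theorem IsTraceClass.isNuclear {T : E →L[ℂ] E} (h : IsTraceClass T) : IsNuclear T := by
  obtain ⟨ι, s, u, v, hs, hsum, hu, hv, h⟩ := h
  refine ⟨ι, fun i => (s i : ℂ) • u i, v, ?_, fun x => ?_⟩
  · refine hsum.congr fun i => ?_
    simp [norm_smul, hu.1 i, hv.1 i, abs_of_pos (hs i)]
  · refine (h x).congr_fun fun i => ?_
    simp [mul_smul, smul_comm (⟪v i, x⟫_ℂ)]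

theorem NuclearRep.comp_left {T : E →L[ℂ] F} {ι : Type} {u : ι → F} {v : ι → E}
    (h : NuclearRep T u v) (B : F →L[ℂ] G) : NuclearRep (B ∘L T) (fun i => B (u i)) v := by
  refine ⟨?_, fun x => ?_⟩
  · refine Summable.of_nonneg_of_le (fun i => by positivity) (fun i => ?_)
      (h.summable.mul_left ‖B‖)
    rw [← mul_assoc]
    gcongr
    exact B.le_opNorm _
  · simpa using (h.hasSum x).mapL B

theorem NuclearRep.comp_right {T : E →L[ℂ] F} {ι : Type} {u : ι → F} {v : ι → E}
    (h : NuclearRep T u v) (B : G →L[ℂ] E) :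
    NuclearRep (T ∘L B) u (fun i => ContinuousLinearMap.adjoint B (v i)) := by
  refine ⟨?_, fun x => ?_⟩
  · refine Summable.of_nonneg_of_le (fun i => by positivity) (fun i => ?_)
      (h.summable.mul_left ‖ContinuousLinearMap.adjoint B‖)
    rw [mul_left_comm]
    gcongr
    exact ContinuousLinearMap.le_opNorm _ _
  · simpa [ContinuousLinearMap.adjoint_inner_left] using h.hasSum (B x)

theorem IsNuclear.comp_left {T : E →L[ℂ] F} (h : IsNuclear T) (B : F →L[ℂ] G) :
    IsNuclear (B ∘L T) := by
  obtain ⟨ι, u, v, h⟩ := h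
  exact ⟨ι, _, _, h.comp_left B⟩

theorem IsNuclear.comp_right {T : E →L[ℂ] F} (h : IsNuclear T) (B : G →L[ℂ] E) :
    IsNuclear (T ∘L B) := by
  obtain ⟨ι, u, v, h⟩ := h
  exact ⟨ι, _, _, h.comp_right B⟩

theorem IsNuclear.add {S T : E →L[ℂ] F} (hS : IsNuclear S) (hT : IsNuclear T) :
    IsNuclear (S + T) := by
  obtain ⟨ι, u, v, hS⟩ := hS
  obtain ⟨ι', u', v', hT⟩ := hT
  refine ⟨ι ⊕ ι', Sum.elim u u', Sum.elim v v', ?_, fun x => ?_⟩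
  · exact ((hS.summable.hasSum).sum (f := fun i => ‖Sum.elim u u' i‖ * ‖Sum.elim v v' i‖)
      hT.summable.hasSum).summable
  · exact (hS.hasSum x).sum (f := fun i => ⟪Sum.elim v v' i, x⟫_ℂ • Sum.elim u u' i) (hT.hasSum x)

theorem IsNuclear.smul {T : E →L[ℂ] F} (hT : IsNuclear T) (c : ℂ) : IsNuclear (c • T) := by
  have := hT.comp_left (c • ContinuousLinearMap.id ℂ F)
  simpa [ContinuousLinearMap.smul_comp] using this

theorem IsNuclear.neg {T : E →L[ℂ] F} (hT : IsNuclear T) : IsNuclear (-T) := by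
  simpa using hT.smul (-1)

theorem IsNuclear.sub {S T : E →L[ℂ] F} (hS : IsNuclear S) (hT : IsNuclear T) :
    IsNuclear (S - T) := by
  simpa [sub_eq_add_neg] using hS.add hT.neg

theorem NuclearRep.adjoint {T : E →L[ℂ] F} {ι : Type} {u : ι → F} {v : ι → E}
    (h : NuclearRep T u v) : NuclearRep (ContinuousLinearMap.adjoint T) v u := by
  have hs : Summable fun i => ‖v i‖ * ‖u i‖ := h.summable.congr fun i => mul_comm _ _
  refine ⟨hs, fun y => ?_⟩
  have hsum : Summable fun i => ⟪u i, y⟫_ℂ • v i := by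
    refine Summable.of_norm_bounded (hs.mul_right ‖y‖) fun i => ?_
    rw [norm_smul]
    calc ‖⟪u i, y⟫_ℂ‖ * ‖v i‖ ≤ (‖u i‖ * ‖y‖) * ‖v i‖ := by
          gcongr; exact norm_inner_le_norm _ _
      _ = _ := by ring
  convert hsum.hasSum using 1
  refine ext_inner_left ℂ fun x => ?_
  rw [ContinuousLinearMap.adjoint_inner_right]
  have h1 : HasSum (fun i => ⟪x, ⟪u i, y⟫_ℂ • v i⟫_ℂ) ⟪x, ∑' i, ⟪u i, y⟫_ℂ • v i⟫_ℂ :=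
    hsum.hasSum.mapL (innerSL ℂ x)
  have h2 : HasSum (fun i => ⟪y, ⟪v i, x⟫_ℂ • u i⟫_ℂ) ⟪y, T x⟫_ℂ :=
    (h.hasSum x).mapL (innerSL ℂ y)
  have h3 : HasSum (fun i => (starRingEnd ℂ) ⟪y, ⟪v i, x⟫_ℂ • u i⟫_ℂ)
      ((starRingEnd ℂ) ⟪y, T x⟫_ℂ) := h2.star
  rw [inner_conj_symm] at h3
  refine h3.unique (h1.congr_fun fun i => ?_)
  rw [inner_conj_symm, inner_smul_left, inner_smul_right, inner_conj_symm, mul_comm]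

theorem IsNuclear.adjoint {T : E →L[ℂ] F} (h : IsNuclear T) :
    IsNuclear (ContinuousLinearMap.adjoint T) := by
  obtain ⟨ι, u, v, h⟩ := h
  exact ⟨ι, _, _, h.adjoint⟩

theorem sum_norm_inner_mul_inner_le {κ : Type*} {b : κ → E} (hb : Orthonormal ℂ b) (x y : E)
    (s : Finset κ) : ∑ k ∈ s, ‖⟪x, b k⟫_ℂ * ⟪b k, y⟫_ℂ‖ ≤ ‖x‖ * ‖y‖ := by
  refine le_of_sq_le_sq ?_ (by positivity)
  simp only [norm_mul]
  refine (Finset.sum_mul_sq_le_sq_mul_sq _ _ _).trans ?_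
  rw [mul_pow]
  gcongr
  · simpa only [norm_inner_symm] using hb.sum_inner_products_le x
  · exact hb.sum_inner_products_le y

/-- The double series of `⟪v i, b k⟫ ⟪b k, u i⟫` converges absolutely by Cauchy-Schwarz and Bessel.
Summing over `k` first is Parseval, summing over `i` first gives the diagonal of `T`; so the trace
depends neither on the basis nor on the representation. -/
theorem NuclearRep.hasSum_trace {T : E →L[ℂ] E} {ι : Type} {u v : ι → E}
    (h : NuclearRep T u v) {κ : Type*} (b : HilbertBasis κ ℂ E) :
    HasSum (fun k => ⟪b k, T (b k)⟫_ℂ) (∑' i, ⟪v i, u i⟫_ℂ) := by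
  have hs : Summable fun p : ι × κ => ⟪v p.1, b p.2⟫_ℂ * ⟪b p.2, u p.1⟫_ℂ := by
    refine Summable.of_norm ?_
    have hle := fun i => sum_norm_inner_mul_inner_le b.orthonormal (v i) (u i)
    have hs' := fun i => summable_of_sum_le (f := fun k => ‖⟪v i, b k⟫_ℂ * ⟪b k, u i⟫_ℂ‖)
      (fun k => norm_nonneg _) (hle i)
    refine (summable_prod_of_nonneg fun p => norm_nonneg _).2 ⟨hs', ?_⟩
    refine Summable.of_nonneg_of_le (fun i => tsum_nonneg fun k => norm_nonneg _) (fun i => ?_)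
      h.summable
    rw [mul_comm]
    exact (hs' i).tsum_le_of_sum_le (hle i)
  have h1 : HasSum (fun p : ι × κ => ⟪v p.1, b p.2⟫_ℂ * ⟪b p.2, u p.1⟫_ℂ)
      (∑' i, ⟪v i, u i⟫_ℂ) := by
    rw [hs.hasSum_iff, hs.tsum_prod]
    exact tsum_congr fun i => (b.hasSum_inner_mul_inner (v i) (u i)).tsum_eq
  have h2 := (Equiv.prodComm κ ι).hasSum_iff.2 h1
  refine h2.prod_fiberwise fun k => ?_
  have h3 := (h.hasSum (b k)).mapL (innerSL ℂ (b k))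
  simpa [inner_smul_right] using h3

theorem NuclearRep.opTrace_eq {T : E →L[ℂ] E} {ι : Type} {u v : ι → E}
    (h : NuclearRep T u v) : opTrace T = ∑' i, ⟪v i, u i⟫_ℂ :=
  (h.hasSum_trace (hilbBasis E)).tsum_eq

theorem IsNuclear.hasSum_trace {T : E →L[ℂ] E} (h : IsNuclear T) {κ : Type*}
    (b : HilbertBasis κ ℂ E) : HasSum (fun k => ⟪b k, T (b k)⟫_ℂ) (opTrace T) := by
  obtain ⟨ι, u, v, h⟩ := h
  rw [h.opTrace_eq]
  exact h.hasSum_trace b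

theorem opTrace_add {S T : E →L[ℂ] E} (hS : IsNuclear S) (hT : IsNuclear T) :
    opTrace (S + T) = opTrace S + opTrace T := by
  refine HasSum.tsum_eq ?_
  simpa [inner_add_right] using
    (hS.hasSum_trace (hilbBasis E)).add (hT.hasSum_trace (hilbBasis E))

theorem opTrace_smul {T : E →L[ℂ] E} (hT : IsNuclear T) (c : ℂ) :
    opTrace (c • T) = c * opTrace T := by
  refine HasSum.tsum_eq ?_
  simpa [inner_smul_right] using (hT.hasSum_trace (hilbBasis E)).mul_left c

theorem opTrace_sub {S T : E →L[ℂ] E} (hS : IsNuclear S) (hT : IsNuclear T) :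
    opTrace (S - T) = opTrace S - opTrace T := by
  refine HasSum.tsum_eq ?_
  simpa [inner_sub_right] using
    (hS.hasSum_trace (hilbBasis E)).sub (hT.hasSum_trace (hilbBasis E))

theorem opTrace_comp_comm {A : E →L[ℂ] F} (hA : IsNuclear A) (B : F →L[ℂ] E) :
    opTrace (A ∘L B) = opTrace (B ∘L A) := by
  obtain ⟨ι, u, v, h⟩ := hA
  rw [(h.comp_left B).opTrace_eq, (h.comp_right B).opTrace_eq]
  exact tsum_congr fun i => ContinuousLinearMap.adjoint_inner_left _ _ _

theorem IsNuclear.summable_norm_sq {T : E →L[ℂ] F} (h : IsNuclear T) {κ : Type*}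
    (b : HilbertBasis κ ℂ E) : Summable fun k => ‖T (b k)‖ ^ 2 := by
  have h1 := ((h.comp_left (ContinuousLinearMap.adjoint T)).hasSum_trace b).summable
  simp only [ContinuousLinearMap.comp_apply, ContinuousLinearMap.adjoint_inner_right,
    inner_self_eq_norm_sq_to_K] at h1
  exact_mod_cast h1

/-- Strong convergence is enough, because the trace is `∑ ⟪vᵢ, Bₙ uᵢ⟫`, dominated by `C ∑ ‖uᵢ‖
‖vᵢ‖`. This is what removes a spatial cutoff from a trace. -/
theorem IsNuclear.tendsto_opTrace_comp {A : E →L[ℂ] E} (hA : IsNuclear A) {B : E →L[ℂ] E}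
    {Bn : ℕ → E →L[ℂ] E} {C : ℝ} (hC : ∀ n, ‖Bn n‖ ≤ C)
    (hB : ∀ x, Tendsto (fun n => Bn n x) atTop (𝓝 (B x))) :
    Tendsto (fun n => opTrace (A ∘L Bn n)) atTop (𝓝 (opTrace (A ∘L B))) := by
  obtain ⟨ι, u, v, h⟩ := hA
  have key : ∀ D : E →L[ℂ] E, opTrace (A ∘L D) = ∑' i, ⟪v i, D (u i)⟫_ℂ := fun D => by
    rw [(h.comp_right D).opTrace_eq]
    exact tsum_congr fun i => ContinuousLinearMap.adjoint_inner_left _ _ _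
  simp only [key]
  refine tendsto_tsum_of_dominated_convergence (h.summable.mul_left C) (fun i => ?_)
    (Eventually.of_forall fun n i => ?_)
  · exact tendsto_const_nhds.inner (hB _)
  · calc ‖⟪v i, Bn n (u i)⟫_ℂ‖ ≤ ‖v i‖ * (‖Bn n‖ * ‖u i‖) :=
        (norm_inner_le_norm _ _).trans (by gcongr; exact ContinuousLinearMap.le_opNorm _ _)
      _ = ‖Bn n‖ * (‖u i‖ * ‖v i‖) := by ring
      _ ≤ _ := by gcongr; exact hC n

/-- The series is cut at a finite set outside which its total mass is below `1`. The bound `1` is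
what the Neumann series needs in order to invert `1 - B`. -/
theorem IsNuclear.exists_finite_add_small {T : E →L[ℂ] F} (h : IsNuclear T) :
    ∃ A B : E →L[ℂ] F, T = A + B ∧ (A : E →ₗ[ℂ] F).HasFiniteRange ∧ ‖B‖ < 1 := by
  classical
  obtain ⟨ι, u, v, h⟩ := h
  obtain ⟨s, hs⟩ := ((tendsto_order.1 (tendsto_tsum_compl_atTop_zero
    fun i => ‖u i‖ * ‖v i‖)).2 1 one_pos).exists
  let A : E →L[ℂ] F := ∑ i ∈ s, (innerSL ℂ (v i)).smulRight (u i)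
  refine ⟨A, T - A, by abel, ?_, ?_⟩
  · have : (A : E →ₗ[ℂ] F) = ∑ i ∈ s, (((innerSL ℂ (v i)).smulRight (u i) : E →L[ℂ] F) :
        E →ₗ[ℂ] F) := by simp [A]
    rw [this, ← LinearMap.mem_finiteRange_iff_hasFiniteRange]
    refine Submodule.sum_mem _ fun i _ => ?_
    rw [LinearMap.mem_finiteRange_iff_hasFiniteRange]
    refine Submodule.FG.of_le (Submodule.fg_span_singleton (u i)) ?_
    rintro _ ⟨x, rfl⟩
    exact Submodule.smul_mem _ _ (Submodule.mem_span_singleton_self _)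
  · refine lt_of_le_of_lt (ContinuousLinearMap.opNorm_le_bound _ (tsum_nonneg fun i => by positivity)
      fun x => ?_) hs
    have h1 : HasSum (fun i : {i // i ∉ s} => ⟪v i, x⟫_ℂ • u i) ((T - A) x) := by
      have := (h.hasSum x).summable.sum_add_tsum_subtype_compl s
      have h2 : (T - A) x = ∑' i : {i // i ∉ s}, ⟪v i, x⟫_ℂ • u i := by
        rw [(h.hasSum x).tsum_eq] at this
        simp [A, ← this]
      rw [h2]
      exact ((h.hasSum x).summable.subtype _).hasSum
    rw [← tsum_mul_right]
    refine h1.norm_le_of_bounded ((h.summable.subtype (fun i => i ∉ s)).mul_right _).hasSum fun i => ?_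
    simp only [Function.comp_apply]
    rw [norm_smul]
    calc _ ≤ (‖v i‖ * ‖x‖) * ‖u i‖ := by gcongr; exact norm_inner_le_norm _ _
      _ = _ := by ring

end Nuclear

/-! ### Index formula for invertibility modulo nuclear operators -/

section Fredholm

variable {E : Type*} [NormedAddCommGroup E] [InnerProductSpace ℂ E] [CompleteSpace E]

theorem nuclearRep_id_of_orthonormalBasis {n : ℕ} (b : OrthonormalBasis (Fin n) ℂ E) :
    NuclearRep (ContinuousLinearMap.id ℂ E) b b := by
  refine ⟨(hasSum_fintype _).summable, fun x => ?_⟩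
  have h : ∑ i, ⟪b i, x⟫_ℂ • b i = x := b.sum_repr' x
  have h2 := hasSum_fintype fun i => ⟪b i, x⟫_ℂ • b i
  rwa [h] at h2

theorem isNuclear_id [FiniteDimensional ℂ E] : IsNuclear (ContinuousLinearMap.id ℂ E) :=
  ⟨_, _, _, nuclearRep_id_of_orthonormalBasis (stdOrthonormalBasis ℂ E)⟩

theorem opTrace_id [FiniteDimensional ℂ E] :
    opTrace (ContinuousLinearMap.id ℂ E) = Module.finrank ℂ E := by
  rw [(nuclearRep_id_of_orthonormalBasis (stdOrthonormalBasis ℂ E)).opTrace_eq, tsum_fintype]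
  simp

/-- Factor `Q` through its range: cyclicity turns the trace into that of the identity of the range.
Self-adjointness plays no role, so oblique projections are covered. -/
theorem isNuclear_and_opTrace_of_idempotent (Q : E →L[ℂ] E) (hQ : Q ∘L Q = Q)
    [FiniteDimensional ℂ (LinearMap.range (Q : E →ₗ[ℂ] E))] :
    IsNuclear Q ∧ opTrace Q = Module.finrank ℂ (LinearMap.range (Q : E →ₗ[ℂ] E)) := by
  let V := LinearMap.range (Q : E →ₗ[ℂ] E)
  let Q' : E →L[ℂ] V := Q.codRestrict V fun x => ⟨x, rfl⟩
  have h1 : Q = V.subtypeL ∘L Q' := by ext x; rfl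
  have h2 : Q' ∘L V.subtypeL = ContinuousLinearMap.id ℂ V := by
    ext ⟨_, x, rfl⟩
    exact congr($hQ x)
  have hn : IsNuclear Q' := by simpa using (isNuclear_id (E := V)).comp_right Q'
  constructor
  · rw [h1]
    exact hn.comp_left _
  · conv_lhs => rw [h1, ← opTrace_comp_comm hn, h2]
    exact opTrace_id

/-- Neumann inverses `V`, `W` absorb the small parts of `A` and `B`. Then `V * S` is a left inverse
and `S * W` a right inverse of `T` modulo finite rank, and the left inverse serves on both sides. -/
theorem isFredholm_of_parametrix {T S A B : E →L[ℂ] E} (hA : IsNuclear A) (hB : IsNuclear B)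
    (hST : S ∘L T = ContinuousLinearMap.id ℂ E - A)
    (hTS : T ∘L S = ContinuousLinearMap.id ℂ E - B) : T.IsFredholm := by
  obtain ⟨A₀, A₁, rfl, hA₀, hA₁⟩ := hA.exists_finite_add_small
  obtain ⟨B₀, B₁, rfl, hB₀, hB₁⟩ := hB.exists_finite_add_small
  obtain ⟨V, hV⟩ := (isUnit_one_sub_of_norm_lt_one hA₁).exists_left_inv
  obtain ⟨W, hW⟩ := (isUnit_one_sub_of_norm_lt_one hB₁).exists_right_inv
  change S * T = 1 - (A₀ + A₁) at hST
  change T * S = 1 - (B₀ + B₁) at hTS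
  have h1 : V * S * T = 1 - V * A₀ := by
    rw [mul_assoc, hST, show 1 - (A₀ + A₁) = (1 - A₁) - A₀ by abel, mul_sub, hV]
  have h2 : T * S * W = 1 - B₀ * W := by
    rw [hTS, show 1 - (B₀ + B₁) = (1 - B₁) - B₀ by abel, sub_mul, hW]
  -- Inserting `1 = T * S * W + B₀ * W` on the right compares the left inverse with the right one.
  have h3 : T * (V * S) - 1 = -(B₀ * W) - T * (V * A₀) * (S * W) + (T * V * S) * (B₀ * W) := by
    have e1 : T * (V * S) = T * (V * S) * (T * S * W + B₀ * W) := by rw [h2]; simp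
    have e2 : T * (V * S) * (T * S * W) = T * (V * S * T) * (S * W) := by noncomm_ring
    have e3 : T * (1 - V * A₀) * (S * W) = T * S * W - T * (V * A₀) * (S * W) := by
      noncomm_ring
    rw [e1, mul_add, e2, h1, e3, h2]
    noncomm_ring
  have hf1 : ((V * A₀ : E →L[ℂ] E) : E →ₗ[ℂ] E).HasFiniteRange := hA₀.comp_left _
  have hf2 : ((B₀ * W : E →L[ℂ] E) : E →ₗ[ℂ] E).HasFiniteRange := hB₀.comp_right _
  refine ContinuousLinearMap.IsFredholm.of_isQuasiInverse (v := V * S) ⟨?_, ?_⟩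
  · refine LinearMap.FiniteRangeSetoid.equiv_iff_hasFiniteRange.2 ?_
    have : (((V * S : E →L[ℂ] E) : E →ₗ[ℂ] E) ∘ₗ (T : E →ₗ[ℂ] E) - LinearMap.id) =
        -((V * A₀ : E →L[ℂ] E) : E →ₗ[ℂ] E) := by
      have := congrArg (fun X : E →L[ℂ] E => (X : E →ₗ[ℂ] E)) h1
      ext x
      have := congr($h1 x)
      simp at this ⊢
      rw [this]; abel
    rw [this]
    exact hf1.neg
  · refine LinearMap.FiniteRangeSetoid.equiv_iff_hasFiniteRange.2 ?_
    have : ((T : E →ₗ[ℂ] E) ∘ₗ ((V * S : E →L[ℂ] E) : E →ₗ[ℂ] E) - LinearMap.id) =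
        -((B₀ * W : E →L[ℂ] E) : E →ₗ[ℂ] E) -
          ((T : E →L[ℂ] E) : E →ₗ[ℂ] E) ∘ₗ (((V * A₀ : E →L[ℂ] E) : E →ₗ[ℂ] E) ∘ₗ
            ((S * W : E →L[ℂ] E) : E →ₗ[ℂ] E)) +
          ((T * V * S : E →L[ℂ] E) : E →ₗ[ℂ] E) ∘ₗ ((B₀ * W : E →L[ℂ] E) : E →ₗ[ℂ] E) := by
      ext x
      have := congr($h3 x)
      simpa using this
    rw [this]
    exact (hf2.neg.sub ((hf1.comp_right _).comp_left _)).add (hf2.comp_left _)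

/-- Fedosov's formula for the index of an operator that is invertible modulo nuclear operators. -/
theorem index_of_parametrix {T S A B : E →L[ℂ] E} (hA : IsNuclear A) (hB : IsNuclear B)
    (hST : S ∘L T = ContinuousLinearMap.id ℂ E - A)
    (hTS : T ∘L S = ContinuousLinearMap.id ℂ E - B) :
    (fredholmIndex T : ℂ) = opTrace A - opTrace B := by
  have hT := isFredholm_of_parametrix hA hB hST hTS
  -- With a generalized inverse, `1 - S' * T` is an idempotent onto the kernel of `T`, and `1 - T *
  -- S'` is one whose kernel is the range of `T`. Their traces are the two dimensions in the index.
  obtain ⟨S', hS'⟩ : ∃ S' : E →L[ℂ] E, T * S' * T = T := by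
    obtain ⟨pkg⟩ := hT.nonempty_fredholmPackage
    refine ⟨pkg.quasiInverse, ?_⟩
    have hTx : ∀ x, T x = pkg.equiv (pkg.decDom.proj x) := fun x => congr($(pkg.eq_equiv) x)
    have hSx : ∀ y, pkg.quasiInverse y = pkg.equiv.symm (pkg.decCodom.proj y) := fun y => rfl
    ext x
    change T (pkg.quasiInverse (T x)) = T x
    rw [hTx (pkg.quasiInverse (T x)), hSx, hTx x]
    have hproj : ∀ z : pkg.decDom.X₁, pkg.decDom.proj (z : E) = z := fun z =>
      Submodule.projectionOnto_apply_left _ z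
    have hproj' : ∀ z : pkg.decCodom.X₁, pkg.decCodom.proj (z : E) = z := fun z =>
      Submodule.projectionOnto_apply_left _ z
    rw [hproj, hproj', ContinuousLinearEquiv.apply_symm_apply]
  change S * T = 1 - A at hST
  change T * S = 1 - B at hTS
  have hA' : A = 1 - S * T := by rw [hST]; abel
  have hB' : B = 1 - T * S := by rw [hTS]; abel
  have hkerT : LinearMap.range ((1 - S' * T : E →L[ℂ] E) : E →ₗ[ℂ] E) =
      LinearMap.ker (T : E →ₗ[ℂ] E) := by
    ext x
    constructor
    · rintro ⟨y, rfl⟩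
      have := congr($hS' y)
      simp at this
      simp [this]
    · intro hx
      have hx : T x = 0 := hx
      exact ⟨x, by simp [hx]⟩
  have hranT : LinearMap.ker ((1 - T * S' : E →L[ℂ] E) : E →ₗ[ℂ] E) =
      LinearMap.range (T : E →ₗ[ℂ] E) := by
    ext x
    constructor
    · intro hx
      refine ⟨S' x, ?_⟩
      have hx : x - T (S' x) = 0 := hx
      exact (sub_eq_zero.1 hx).symm
    · rintro ⟨y, rfl⟩
      have := congr($hS' y)
      simp at this
      simp [this]
  have hi1 : (1 - S' * T) * (1 - S' * T) = 1 - S' * T := by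
    have : S' * T * (S' * T) = S' * T := by rw [mul_assoc, ← mul_assoc T, hS']
    rw [mul_sub, sub_mul, sub_mul, this]; simp
  have hi2 : (1 - T * S') * (1 - T * S') = 1 - T * S' := by
    have : T * S' * (T * S') = T * S' := by rw [← mul_assoc, hS']
    rw [mul_sub, sub_mul, sub_mul, this]; simp
  have hfd1 : FiniteDimensional ℂ (LinearMap.range ((1 - S' * T : E →L[ℂ] E) : E →ₗ[ℂ] E)) := by
    rw [hkerT]
    exact hT.finite_ker
  have hfq : FiniteDimensional ℂ (E ⧸ LinearMap.range (T : E →ₗ[ℂ] E)) := hT.finite_coker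
  have hq : (E ⧸ LinearMap.ker ((1 - T * S' : E →L[ℂ] E) : E →ₗ[ℂ] E)) ≃ₗ[ℂ]
      LinearMap.range ((1 - T * S' : E →L[ℂ] E) : E →ₗ[ℂ] E) := LinearMap.quotKerEquivRange _
  rw [hranT] at hq
  have hfd2 : FiniteDimensional ℂ (LinearMap.range ((1 - T * S' : E →L[ℂ] E) : E →ₗ[ℂ] E)) :=
    hq.finiteDimensional
  obtain ⟨hn1, ht1⟩ := isNuclear_and_opTrace_of_idempotent _ hi1
  obtain ⟨hn2, ht2⟩ := isNuclear_and_opTrace_of_idempotent _ hi2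
  rw [fredholmIndex, LinearMap.index_eq_finrank_sub, hq.finrank_eq]
  rw [Int.cast_sub, Int.cast_natCast, Int.cast_natCast, ← ht2, ← hkerT, ← ht1]
  -- Passing from `S` to `S'` changes the two traces by those of `(S' - S) * T` and `T * (S' - S)`.
  -- These agree once `S' - S` is known to be nuclear.
  have hR : S' - S = S' * B - (1 - S' * T) * S := by
    rw [hB']; noncomm_ring
  have hRn : IsNuclear (S' - S) := by
    rw [hR]
    exact (hB.comp_left S').sub (hn1.comp_right S)
  have e1 : 1 - S' * T = A - (S' - S) * T := by rw [hA']; noncomm_ring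
  have e2 : 1 - T * S' = B - T * (S' - S) := by rw [hB']; noncomm_ring
  have e3 : opTrace (A - (S' - S) * T) = _ := opTrace_sub hA (hRn.comp_right T)
  have e4 : opTrace (B - T * (S' - S)) = _ := opTrace_sub hB (hRn.comp_left T)
  rw [e1, e2, e3, e4]
  have : opTrace ((S' - S) * T) = opTrace (T * (S' - S)) := opTrace_comp_comm hRn T
  rw [this]; ring

/-- The Toeplitz operator `P U P` of a unitary `U` whose commutator with the projection `P` is
nuclear. -/
theorem compression_fredholm {P U U' : E →L[ℂ] E} (hP : P * P = P) (h1 : U' * U = 1)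
    (h2 : U * U' = 1) (hC : IsNuclear (opComm U P)) :
    (compression P U).IsFredholm ∧
      (fredholmIndex (compression P U) : ℂ) = opTrace (U' ∘L opComm U P) := by
  set V := LinearMap.range (P : E →ₗ[ℂ] E) with hV
  have hmem : ∀ x ∈ V, P x = x := by
    rintro _ ⟨x, rfl⟩
    exact congr($hP x)
  have hclosed : IsClosed (V : Set E) := by
    have : (V : Set E) = {x | P x = x} := by
      ext x
      exact ⟨hmem x, fun h => ⟨x, h⟩⟩
    rw [this]
    exact isClosed_eq P.continuous continuous_id
  have : CompleteSpace V := hclosed.completeSpace_coe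
  let π : E →L[ℂ] V := P.codRestrict V fun x => ⟨x, rfl⟩
  have hιπ : V.subtypeL ∘L π = P := rfl
  have hπ : ∀ x, ((π x : V) : E) = P x := fun x => rfl
  have hPP : ∀ x, P (P x) = P x := fun x => congr($hP x)
  have hU1 : ∀ x, U' (U x) = x := fun x => congr($h1 x)
  have hU2 : ∀ x, U (U' x) = x := fun x => congr($h2 x)
  -- The off-diagonal blocks `N₁ = (1 - P) U P` and `N₂ = -P U (1 - P)` measure how far the
  -- compressions of `U` and `U'` are from being mutually inverse, and their sum is the whole
  -- commutator `[U, P]`.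
  set N₁ : E →L[ℂ] E := (1 - P) ∘L opComm U P ∘L P with hN₁
  set N₂ : E →L[ℂ] E := P ∘L opComm U P ∘L (1 - P) with hN₂
  have hn₁ : IsNuclear N₁ := (hC.comp_right P).comp_left _
  have hn₂ : IsNuclear N₂ := (hC.comp_right _).comp_left _
  have hA : IsNuclear (π ∘L (U' ∘L N₁) ∘L V.subtypeL) :=
    ((hn₁.comp_left U').comp_right _).comp_left _
  have hB : IsNuclear (-(π ∘L (N₂ ∘L U') ∘L V.subtypeL)) :=
    (((hn₂.comp_right U').comp_right _).comp_left _).neg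
  have hST : (compression P U') ∘L (compression P U) =
      ContinuousLinearMap.id ℂ V - π ∘L (U' ∘L N₁) ∘L V.subtypeL := by
    ext x
    have hx := hmem x x.2
    change P (U' (P (U x))) = x - P (U' ((1 - P) (U (P (P x)) - P (U (P x)))))
    simp [hx, hPP, hU1]
  have hTS : (compression P U) ∘L (compression P U') =
      ContinuousLinearMap.id ℂ V - -(π ∘L (N₂ ∘L U') ∘L V.subtypeL) := by
    ext x
    have hx := hmem x x.2
    change P (U (P (U' x))) = x - -P (P (U (P ((1 - P) (U' x))) - P (U ((1 - P) (U' x)))))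
    simp [hx, hPP, hU2]
  refine ⟨isFredholm_of_parametrix hA hB hST hTS, ?_⟩
  rw [index_of_parametrix hA hB hST hTS]
  have t1 : opTrace (π ∘L (U' ∘L N₁) ∘L V.subtypeL) = opTrace (U' ∘L N₁) := by
    rw [← opTrace_comp_comm ((hn₁.comp_left U').comp_right V.subtypeL),
      ContinuousLinearMap.comp_assoc, hιπ]
    congr 1
    ext x
    simp [hN₁, hPP]
  have t2 : opTrace (-(π ∘L (N₂ ∘L U') ∘L V.subtypeL)) = -opTrace (U' ∘L N₂) := by
    have h3 := opTrace_smul (((hn₂.comp_right U').comp_right V.subtypeL).comp_left π) (-1)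
    rw [neg_one_smul] at h3
    rw [h3, ← opTrace_comp_comm ((hn₂.comp_right U').comp_right V.subtypeL),
      ContinuousLinearMap.comp_assoc, hιπ, ContinuousLinearMap.comp_assoc,
      opTrace_comp_comm hn₂, neg_one_mul]
    congr 2
    ext x
    simp [hN₂, hPP]
  rw [t1, t2, sub_neg_eq_add, ← opTrace_add (hn₁.comp_left U') (hn₂.comp_left U')]
  congr 1
  ext x
  simp [hN₁, hN₂, opComm, hPP]

end Fredholm

/-! ### Resolvents of self-adjoint operators -/

section Resolvent

variable {E : Type*} [NormedAddCommGroup E] [InnerProductSpace ℂ E] [CompleteSpace E]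
  {H : E →ₗ.[ℂ] E}

theorem inner_apply_symm (hH : IsSelfAdjoint H) (x y : H.domain) :
    ⟪H x, (y : E)⟫_ℂ = ⟪(x : E), H y⟫_ℂ := by
  have h := LinearPMap.adjoint_isFormalAdjoint hH.dense_domain
  rw [LinearPMap.isSelfAdjoint_def.1 hH] at h
  exact h x y

/-- The cross term has no real part, since `⟪H u, u⟫` is real and `z` is imaginary. The hypotheses
on `z` treat `i` and `-i` together. -/
theorem norm_sub_smul_sq (hH : IsSelfAdjoint H) {z : ℂ} (hz : (starRingEnd ℂ) z = -z)
    (hz1 : ‖z‖ = 1) (u : H.domain) : ‖H u - z • (u : E)‖ ^ 2 = ‖H u‖ ^ 2 + ‖(u : E)‖ ^ 2 := by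
  have h1 : (⟪H u, z • (u : E)⟫_ℂ).re = 0 := by
    have h2 : (starRingEnd ℂ) ⟪H u, z • (u : E)⟫_ℂ = -⟪H u, z • (u : E)⟫_ℂ := by
      rw [inner_smul_right, map_mul, inner_conj_symm, ← inner_apply_symm hH, hz]
      ring
    have h3 := congrArg Complex.re h2
    simp only [Complex.conj_re, Complex.neg_re] at h3
    linarith
  have := norm_sub_sq (𝕜 := ℂ) (H u) (z • (u : E))
  rw [this, norm_smul, hz1]
  simp only [RCLike.re_to_complex, h1]
  ring

/-- On the complete graph of `H`, the map `H - z` is bounded below by the norm identity, hence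
injective with closed range. A vector orthogonal to the range is an eigenvector of the adjoint,
which is `H`, for the conjugate of `z`, and the same identity forces it to vanish. -/
theorem exists_isResolventAt (hH : IsSelfAdjoint H) {z : ℂ} (hz : (starRingEnd ℂ) z = -z)
    (hz1 : ‖z‖ = 1) : ∃ R, IsResolventAt H z R := by
  have hcl : IsClosed (H.graph : Set (E × E)) := hH.isClosed
  have : CompleteSpace H.graph := hcl.completeSpace_coe
  let L : H.graph →L[ℂ] E :=
    (ContinuousLinearMap.snd ℂ E E - z • ContinuousLinearMap.fst ℂ E E) ∘L H.graph.subtypeL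
  have hL : ∀ p : H.graph, ∃ u : H.domain, (p : E × E) = ((u : E), H u) := by
    rintro ⟨p, hp⟩
    obtain ⟨u, hu⟩ := H.mem_graph_iff'.1 hp
    exact ⟨u, hu.symm⟩
  have hbd : ∀ p : H.graph, ‖p‖ ≤ (1 : NNReal) * ‖L p‖ := by
    intro p
    obtain ⟨u, hu⟩ := hL p
    have h1 : L p = H u - z • (u : E) := by
      change (p : E × E).2 - z • (p : E × E).1 = _
      rw [hu]
    have h2 := norm_sub_smul_sq hH hz hz1 u
    rw [NNReal.coe_one, one_mul, h1]
    change ‖(p : E × E)‖ ≤ _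
    rw [hu, Prod.norm_def]
    refine max_le ?_ ?_ <;> refine le_of_sq_le_sq ?_ (norm_nonneg _) <;> nlinarith [sq_nonneg ‖H u‖, sq_nonneg ‖(u : E)‖]
  have hanti : AntilipschitzWith 1 L := ContinuousLinearMap.antilipschitz_of_bound L hbd
  have hker : LinearMap.ker (L : H.graph →ₗ[ℂ] E) = ⊥ := LinearMap.ker_eq_bot.2 hanti.injective
  have hran_cl : IsClosed (LinearMap.range (L : H.graph →ₗ[ℂ] E) : Set E) := by
    have := hanti.isClosed_range L.uniformContinuous
    rwa [← ContinuousLinearMap.coe_coe L, ← LinearMap.coe_range] at this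
  have hran : LinearMap.range (L : H.graph →ₗ[ℂ] E) = ⊤ := by
    have : CompleteSpace (LinearMap.range (L : H.graph →ₗ[ℂ] E)) := hran_cl.completeSpace_coe
    rw [← Submodule.orthogonal_eq_bot_iff, Submodule.eq_bot_iff]
    intro v hv
    have h0 : ∀ u : H.domain, ⟪H u - z • (u : E), v⟫_ℂ = 0 := fun u =>
      hv _ ⟨⟨((u : E), H u), H.mem_graph u⟩, rfl⟩
    have h1 : ∀ u : H.domain, ⟪(starRingEnd ℂ) z • v, (u : E)⟫_ℂ = ⟪v, H u⟫_ℂ := by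
      intro u
      have := h0 u
      rw [← inner_eq_zero_symm, inner_sub_right, sub_eq_zero, inner_smul_right] at this
      rw [inner_smul_left, Complex.conj_conj, this]
    have hv1 := LinearPMap.mem_adjoint_domain_of_exists v ⟨_, h1⟩
    have hv2 := LinearPMap.adjoint_apply_eq hH.dense_domain ⟨v, hv1⟩ h1
    have hv3 : ∃ w : H.domain, (w : E) = v ∧ H w = (starRingEnd ℂ) z • v := by
      have key : ∀ A : E →ₗ.[ℂ] E, A = H → ∀ h : v ∈ A.domain, A ⟨v, h⟩ = (starRingEnd ℂ) z • v →
          ∃ w : H.domain, (w : E) = v ∧ H w = (starRingEnd ℂ) z • v := by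
        rintro A rfl h h'
        exact ⟨⟨v, h⟩, rfl, h'⟩
      exact key _ (LinearPMap.isSelfAdjoint_def.1 hH) hv1 hv2
    obtain ⟨w, rfl, hw⟩ := hv3
    have h4 := norm_sub_smul_sq hH (z := (starRingEnd ℂ) z) (by rw [Complex.conj_conj, hz, neg_neg])
      (by simpa using hz1) w
    rw [hw, sub_self, norm_zero] at h4
    have : ‖(w : E)‖ ^ 2 = 0 := by nlinarith [sq_nonneg ‖(starRingEnd ℂ) z • (w : E)‖, sq_nonneg ‖(w : E)‖]
    simpa using this
  let e := ContinuousLinearEquiv.ofBijective L hker hran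
  have he : ∀ p, e p = L p := fun p => rfl
  refine ⟨ContinuousLinearMap.fst ℂ E E ∘L H.graph.subtypeL ∘L (e.symm : E →L[ℂ] H.graph), ?_, ?_⟩
  · intro v
    obtain ⟨u, hu⟩ := hL (e.symm v)
    have h1 : ((e.symm v : H.graph) : E × E).1 = u := by rw [hu]
    have h2 : L (e.symm v) = v := by rw [← he]; exact e.apply_symm_apply v
    have h3 : L (e.symm v) = H u - z • (u : E) := by
      change ((e.symm v : H.graph) : E × E).2 - z • ((e.symm v : H.graph) : E × E).1 = _
      rw [hu]
    refine ⟨?_, ?_⟩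
    · change ((e.symm v : H.graph) : E × E).1 ∈ _
      rw [h1]; exact u.2
    · have h4 : ∀ (x : E) (hx : x ∈ H.domain), x = u → H ⟨x, hx⟩ - z • x = v := by
        rintro x hx rfl
        exact h3.symm.trans h2
      exact h4 _ _ h1
  · intro u
    have h1 : e ⟨((u : E), H u), H.mem_graph u⟩ = H u - z • (u : E) := rfl
    change ((e.symm (H u - z • (u : E)) : H.graph) : E × E).1 = u
    rw [← h1, e.symm_apply_apply]

theorem isResolventAt_resolventAt (hH : IsSelfAdjoint H) {z : ℂ} (hz : (starRingEnd ℂ) z = -z)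
    (hz1 : ‖z‖ = 1) : IsResolventAt H z (resolventAt H z) := by
  have h := exists_isResolventAt hH hz hz1
  rw [resolventAt, dif_pos h]
  exact h.choose_spec

theorem isResolventAt_neg_I (hH : IsSelfAdjoint H) :
    IsResolventAt H (-Complex.I) (resolventAt H (-Complex.I)) :=
  isResolventAt_resolventAt hH (by simp) (by simp)

theorem isResolventAt_I (hH : IsSelfAdjoint H) :
    IsResolventAt H Complex.I (resolventAt H Complex.I) :=
  isResolventAt_resolventAt hH (by simp) (by simp)

theorem adjoint_resolventAt (hH : IsSelfAdjoint H) :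
    ContinuousLinearMap.adjoint (resolventAt H (-Complex.I)) = resolventAt H Complex.I := by
  refine (ContinuousLinearMap.eq_adjoint_iff _ _).2 (fun y x => ?_) |>.symm
  obtain ⟨h1, h2⟩ := (isResolventAt_neg_I hH).1 x
  obtain ⟨h3, h4⟩ := (isResolventAt_I hH).1 y
  have h5 := inner_apply_symm hH ⟨_, h3⟩ ⟨_, h1⟩
  conv_rhs => rw [← h4]
  conv_lhs => rw [← h2]
  rw [inner_sub_left, inner_sub_right, h5]
  simp [inner_smul_left, inner_smul_right]

theorem resolvent_sub (hH : IsSelfAdjoint H) :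
    resolventAt H (-Complex.I) - resolventAt H Complex.I =
      (-2 * Complex.I) • (resolventAt H Complex.I * resolventAt H (-Complex.I)) := by
  ext x
  obtain ⟨h1, h2⟩ := (isResolventAt_neg_I hH).1 x
  have h3 := (isResolventAt_I hH).2 ⟨_, h1⟩
  have h4 : H ⟨_, h1⟩ = x + (-Complex.I) • resolventAt H (-Complex.I) x := sub_eq_iff_eq_add.1 h2
  simp only [h4] at h3
  simp only [map_sub, map_add, map_smul] at h3
  change resolventAt H (-Complex.I) x - resolventAt H Complex.I x =
    (-2 * Complex.I) • (resolventAt H Complex.I (resolventAt H (-Complex.I) x))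
  conv_lhs => rw [← h3]
  module

theorem resolvent_sub' (hH : IsSelfAdjoint H) :
    resolventAt H (-Complex.I) - resolventAt H Complex.I =
      (-2 * Complex.I) • (resolventAt H (-Complex.I) * resolventAt H Complex.I) := by
  ext x
  obtain ⟨h1, h2⟩ := (isResolventAt_I hH).1 x
  have h3 := (isResolventAt_neg_I hH).2 ⟨_, h1⟩
  have h4 : H ⟨_, h1⟩ = x + Complex.I • resolventAt H Complex.I x := sub_eq_iff_eq_add.1 h2
  simp only [h4] at h3
  simp only [map_sub, map_add, map_smul] at h3
  change resolventAt H (-Complex.I) x - resolventAt H Complex.I x =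
    (-2 * Complex.I) • (resolventAt H (-Complex.I) (resolventAt H Complex.I x))
  conv_lhs => rw [← h3]
  module

theorem isStarNormal_resolvent (hH : IsSelfAdjoint H) :
    IsStarNormal (resolventAt H (-Complex.I)) := by
  refine ⟨?_⟩
  rw [ContinuousLinearMap.star_eq_adjoint, adjoint_resolventAt hH]
  have h : (-2 * Complex.I) ≠ 0 := by simp
  have := (resolvent_sub hH).symm.trans (resolvent_sub' hH)
  exact smul_right_injective _ h this

/-- The resolvent identity `R - R* = -2i R* R` passes to the spectrum as `w - w̄ = -2i |w|²`. This
is the circle on which `1/w - i` is real. -/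
theorem spectrum_resolvent (hH : IsSelfAdjoint H) {w : ℂ}
    (hw : w ∈ spectrum ℂ (resolventAt H (-Complex.I))) (hw0 : w ≠ 0) :
    (w⁻¹ - Complex.I).im = 0 := by
  set R := resolventAt H (-Complex.I) with hR
  have hn : IsStarNormal R := isStarNormal_resolvent hH
  have h1 : cfc (fun z : ℂ => z - star z) R = R - star R := by
    rw [cfc_sub (fun z : ℂ => z) (fun z => star z) R, cfc_id' ℂ R, cfc_star_id (R := ℂ) (a := R)]
  have h2 : cfc (fun z : ℂ => (-2 * Complex.I) * (star z * z)) R =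
      (-2 * Complex.I) • (star R * R) := by
    rw [cfc_const_mul _ (fun z : ℂ => star z * z) R, cfc_mul (fun z : ℂ => star z) (fun z => z) R,
      cfc_id' ℂ R, cfc_star_id (R := ℂ) (a := R)]
  have h3 : R - star R = (-2 * Complex.I) • (star R * R) := by
    rw [ContinuousLinearMap.star_eq_adjoint, hR, adjoint_resolventAt hH]
    exact resolvent_sub hH
  have h4 := eqOn_of_cfc_eq_cfc (h1.trans (h3.trans h2.symm)) (by fun_prop) (by fun_prop) hn hw
  have h5 := congrArg Complex.im h4
  have hns : Complex.normSq w ≠ 0 := by simpa using hw0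
  simp at h5
  simp only [Complex.sub_im, Complex.inv_im, Complex.I_im]
  rw [Complex.normSq_apply] at hns ⊢
  rw [sub_eq_zero, div_eq_one_iff_eq hns]
  linarith

end Resolvent

/-! ### Functional calculus on functions that are eventually constant -/

section Calculus

variable {E : Type*} [NormedAddCommGroup E] [InnerProductSpace ℂ E] [CompleteSpace E]
  {H : E →ₗ.[ℂ] E}

/-- Continuous functions that are equal to the constant `c` near `±∞`. -/
structure EventuallyConst (f : ℝ → ℂ) (c : ℂ) : Prop where
  continuous : Continuous f
  eventually : ∀ᶠ t in cocompact ℝ, f t = c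

theorem EventuallyConst.limUnder_eq {f : ℝ → ℂ} {c : ℂ} (hf : EventuallyConst f c) :
    limUnder (cocompact ℝ) f = c :=
  (tendsto_const_nhds.congr' (hf.eventually.mono fun _ h => h.symm)).limUnder_eq

theorem EventuallyConst.of_hasCompactSupport {f : ℝ → ℂ} (hf : Continuous f)
    (h : HasCompactSupport f) : EventuallyConst f 0 := by
  refine ⟨hf, ?_⟩
  filter_upwards [h.isCompact.compl_mem_cocompact] with t ht
  exact image_eq_zero_of_notMem_tsupport ht

theorem EventuallyConst.const (c : ℂ) : EventuallyConst (fun _ => c) c :=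
  ⟨continuous_const, Eventually.of_forall fun _ => rfl⟩

theorem EventuallyConst.mul {f g : ℝ → ℂ} {c d : ℂ} (hf : EventuallyConst f c)
    (hg : EventuallyConst g d) : EventuallyConst (fun t => f t * g t) (c * d) := by
  refine ⟨hf.continuous.mul hg.continuous, ?_⟩
  filter_upwards [hf.eventually, hg.eventually] with t h1 h2
  rw [h1, h2]

theorem EventuallyConst.add {f g : ℝ → ℂ} {c d : ℂ} (hf : EventuallyConst f c)
    (hg : EventuallyConst g d) : EventuallyConst (fun t => f t + g t) (c + d) := by
  refine ⟨hf.continuous.add hg.continuous, ?_⟩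
  filter_upwards [hf.eventually, hg.eventually] with t h1 h2
  rw [h1, h2]

theorem EventuallyConst.star {f : ℝ → ℂ} {c : ℂ} (hf : EventuallyConst f c) :
    EventuallyConst (fun t => star (f t)) (star c) := by
  refine ⟨hf.continuous.star, ?_⟩
  filter_upwards [hf.eventually] with t h1
  rw [h1]

open Classical in
/-- The function of `w = 1 / (t + i)` that corresponds to `f(t)`, with value `c` at `w = 0`. -/
noncomputable def cayleyFun (f : ℝ → ℂ) (c : ℂ) (w : ℂ) : ℂ := if w = 0 then c else f (w⁻¹ - Complex.I).re

theorem funCalc_eq {f : ℝ → ℂ} {c : ℂ} (hf : EventuallyConst f c) :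
    funCalc H f = cfc (cayleyFun f c) (resolventAt H (-Complex.I)) := by
  rw [funCalc, hf.limUnder_eq]
  rfl

theorem continuousOn_cayleyFun (hH : IsSelfAdjoint H) {f : ℝ → ℂ} {c : ℂ}
    (hf : EventuallyConst f c) :
    ContinuousOn (cayleyFun f c) (spectrum ℂ (resolventAt H (-Complex.I))) := by
  intro w hw
  by_cases hw0 : w = 0
  · subst hw0
    obtain ⟨M, hM⟩ : ∃ M : ℝ, ∀ t : ℝ, M < |t| → f t = c := by
      have h := hf.eventually
      rw [← Metric.cobounded_eq_cocompact, ← comap_norm_atTop, eventually_comap] at h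
      obtain ⟨M, hM⟩ := h.exists_forall_of_atTop
      exact ⟨M, fun t ht => hM |t| ht.le t rfl⟩
    have hev : ∀ᶠ z in 𝓝[spectrum ℂ (resolventAt H (-Complex.I))] (0 : ℂ),
        cayleyFun f c z = c := by
      -- On the spectrum `1/z = t + i` with `t` real, so `|t| ≥ ‖1/z‖ - 1 > |M| + 1`: points near
      -- `0` correspond to energies where `f` already equals `c`.
      have hball : ∀ᶠ z in 𝓝 (0 : ℂ), ‖z‖ < (|M| + 2)⁻¹ := by
        have := Metric.ball_mem_nhds (0 : ℂ) (show 0 < (|M| + 2)⁻¹ by positivity)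
        filter_upwards [this] with z hz
        simpa using hz
      filter_upwards [nhdsWithin_le_nhds hball, self_mem_nhdsWithin] with z hz hzs
      rw [cayleyFun]
      split_ifs with hz0
      · rfl
      · apply hM
        have h1 := spectrum_resolvent hH hzs hz0
        have h2 : z⁻¹ = ((z⁻¹ - Complex.I).re : ℂ) + Complex.I := by
          apply Complex.ext
          · simp
          · simp only [Complex.sub_im, Complex.I_im] at h1
            simp; simp at h1; linarith
        have h3 : |M| + 2 < ‖z⁻¹‖ := by
          rw [norm_inv]
          exact (lt_inv_comm₀ (by positivity) (by simpa using hz0)).2 hz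
        have h4 : ‖z⁻¹‖ ≤ |(z⁻¹ - Complex.I).re| + 1 := by
          conv_lhs => rw [h2]
          refine (norm_add_le _ _).trans ?_
          rw [Complex.norm_real, Complex.norm_I, Real.norm_eq_abs]
        have := le_abs_self M
        linarith
    have h0 : cayleyFun f c 0 = c := by simp [cayleyFun]
    rw [ContinuousWithinAt, h0]
    exact tendsto_const_nhds.congr' (hev.mono fun _ h => h.symm)
  · refine ContinuousAt.continuousWithinAt ?_
    have h1 : cayleyFun f c =ᶠ[𝓝 w] fun z => f (z⁻¹ - Complex.I).re := by
      filter_upwards [isOpen_ne.mem_nhds hw0] with z hz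
      rw [cayleyFun, if_neg hz]
    rw [continuousAt_congr h1]
    have h2 : ContinuousAt (fun z : ℂ => (z⁻¹ - Complex.I).re) w :=
      Complex.continuous_re.continuousAt.comp ((continuousAt_inv₀ hw0).sub continuousAt_const)
    exact hf.continuous.continuousAt.comp h2

theorem funCalc_mul (hH : IsSelfAdjoint H) {f g : ℝ → ℂ} {c d : ℂ} (hf : EventuallyConst f c)
    (hg : EventuallyConst g d) : funCalc H (fun t => f t * g t) = funCalc H f * funCalc H g := by
  have hn := isStarNormal_resolvent hH
  rw [funCalc_eq (hf.mul hg), funCalc_eq hf, funCalc_eq hg,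
    ← cfc_mul _ _ _ (continuousOn_cayleyFun hH hf) (continuousOn_cayleyFun hH hg)]
  congr 1
  ext w
  simp only [cayleyFun]
  split_ifs <;> rfl

theorem funCalc_add (hH : IsSelfAdjoint H) {f g : ℝ → ℂ} {c d : ℂ} (hf : EventuallyConst f c)
    (hg : EventuallyConst g d) : funCalc H (fun t => f t + g t) = funCalc H f + funCalc H g := by
  have hn := isStarNormal_resolvent hH
  rw [funCalc_eq (hf.add hg), funCalc_eq hf, funCalc_eq hg,
    ← cfc_add _ _ _ (continuousOn_cayleyFun hH hf) (continuousOn_cayleyFun hH hg)]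
  congr 1
  ext w
  simp only [cayleyFun]
  split_ifs <;> rfl

theorem funCalc_const (hH : IsSelfAdjoint H) (c : ℂ) :
    funCalc H (fun _ => c) = c • (1 : E →L[ℂ] E) := by
  have hn := isStarNormal_resolvent hH
  rw [funCalc_eq (EventuallyConst.const c), ← Algebra.algebraMap_eq_smul_one,
    ← cfc_const c (resolventAt H (-Complex.I))]
  congr 1
  ext w
  simp [cayleyFun]

theorem funCalc_star {f : ℝ → ℂ} {c : ℂ} (hf : EventuallyConst f c) :
    funCalc H (fun t => star (f t)) = ContinuousLinearMap.adjoint (funCalc H f) := by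
  rw [funCalc_eq hf.star, funCalc_eq hf, ← ContinuousLinearMap.star_eq_adjoint, ← cfc_star]
  congr 1
  ext w
  simp only [cayleyFun]
  split_ifs <;> rfl

/-- On the spectrum this is `w (t + i) = 1`. The resolvent on the left places the range of `f(H)` in
the domain of `H`. -/
theorem funCalc_eq_resolvent_mul (hH : IsSelfAdjoint H) {f : ℝ → ℂ} (hf : Continuous f)
    (hfc : HasCompactSupport f) :
    funCalc H f = resolventAt H (-Complex.I) * (funCalc H (fun t => (t : ℂ) * f t) +
      Complex.I • funCalc H f) := by
  have hn := isStarNormal_resolvent hH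
  have h0 := EventuallyConst.of_hasCompactSupport hf hfc
  have h1 : EventuallyConst (fun t : ℝ => (t : ℂ) * f t) 0 :=
    EventuallyConst.of_hasCompactSupport (Complex.continuous_ofReal.mul hf) hfc.mul_left
  have h2 := (EventuallyConst.const Complex.I).mul h0
  have h3 : funCalc H (fun t => (t : ℂ) * f t) + Complex.I • funCalc H f =
      funCalc H (fun t => (t : ℂ) * f t + Complex.I * f t) := by
    rw [funCalc_add hH h1 h2, funCalc_mul hH (EventuallyConst.const _) h0, funCalc_const hH,
      smul_mul_assoc, one_mul]
  have h4 := h1.add h2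
  rw [h3, funCalc_eq h4, funCalc_eq h0]
  conv_rhs => enter [1]; rw [← cfc_id' ℂ (resolventAt H (-Complex.I))]
  rw [← cfc_mul (fun z : ℂ => z) _ _ continuousOn_id (continuousOn_cayleyFun hH h4)]
  refine cfc_congr fun w hw => ?_
  simp only [cayleyFun]
  split_ifs with hw0
  · simp
  · have h5 := spectrum_resolvent hH hw hw0
    have h6 : w⁻¹ = ((w⁻¹ - Complex.I).re : ℂ) + Complex.I := by
      apply Complex.ext
      · simp
      · simp only [Complex.sub_im, Complex.I_im] at h5
        simp; simp at h5; linarith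
    rw [← add_mul, ← h6, ← mul_assoc, mul_inv_cancel₀ hw0, one_mul]

theorem funCalc_commute (hH : IsSelfAdjoint H) {f g : ℝ → ℂ} {c d : ℂ} (hf : EventuallyConst f c)
    (hg : EventuallyConst g d) : funCalc H f * funCalc H g = funCalc H g * funCalc H f := by
  rw [← funCalc_mul hH hf hg, ← funCalc_mul hH hg hf]
  simp_rw [mul_comm]

theorem apply_funCalc (hH : IsSelfAdjoint H) {f : ℝ → ℂ} (hf : Continuous f)
    (hfc : HasCompactSupport f) (v : E) :
    ∃ h : funCalc H f v ∈ H.domain,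
      H ⟨funCalc H f v, h⟩ = funCalc H (fun t => (t : ℂ) * f t) v := by
  set y := funCalc H (fun t => (t : ℂ) * f t) v + Complex.I • funCalc H f v with hy
  have h1 : funCalc H f v = resolventAt H (-Complex.I) y :=
    congr($(funCalc_eq_resolvent_mul hH hf hfc) v)
  obtain ⟨h2, h3⟩ := (isResolventAt_neg_I hH).1 y
  have h4 : ∀ x (hx : x = resolventAt H (-Complex.I) y), ∃ h : x ∈ H.domain,
      H ⟨x, h⟩ + Complex.I • x = y := by
    rintro x rfl
    refine ⟨h2, ?_⟩
    have h3' := h3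
    rwa [neg_smul, sub_neg_eq_add] at h3'
  obtain ⟨h5, h6⟩ := h4 _ h1
  refine ⟨h5, ?_⟩
  rw [hy] at h6
  exact add_right_cancel h6

/-- The resolvent is injective and commutes with `f(H)`, so the identity may be checked after
applying it. -/
theorem funCalc_apply (hH : IsSelfAdjoint H) {f : ℝ → ℂ} (hf : Continuous f)
    (hfc : HasCompactSupport f) (u : H.domain) :
    funCalc H f (H u) = funCalc H (fun t => (t : ℂ) * f t) u := by
  have h1 : EventuallyConst (fun t : ℝ => (t : ℂ) * f t) 0 :=
    EventuallyConst.of_hasCompactSupport (Complex.continuous_ofReal.mul hf) hfc.mul_left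
  have h0 := EventuallyConst.of_hasCompactSupport hf hfc
  have hcomm : ∀ x, funCalc H f (resolventAt H (-Complex.I) x) =
      resolventAt H (-Complex.I) (funCalc H f x) := by
    intro x
    have hn := isStarNormal_resolvent hH
    have := cfc_commute_cfc (cayleyFun f 0) (fun z : ℂ => z) (resolventAt H (-Complex.I))
    rw [cfc_id' ℂ (resolventAt H (-Complex.I)), ← funCalc_eq h0] at this
    exact congr($(this.eq) x)
  set v := H u + Complex.I • (u : E) with hv
  have hu : resolventAt H (-Complex.I) v = u := by
    have := (isResolventAt_neg_I hH).2 u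
    simpa [hv] using this
  have h2 : funCalc H f u = resolventAt H (-Complex.I)
      (funCalc H (fun t => (t : ℂ) * f t) u + Complex.I • funCalc H f u) :=
    congr($(funCalc_eq_resolvent_mul hH hf hfc) u)
  have hinj : Function.Injective (resolventAt H (-Complex.I)) := by
    rw [injective_iff_map_eq_zero]
    intro x hx
    obtain ⟨h3, h4⟩ := (isResolventAt_neg_I hH).1 x
    have h5 : (⟨resolventAt H (-Complex.I) x, h3⟩ : H.domain) = 0 := Subtype.ext hx
    rw [h5, hx] at h4
    simpa using h4.symm
  have h3 : funCalc H f v = funCalc H (fun t => (t : ℂ) * f t) u + Complex.I • funCalc H f u := by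
    apply hinj
    rw [← hcomm, hu, ← h2]
  rw [hv, map_add, map_smul] at h3
  exact add_right_cancel h3

end Calculus

/-! ### Fourier transform of compactly supported square-integrable functions -/

section Fourier

variable {K : Type*} [NormedAddCommGroup K] [InnerProductSpace ℂ K] [CompleteSpace K]

theorem continuous_neg_inner_real : Continuous fun p : ℝ × ℝ => (-innerₗ ℝ) p.1 p.2 := by
  have : Continuous fun p : ℝ × ℝ => -(p.2 * p.1) := by fun_prop
  simpa using this

theorem continuous_fourierInv_of_integrable {g : ℝ → K} (hg : Integrable g) :
    Continuous (𝓕⁻ g) := by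
  have := VectorFourier.fourierIntegral_continuous (L := -innerₗ ℝ) (μ := volume)
    (e := Real.fourierChar) Real.continuous_fourierChar continuous_neg_inner_real hg
  convert this using 1
  ext x
  simp [Real.fourierInv_eq, VectorFourier.fourierIntegral]

theorem integral_fourierInv_smul_eq_of_integrable {g : ℝ → K} (hg : Integrable g)
    (ψ : SchwartzMap ℝ ℂ) : ∫ x, 𝓕⁻ (ψ : ℝ → ℂ) x • g x = ∫ x, ψ x • 𝓕⁻ g x := by
  have h := VectorFourier.integral_fourierIntegral_smul_eq_flip (L := -innerₗ ℝ) (μ := volume)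
    (ν := volume) (e := Real.fourierChar) Real.continuous_fourierChar
    continuous_neg_inner_real (f := (ψ : ℝ → ℂ)) ψ.integrable hg
  convert h using 1
  · refine integral_congr_ae (Eventually.of_forall fun x => ?_)
    simp [Real.fourierInv_eq, VectorFourier.fourierIntegral]
  · refine integral_congr_ae (Eventually.of_forall fun x => ?_)
    simp [Real.fourierInv_eq, VectorFourier.fourierIntegral, mul_comm]

/-- The abstract `L²` transform must be identified with the integral formula in order to have
kernels with pointwise values. Both have the same pairings with smooth compactly supported
functions, through tempered distributions on one side and Fubini on the other. -/
theorem fourierInv_toLp_ae {g : ℝ → K} (h2 : MemLp g 2 volume) (h1 : Integrable g) :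
    ((𝓕⁻ (h2.toLp g) : L2 K) : ℝ → K) =ᵐ[volume] 𝓕⁻ g := by
  have hcont := continuous_fourierInv_of_integrable h1
  refine ae_eq_of_integral_contDiff_smul_eq ((Lp.memLp _).locallyIntegrable one_le_two)
    hcont.locallyIntegrable fun ψ hψ hψc => ?_
  have hψ' : ContDiff ℝ ∞ (fun x => (ψ x : ℂ)) := Complex.ofRealCLM.contDiff.comp hψ
  have hψc' : HasCompactSupport (fun x => (ψ x : ℂ)) :=
    hψc.comp_left (g := fun x : ℝ => (x : ℂ)) (by simp)
  let Ψ : SchwartzMap ℝ ℂ := hψc'.toSchwartzMap hψ'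
  have hΨ : ∀ x, Ψ x = ψ x := fun x => rfl
  have e1 := congr($(Lp.fourierInv_toTemperedDistribution_eq (h2.toLp g)) Ψ)
  rw [TemperedDistribution.fourierInv_apply, Lp.toTemperedDistribution_apply,
    Lp.toTemperedDistribution_apply] at e1
  have e2 := integral_fourierInv_smul_eq_of_integrable h1 Ψ
  have e3 : ∫ x, (𝓕⁻ Ψ : SchwartzMap ℝ ℂ) x • (h2.toLp g) x = ∫ x, 𝓕⁻ (Ψ : ℝ → ℂ) x • g x := by
    refine integral_congr_ae ?_
    filter_upwards [h2.coeFn_toLp] with x hx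
    rw [hx, SchwartzMap.fourierInv_coe]
  have e4 := e1.symm.trans (e3.trans e2)
  simpa [hΨ] using e4

/-- Bounded functions that vanish outside a bounded set. -/
structure BddSupp (h : ℝ → K) : Prop where
  meas : AEStronglyMeasurable h volume
  bound : ∃ C, ∀ w, ‖h w‖ ≤ C
  supp : ∃ R, ∀ w, R < |w| → h w = 0

theorem BddSupp.memLp {h : ℝ → K} (hh : BddSupp h) (p : ℝ≥0∞) : MemLp h p volume := by
  obtain ⟨C, hC⟩ := hh.bound
  obtain ⟨R, hR⟩ := hh.supp
  have h1 : (Set.Icc (-R) R).indicator h = h := by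
    refine Set.indicator_eq_self.2 fun w hw => ?_
    by_contra hw'
    refine hw (hR w ?_)
    by_contra h3
    exact hw' (abs_le.1 (not_lt.1 h3))
  rw [← h1, memLp_indicator_iff_restrict measurableSet_Icc]
  exact MemLp.of_bound hh.meas.restrict C (Eventually.of_forall hC)

theorem BddSupp.integrable {h : ℝ → K} (hh : BddSupp h) : Integrable h :=
  memLp_one_iff_integrable.1 (hh.memLp 1)

theorem BddSupp.comp_add {h : ℝ → K} (hh : BddSupp h) (η : ℝ) :
    BddSupp fun w => h (w + η) := by
  obtain ⟨C, hC⟩ := hh.bound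
  obtain ⟨R, hR⟩ := hh.supp
  refine ⟨hh.meas.comp_measurePreserving (measurePreserving_add_right volume η),
    ⟨C, fun w => hC _⟩, ⟨R + |η|, fun w hw => hR _ ?_⟩⟩
  have := abs_add_le (w + η) (-η)
  rw [abs_neg, add_neg_cancel_right] at this
  linarith

theorem BddSupp.sub {h h' : ℝ → K} (hh : BddSupp h) (hh' : BddSupp h') :
    BddSupp fun w => h w - h' w := by
  obtain ⟨C, hC⟩ := hh.bound
  obtain ⟨R, hR⟩ := hh.supp
  obtain ⟨C', hC'⟩ := hh'.bound
  obtain ⟨R', hR'⟩ := hh'.supp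
  refine ⟨hh.meas.sub hh'.meas, ⟨C + C', fun w => (norm_sub_le _ _).trans (add_le_add (hC w) (hC' w))⟩,
    ⟨max R R', fun w hw => ?_⟩⟩
  rw [hR w (lt_of_le_of_lt (le_max_left _ _) hw), hR' w (lt_of_le_of_lt (le_max_right _ _) hw),
    sub_zero]

theorem BddSupp.char_smul {h : ℝ → K} (hh : BddSupp h) (y : ℝ) :
    BddSupp fun w => Real.fourierChar (-(y * w)) • h w := by
  obtain ⟨C, hC⟩ := hh.bound
  obtain ⟨R, hR⟩ := hh.supp
  refine ⟨?_, ⟨C, fun w => ?_⟩, ⟨R, fun w hw => by rw [hR w hw, smul_zero]⟩⟩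
  · have hc : Continuous fun w : ℝ => ((Real.fourierChar (-(y * w)) : Circle) : ℂ) := by
      fun_prop
    exact hc.aestronglyMeasurable.smul hh.meas
  · rw [Circle.norm_smul]; exact hC w

theorem BddSupp.continuous_fourierInv {h : ℝ → K} (hh : BddSupp h) : Continuous (𝓕⁻ h) :=
  continuous_fourierInv_of_integrable hh.integrable

theorem BddSupp.memLp_fourierInv {h : ℝ → K} (hh : BddSupp h) : MemLp (𝓕⁻ h) 2 volume :=
  (memLp_congr_ae (fourierInv_toLp_ae (hh.memLp 2) hh.integrable)).1 (Lp.memLp _)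

theorem BddSupp.toLp_fourierInv {h : ℝ → K} (hh : BddSupp h) :
    hh.memLp_fourierInv.toLp (𝓕⁻ h) = 𝓕⁻ ((hh.memLp 2).toLp h) := by
  refine Lp.ext ?_
  exact hh.memLp_fourierInv.coeFn_toLp.trans
    (fourierInv_toLp_ae (hh.memLp 2) hh.integrable).symm

theorem inner_toLp_eq {f g : ℝ → K} (hf : MemLp f 2 volume) (hg : MemLp g 2 volume) :
    ⟪hf.toLp f, hg.toLp g⟫_ℂ = ∫ x, ⟪f x, g x⟫_ℂ := by
  rw [L2.inner_def]
  refine integral_congr_ae ?_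
  filter_upwards [hf.coeFn_toLp, hg.coeFn_toLp] with x h1 h2
  rw [h1, h2]

theorem enorm_toLp_sq {f : ℝ → K} (hf : MemLp f 2 volume) :
    ‖hf.toLp f‖ₑ ^ 2 = ∫⁻ x, ‖f x‖ₑ ^ 2 := by
  rw [Lp.enorm_toLp]
  have := eLpNorm_nnreal_pow_eq_lintegral (μ := volume) (f := f) (p := 2) (by simp)
  simpa using this

theorem enorm_sq_eq_lintegral (f : L2 K) : ‖f‖ₑ ^ 2 = ∫⁻ x, ‖f x‖ₑ ^ 2 := by
  conv_lhs => rw [← Lp.toLp_coeFn f (Lp.memLp f)]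
  exact enorm_toLp_sq _

theorem inner_fourierInv_eq (f g : L2 K) : ⟪𝓕⁻ f, 𝓕⁻ g⟫_ℂ = ⟪f, g⟫_ℂ :=
  (Lp.fourierTransformₗᵢ ℝ K).symm.inner_map_map f g

theorem BddSupp.integral_inner_fourierInv {h h' : ℝ → K} (hh : BddSupp h) (hh' : BddSupp h') :
    ∫ t, ⟪𝓕⁻ h t, 𝓕⁻ h' t⟫_ℂ = ∫ w, ⟪h w, h' w⟫_ℂ := by
  rw [← inner_toLp_eq hh.memLp_fourierInv hh'.memLp_fourierInv, hh.toLp_fourierInv,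
    hh'.toLp_fourierInv, inner_fourierInv_eq, inner_toLp_eq]

theorem BddSupp.lintegral_fourierInv {h : ℝ → K} (hh : BddSupp h) :
    ∫⁻ t, ‖𝓕⁻ h t‖ₑ ^ 2 = ∫⁻ w, ‖h w‖ₑ ^ 2 := by
  rw [← enorm_toLp_sq hh.memLp_fourierInv, ← enorm_toLp_sq (hh.memLp 2), hh.toLp_fourierInv]
  congr 1
  have : ‖𝓕⁻ ((hh.memLp 2).toLp h)‖ = ‖(hh.memLp 2).toLp h‖ :=
    (Lp.fourierTransformₗᵢ ℝ K).symm.norm_map _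
  rw [← ofReal_norm, ← ofReal_norm, this]

theorem fourierInv_comp_add (h : ℝ → K) (η t : ℝ) :
    𝓕⁻ (fun w => h (w + η)) t = Real.fourierChar (-(η * t)) • 𝓕⁻ h t := by
  simp only [Real.fourierInv_eq]
  rw [← integral_add_right_eq_self (fun v => Real.fourierChar (inner ℝ v t) • h v) η]
  rw [Circle.smul_def, ← integral_smul]
  refine integral_congr_ae (Eventually.of_forall fun w => ?_)
  simp only [Circle.smul_def, smul_smul, ← Circle.coe_mul, ← AddChar.map_add_eq_mul]
  congr 3
  simp
  ring

theorem fourierInv_char_smul (h : ℝ → K) (y x : ℝ) :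
    𝓕⁻ (fun w => Real.fourierChar (-(y * w)) • h w) x = 𝓕⁻ h (x - y) := by
  simp only [Real.fourierInv_eq]
  refine integral_congr_ae (Eventually.of_forall fun w => ?_)
  simp only [smul_smul, ← AddChar.map_add_eq_mul]
  congr 2
  simp
  ring

end Fourier

/-! ### Fourier multipliers and their rows -/

section Rows

variable {K : Type*} [NormedAddCommGroup K] [InnerProductSpace ℂ K] [CompleteSpace K]
  {ι : Type*} (e : HilbertBasis ι ℂ K)

/-- `A` is the Fourier multiplier with symbol `m`, a compactly supported and Hilbert-Schmidt valued
function with pointwise adjoint `m'`. -/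
structure IsMult (A : L2 K →L[ℂ] L2 K) (m m' : ℝ → K →L[ℂ] K) : Prop where
  col : ∀ v, BddSupp fun w => m w v
  col' : ∀ v, BddSupp fun w => m' w v
  adj : ∀ w x y, ⟪m' w x, y⟫_ℂ = ⟪x, m w y⟫_ℂ
  supp : ∃ R, ∀ w, R < |w| → m w = 0 ∧ m' w = 0
  hs : ∃ C : ℝ≥0∞, C ≠ ⊤ ∧ ∀ w, ∑' n, ‖m w (e n)‖ₑ ^ 2 ≤ C
  hs' : ∃ C : ℝ≥0∞, C ≠ ⊤ ∧ ∀ w, ∑' n, ‖m' w (e n)‖ₑ ^ 2 ≤ C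
  apply : ∀ u : L2 K, ∀ᵐ w, (𝓕 (A u) : L2 K) w = m w ((𝓕 u : L2 K) w)

/-- The inverse Fourier transform of the column `m eₙ` of a symbol. -/
noncomputable def kern (m : ℝ → K →L[ℂ] K) (n : ι) : ℝ → K := 𝓕⁻ fun w => m w (e n)

/-- `A` is an integral operator whose kernel has the rows `κ`:
`⟨eₙ, (A u)(y)⟩ = ∫ ⟨κ n y x, u x⟩ dx`. -/
structure Rows (A : L2 K →L[ℂ] L2 K) (κ : ι → ℝ → ℝ → K) : Prop where
  memLp : ∀ n y, MemLp (κ n y) 2 volume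
  apply : ∀ (u : L2 K) n, ∀ᵐ y, ⟪e n, A u y⟫_ℂ = ∫ x, ⟪κ n y x, u x⟫_ℂ

variable {e}

theorem IsMult.swap {A A' : L2 K →L[ℂ] L2 K} {m m' : ℝ → K →L[ℂ] K} (h : IsMult e A m m')
    (h' : ∀ u : L2 K, ∀ᵐ w, (𝓕 (A' u) : L2 K) w = m' w ((𝓕 u : L2 K) w)) :
    IsMult e A' m' m :=
  ⟨h.col', h.col, fun w x y => by rw [← inner_conj_symm, ← h.adj, inner_conj_symm],
    h.supp.imp fun R hR w hw => (hR w hw).symm, h.hs', h.hs, h'⟩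

/-- The `n`-th coordinate of `A u` at `y` pairs the transform of `u` with `exp(-2πi y w) m'(w) eₙ`.
By Plancherel this is a pairing of `u` with the kernel translated by `y`. -/
theorem IsMult.rows {A : L2 K →L[ℂ] L2 K} {m m' : ℝ → K →L[ℂ] K} (h : IsMult e A m m') :
    Rows e A fun n y x => kern e m' n (x - y) := by
  have hmem : ∀ n y, MemLp (fun x => kern e m' n (x - y)) 2 volume := fun n y =>
    (h.col' (e n)).memLp_fourierInv.comp_measurePreserving
      (measurePreserving_sub_right volume y)
  refine ⟨hmem, fun u n => ?_⟩
  set û : L2 K := 𝓕 u with hû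
  have hg2 : MemLp (fun w => m w (û w)) 2 volume :=
    (memLp_congr_ae (h.apply u)).1 (Lp.memLp _)
  have hg1 : Integrable fun w => m w (û w) := by
    obtain ⟨R, hR⟩ := h.supp
    have h1 : (Set.Icc (-R) R).indicator (fun w => m w (û w)) = fun w => m w (û w) := by
      refine Set.indicator_eq_self.2 fun w hw => ?_
      by_contra hw'
      have hRw : R < |w| := by
        by_contra h3
        exact hw' (abs_le.1 (not_lt.1 h3))
      refine hw ?_
      change m w (û w) = 0
      rw [(hR w hRw).1]
      rfl
    rw [← h1, integrable_indicator_iff measurableSet_Icc]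
    exact (hg2.restrict _).integrable one_le_two
  have hAu : A u = 𝓕⁻ (hg2.toLp _) := by
    have h5 : (𝓕 (A u) : L2 K) =ᵐ[volume] fun w => m w (û w) := h.apply u
    have : (𝓕 (A u) : L2 K) = hg2.toLp _ := Lp.ext (h5.trans hg2.coeFn_toLp.symm)
    rw [← this, FourierTransform.fourierInv_fourier_eq]
  have hAe := fourierInv_toLp_ae hg2 hg1
  rw [← hAu] at hAe
  filter_upwards [hAe] with y hy
  have hS := (h.col' (e n)).char_smul y
  have e1 : ∫ x, ⟪kern e m' n (x - y), u x⟫_ℂ = ⟪hS.memLp_fourierInv.toLp _, u⟫_ℂ := by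
    rw [L2.inner_def]
    refine integral_congr_ae ?_
    filter_upwards [hS.memLp_fourierInv.coeFn_toLp] with x hx
    rw [hx, fourierInv_char_smul]
    rfl
  have e2 : (u : L2 K) = 𝓕⁻ û := (FourierTransform.fourierInv_fourier_eq u).symm
  have e4 : ∀ X : L2 K, ⟪(𝓕⁻ X : L2 K), u⟫_ℂ = ⟪X, û⟫_ℂ := fun X => by
    conv_lhs => rw [e2]
    exact inner_fourierInv_eq _ _
  rw [e1, hS.toLp_fourierInv, e4, L2.inner_def, hy, Real.fourierInv_eq]
  have e3 := (innerSL ℂ (e n)).integral_comp_comm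
    (μ := volume) (φ := fun w => Real.fourierChar (inner ℝ w y) • m w (û w)) ?_
  · simp only [innerSL_apply_apply] at e3
    rw [← e3]
    refine integral_congr_ae ?_
    filter_upwards [(hS.memLp 2).coeFn_toLp] with w hw
    rw [hw, Circle.smul_def, Circle.smul_def, inner_smul_right, inner_smul_left, h.adj,
      ← Circle.coe_inv_eq_conj, ← AddChar.map_neg_eq_inv]
    simp [mul_comm]
  · have := (Real.fourierIntegral_convergent_iff (μ := volume) (f := fun w => m w (û w)) (-y)).2 hg1
    simpa using this

theorem Rows.mulOp_comp {A : L2 K →L[ℂ] L2 K} {κ : ι → ℝ → ℝ → K} (h : Rows e A κ) {P : ℝ → ℝ}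
    (hP : MemLp (fun x => (P x : ℂ)) ∞ (volume : Measure ℝ)) :
    Rows e (mulOp K P ∘L A) fun n y x => (P y : ℂ) • κ n y x := by
  refine ⟨fun n y => (h.memLp n y).const_smul _, fun u n => ?_⟩
  filter_upwards [h.apply u n, mulOp_ae P hP (A u)] with y h1 h2
  rw [ContinuousLinearMap.comp_apply, h2, inner_smul_right, h1, ← integral_const_mul]
  simp

theorem Rows.comp_mulOp {A : L2 K →L[ℂ] L2 K} {κ : ι → ℝ → ℝ → K} (h : Rows e A κ) {P : ℝ → ℝ}
    (hP : MemLp (fun x => (P x : ℂ)) ∞ (volume : Measure ℝ)) :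
    Rows e (A ∘L mulOp K P) fun n y x => (P x : ℂ) • κ n y x := by
  refine ⟨fun n y => (h.memLp n y).smul (r := 2) hP, fun u n => ?_⟩
  filter_upwards [h.apply (mulOp K P u) n] with y h1
  rw [ContinuousLinearMap.comp_apply, h1]
  refine integral_congr_ae ?_
  filter_upwards [mulOp_ae P hP u] with x hx
  rw [hx, inner_smul_right, inner_smul_left, Complex.conj_ofReal]

theorem Rows.sub {A B : L2 K →L[ℂ] L2 K} {κ κ' : ι → ℝ → ℝ → K} (h : Rows e A κ)
    (h' : Rows e B κ') : Rows e (A - B) fun n y x => κ n y x - κ' n y x := by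
  refine ⟨fun n y => (h.memLp n y).sub (h'.memLp n y), fun u n => ?_⟩
  have hint : ∀ {k : ℝ → K}, MemLp k 2 volume → Integrable fun x => ⟪k x, u x⟫_ℂ := by
    intro k hk
    refine (L2.integrable_inner (𝕜 := ℂ) (hk.toLp k) u).congr ?_
    filter_upwards [hk.coeFn_toLp] with x hx
    rw [hx]
  filter_upwards [h.apply u n, h'.apply u n, Lp.coeFn_sub (A u) (B u)] with y h1 h2 h3
  rw [sub_apply, h3, Pi.sub_apply, inner_sub_right, h1, h2,
    ← integral_sub (hint (h.memLp n y)) (hint (h'.memLp n y))]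
  simp only [inner_sub_left]

theorem Rows.opComm {A : L2 K →L[ℂ] L2 K} {κ : ι → ℝ → ℝ → K} (h : Rows e A κ) {P : ℝ → ℝ}
    (hP : MemLp (fun x => (P x : ℂ)) ∞ (volume : Measure ℝ)) :
    Rows e (opComm A (mulOp K P)) fun n y x => ((P x - P y : ℝ) : ℂ) • κ n y x := by
  have e1 : (fun n y x => ((P x - P y : ℝ) : ℂ) • κ n y x) =
      fun n y x => (P x : ℂ) • κ n y x - (P y : ℂ) • κ n y x := by
    funext n y x
    rw [← sub_smul, Complex.ofReal_sub]
  rw [e1]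
  exact (h.comp_mulOp hP).sub (h.mulOp_comp hP)

theorem HilbertBasis.tsum_enorm_inner_sq {ι' E : Type*} [NormedAddCommGroup E]
    [InnerProductSpace ℂ E] (b : HilbertBasis ι' ℂ E) (x : E) :
    ∑' i, ‖⟪b i, x⟫_ℂ‖ₑ ^ 2 = ‖x‖ₑ ^ 2 := by
  have h1 : HasSum (fun i => ‖⟪b i, x⟫_ℂ‖ ^ 2) (‖x‖ ^ 2) := by
    have h2 := b.hasSum_inner_mul_inner x x
    have h5 : ⟪x, x⟫_ℂ = ((‖x‖ ^ 2 : ℝ) : ℂ) := by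
      rw [inner_self_eq_norm_sq_to_K]
      simp
    rw [h5] at h2
    have h3 : (fun i => ⟪x, b i⟫_ℂ * ⟪b i, x⟫_ℂ) = fun i => ((‖⟪b i, x⟫_ℂ‖ ^ 2 : ℝ) : ℂ) := by
      ext i
      rw [← inner_conj_symm x, mul_comm, Complex.mul_conj, Complex.normSq_eq_norm_sq]
    rw [h3] at h2
    exact Complex.hasSum_ofReal.1 h2
  have h4 : ∀ y : ℝ, 0 ≤ y → ENNReal.ofReal (y ^ 2) = ENNReal.ofReal y ^ 2 := fun y hy =>
    ENNReal.ofReal_pow hy 2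
  rw [← ofReal_norm, ← h4 _ (norm_nonneg _), ← h1.tsum_eq,
    ENNReal.ofReal_tsum_of_nonneg (fun i => by positivity) h1.summable]
  refine tsum_congr fun i => ?_
  rw [h4 _ (norm_nonneg _), ofReal_norm]

/-- Parseval in `K`, then in `L2 K`, with Tonelli in between. Integrated over `y`, it is the
Hilbert-Schmidt norm of an integral operator. -/
theorem Rows.tsum_enorm_sq_apply [Countable ι] {A : L2 K →L[ℂ] L2 K} {κ : ι → ℝ → ℝ → K}
    (h : Rows e A κ) {ι' : Type*} [Countable ι'] (b : HilbertBasis ι' ℂ (L2 K)) :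
    ∀ᵐ y, ∑' i, ‖A (b i) y‖ₑ ^ 2 = ∑' n, ∫⁻ x, ‖κ n y x‖ₑ ^ 2 := by
  have h1 : ∀ᵐ y, ∀ i n, ⟪e n, A (b i) y⟫_ℂ = ∫ x, ⟪κ n y x, b i x⟫_ℂ :=
    ae_all_iff.2 fun i => ae_all_iff.2 fun n => h.apply (b i) n
  filter_upwards [h1] with y hy
  calc ∑' i, ‖A (b i) y‖ₑ ^ 2 = ∑' i, ∑' n, ‖⟪e n, A (b i) y⟫_ℂ‖ₑ ^ 2 :=
        tsum_congr fun i => (HilbertBasis.tsum_enorm_inner_sq e _).symm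
    _ = ∑' n, ∑' i, ‖⟪e n, A (b i) y⟫_ℂ‖ₑ ^ 2 := ENNReal.tsum_comm
    _ = _ := by
        refine tsum_congr fun n => ?_
        rw [← enorm_toLp_sq (h.memLp n y), ← HilbertBasis.tsum_enorm_inner_sq b]
        refine tsum_congr fun i => ?_
        rw [hy, ← inner_conj_symm, L2.inner_def]
        rw [RCLike.enorm_conj]
        congr 2
        refine integral_congr_ae ?_
        filter_upwards [(h.memLp n y).coeFn_toLp] with x hx
        rw [hx]

theorem Rows.tsum_enorm_sq [Countable ι] {A : L2 K →L[ℂ] L2 K} {κ : ι → ℝ → ℝ → K}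
    (h : Rows e A κ) {ι' : Type*} [Countable ι'] (b : HilbertBasis ι' ℂ (L2 K)) :
    ∑' i, ‖A (b i)‖ₑ ^ 2 = ∫⁻ y, ∑' n, ∫⁻ x, ‖κ n y x‖ₑ ^ 2 := by
  rw [← lintegral_congr_ae (h.tsum_enorm_sq_apply b), lintegral_tsum]
  · exact tsum_congr fun i => enorm_sq_eq_lintegral _
  · intro i
    exact (Lp.aestronglyMeasurable _).enorm.pow_const 2

theorem enorm_inner_le_add_sq {E : Type*} [NormedAddCommGroup E] [InnerProductSpace ℂ E]
    (x y : E) : ‖⟪x, y⟫_ℂ‖ₑ ≤ ‖x‖ₑ ^ 2 + ‖y‖ₑ ^ 2 := by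
  have h1 : ‖⟪x, y⟫_ℂ‖ ≤ ‖x‖ ^ 2 + ‖y‖ ^ 2 :=
    (norm_inner_le_norm x y).trans (by nlinarith [sq_nonneg (‖x‖ - ‖y‖), sq_nonneg ‖x‖, sq_nonneg ‖y‖])
  calc ‖⟪x, y⟫_ℂ‖ₑ = ENNReal.ofReal ‖⟪x, y⟫_ℂ‖ := (ofReal_norm _).symm
    _ ≤ ENNReal.ofReal (‖x‖ ^ 2 + ‖y‖ ^ 2) := ENNReal.ofReal_le_ofReal h1
    _ = _ := by
      rw [ENNReal.ofReal_add (by positivity) (by positivity), ENNReal.ofReal_pow (norm_nonneg _),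
        ENNReal.ofReal_pow (norm_nonneg _), ofReal_norm, ofReal_norm]

theorem summable_of_tsum_enorm_ne_top {α : Type*} {f : α → ℂ} (h : ∑' a, ‖f a‖ₑ ≠ ⊤) :
    Summable f := by
  refine Summable.of_nnnorm ?_
  exact ENNReal.tsum_coe_ne_top_iff_summable.1 h

/-- This is the polarized form of the Hilbert-Schmidt identity. Rows sit in the conjugate-linear
slot of their pairing, so `κ'` and `κ` appear in reversed order on the right. -/
theorem Rows.tsum_inner [Countable ι] {A B : L2 K →L[ℂ] L2 K} {κ κ' : ι → ℝ → ℝ → K}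
    (hA : Rows e A κ) (hB : Rows e B κ') {ι' : Type*} [Countable ι']
    (b : HilbertBasis ι' ℂ (L2 K)) (hA2 : ∑' i, ‖A (b i)‖ₑ ^ 2 ≠ ⊤)
    (hB2 : ∑' i, ‖B (b i)‖ₑ ^ 2 ≠ ⊤) :
    ∑' i, ⟪A (b i), B (b i)⟫_ℂ = ∫ y, ∑' n, ∫ x, ⟪κ' n y x, κ n y x⟫_ℂ := by
  have hm : ∀ i, AEStronglyMeasurable (fun y => ⟪A (b i) y, B (b i) y⟫_ℂ) volume := fun i =>
    (Lp.aestronglyMeasurable _).inner (Lp.aestronglyMeasurable _)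
  have h0 : ∑' i, ∫⁻ y, ‖⟪A (b i) y, B (b i) y⟫_ℂ‖ₑ ≠ ⊤ := by
    refine ne_top_of_le_ne_top (ENNReal.add_ne_top.2 ⟨hA2, hB2⟩) ?_
    rw [← ENNReal.tsum_add]
    refine ENNReal.tsum_le_tsum fun i => ?_
    rw [enorm_sq_eq_lintegral, enorm_sq_eq_lintegral, ← lintegral_add_left' ?_]
    · exact lintegral_mono fun y => enorm_inner_le_add_sq _ _
    · exact (Lp.aestronglyMeasurable _).enorm.pow_const 2
  have h1 : ∑' i, ⟪A (b i), B (b i)⟫_ℂ = ∫ y, ∑' i, ⟪A (b i) y, B (b i) y⟫_ℂ := by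
    rw [integral_tsum hm h0]
    exact tsum_congr fun i => L2.inner_def _ _
  rw [h1]
  refine integral_congr_ae ?_
  have hfin : ∀ {C : L2 K →L[ℂ] L2 K}, ∑' i, ‖C (b i)‖ₑ ^ 2 ≠ ⊤ →
      ∀ᵐ y, ∑' i, ‖C (b i) y‖ₑ ^ 2 < ⊤ := by
    intro C hC
    refine ae_lt_top' ?_ ?_
    · exact AEMeasurable.tsum fun i => (Lp.aestronglyMeasurable _).enorm.pow_const 2
    · rw [lintegral_tsum fun i => (Lp.aestronglyMeasurable _).enorm.pow_const 2]
      simpa only [enorm_sq_eq_lintegral] using hC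
  have h2 : ∀ᵐ y, ∀ i n, ⟪e n, A (b i) y⟫_ℂ = ∫ x, ⟪κ n y x, b i x⟫_ℂ :=
    ae_all_iff.2 fun i => ae_all_iff.2 fun n => hA.apply (b i) n
  have h3 : ∀ᵐ y, ∀ i n, ⟪e n, B (b i) y⟫_ℂ = ∫ x, ⟪κ' n y x, b i x⟫_ℂ :=
    ae_all_iff.2 fun i => ae_all_iff.2 fun n => hB.apply (b i) n
  filter_upwards [h2, h3, hfin hA2, hfin hB2] with y h2 h3 h4 h5
  have hs : Summable (Function.uncurry fun i n => ⟪A (b i) y, e n⟫_ℂ * ⟪e n, B (b i) y⟫_ℂ) := by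
    refine summable_of_tsum_enorm_ne_top ?_
    rw [ENNReal.tsum_prod']
    refine ne_top_of_le_ne_top (ENNReal.add_ne_top.2 ⟨h4.ne, h5.ne⟩) ?_
    rw [← ENNReal.tsum_add]
    refine ENNReal.tsum_le_tsum fun i => ?_
    rw [← HilbertBasis.tsum_enorm_inner_sq e, ← HilbertBasis.tsum_enorm_inner_sq e,
      ← ENNReal.tsum_add]
    refine ENNReal.tsum_le_tsum fun n => ?_
    have := enorm_inner_le_add_sq ⟪e n, A (b i) y⟫_ℂ ⟪e n, B (b i) y⟫_ℂ
    rw [RCLike.inner_apply, inner_conj_symm, mul_comm] at this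
    exact this
  calc ∑' i, ⟪A (b i) y, B (b i) y⟫_ℂ
      = ∑' i, ∑' n, ⟪A (b i) y, e n⟫_ℂ * ⟪e n, B (b i) y⟫_ℂ :=
        tsum_congr fun i => (e.hasSum_inner_mul_inner _ _).tsum_eq.symm
    _ = ∑' n, ∑' i, ⟪A (b i) y, e n⟫_ℂ * ⟪e n, B (b i) y⟫_ℂ := hs.tsum_comm.symm
    _ = _ := by
      refine tsum_congr fun n => ?_
      have e1 : ∫ x, ⟪κ' n y x, κ n y x⟫_ℂ = ⟪(hB.memLp n y).toLp _, (hA.memLp n y).toLp _⟫_ℂ :=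
        (inner_toLp_eq _ _).symm
      have e2 : ∀ {k : ℝ → K} (hk : MemLp k 2 volume) i,
          ∫ x, ⟪k x, b i x⟫_ℂ = ⟪hk.toLp k, b i⟫_ℂ := by
        intro k hk i
        rw [L2.inner_def]
        refine integral_congr_ae ?_
        filter_upwards [hk.coeFn_toLp] with x hx
        rw [hx]
      rw [e1, ← (b.hasSum_inner_mul_inner _ _).tsum_eq]
      refine tsum_congr fun i => ?_
      rw [← inner_conj_symm (A (b i) y), h2, h3, e2 (hA.memLp n y), e2 (hB.memLp n y),
        inner_conj_symm, mul_comm]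

end Rows

theorem HilbertBasis.countable_of_separable {ι E : Type*} [NormedAddCommGroup E]
    [InnerProductSpace ℂ E] [TopologicalSpace.SeparableSpace E] (b : HilbertBasis ι ℂ E) :
    Countable ι := by
  refine Pairwise.countable_of_isOpen_disjoint (s := fun i => Metric.ball (b i) (1 / 2))
    (fun i j hij => ?_) (fun i => Metric.isOpen_ball) fun i => ⟨b i, by simp⟩
  refine Metric.ball_disjoint_ball ?_
  have h1 : ‖b i - b j‖ * ‖b i - b j‖ = 2 := by
    rw [norm_sub_mul_self (𝕜 := ℂ), b.orthonormal.inner_eq_zero hij, b.orthonormal.norm_eq_one,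
      b.orthonormal.norm_eq_one]
    norm_num
  rw [dist_eq_norm]
  nlinarith [norm_nonneg (b i - b j)]

/-! ### Switch functions -/

section Switch

variable {P : ℝ → ℝ} {c d : ℝ}

theorem IsSwitch.memLp_top (hP : IsSwitch 0 1 c d P) (hPm : Measurable P) :
    MemLp (fun x => (P x : ℂ)) ∞ (volume : Measure ℝ) := by
  obtain ⟨C, hC⟩ := hP.bounded
  exact memLp_top_of_bound (Complex.measurable_ofReal.comp hPm).aestronglyMeasurable C
    (Eventually.of_forall fun x => by simpa using hC x)

theorem IsSwitch.shift_sub_eq_zero (hP : IsSwitch 0 1 c d P) {t y : ℝ}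
    (hy : y ∉ Set.Icc (c - |t|) (d + |t|)) : P (y + t) - P y = 0 := by
  have h1 := abs_le.1 (le_refl |t|)
  rw [Set.mem_Icc, not_and_or, not_le, not_le] at hy
  rcases hy with hy | hy
  · rw [hP.left _ (by linarith), hP.left _ (by linarith [abs_nonneg t]), sub_self]
  · rw [hP.right _ (by linarith), hP.right _ (by linarith [abs_nonneg t]), sub_self]

theorem IsSwitch.lintegral_shift_sub_le (hP : IsSwitch 0 1 c d P) (hcd : c ≤ d) :
    ∃ C : ℝ, 0 ≤ C ∧ ∀ t, ∫⁻ y, ‖P (y + t) - P y‖ₑ ≤ ENNReal.ofReal (C * (1 + |t|)) := by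
  obtain ⟨C, hC⟩ := hP.bounded
  have hC0 : 0 ≤ C := (abs_nonneg _).trans (hC 0)
  refine ⟨2 * C * (d - c + 2), by nlinarith, fun t => ?_⟩
  calc ∫⁻ y, ‖P (y + t) - P y‖ₑ
      ≤ ∫⁻ y, (Set.Icc (c - |t|) (d + |t|)).indicator (fun _ => ENNReal.ofReal (2 * C)) y := by
        refine lintegral_mono fun y => ?_
        by_cases hy : y ∈ Set.Icc (c - |t|) (d + |t|)
        · rw [Set.indicator_of_mem hy, ← ofReal_norm]
          refine ENNReal.ofReal_le_ofReal ((norm_sub_le _ _).trans ?_)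
          have := hC y
          have := hC (y + t)
          simp only [Real.norm_eq_abs]
          linarith
        · rw [hP.shift_sub_eq_zero hy]
          simp
    _ = ENNReal.ofReal (2 * C * (d + |t| - (c - |t|))) := by
        rw [lintegral_indicator_const measurableSet_Icc, Real.volume_Icc,
          ← ENNReal.ofReal_mul (by positivity)]
    _ ≤ _ := by
        refine ENNReal.ofReal_le_ofReal ?_
        have h1 := abs_nonneg t
        rw [mul_assoc (2 * C)]
        refine mul_le_mul_of_nonneg_left ?_ (by positivity)
        nlinarith

/-- When `|t| > d - c`, on an interval of length `|t| - (d - c)` one of `y`, `y + t` lies to the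
left of `c` and the other to the right of `d`. There the increment is `±1`. -/
theorem IsSwitch.le_lintegral_shift_sub_sq (hP : IsSwitch 0 1 c d P) (t : ℝ) :
    ENNReal.ofReal (|t| - (d - c)) ≤ ∫⁻ y, ‖P (y + t) - P y‖ₑ ^ 2 := by
  have key : ∀ a b : ℝ, b - a = |t| - (d - c) →
      (∀ y ∈ Set.Ioc a b, ‖P (y + t) - P y‖ₑ = 1) →
      ENNReal.ofReal (|t| - (d - c)) ≤ ∫⁻ y, ‖P (y + t) - P y‖ₑ ^ 2 := by
    intro a b hab h
    calc ENNReal.ofReal (|t| - (d - c))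
        = ∫⁻ y, (Set.Ioc a b).indicator (fun _ => 1) y := by
          rw [lintegral_indicator_const measurableSet_Ioc, Real.volume_Ioc, one_mul, hab]
      _ ≤ _ := by
          refine lintegral_mono fun y => ?_
          by_cases hy : y ∈ Set.Ioc a b
          · rw [Set.indicator_of_mem hy, h y hy, one_pow]
          · rw [Set.indicator_of_notMem hy]
            exact zero_le
  rcases le_total 0 t with ht | ht
  · refine key (d - t) c (by rw [abs_of_nonneg ht]; ring) fun y hy => ?_
    rw [hP.right _ (by linarith [hy.1]), hP.left _ hy.2]
    simp
  · refine key d (c - t) (by rw [abs_of_nonpos ht]; ring) fun y hy => ?_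
    rw [hP.right _ hy.1, hP.left _ (by linarith [hy.2])]
    simp

/-- The increments of a function which is constant near `-∞` and near `+∞`. -/
theorem integral_shift_sub {F : ℝ → ℂ} {L L' : ℂ} (hF : Measurable F)
    (hb : ∃ C, ∀ x, ‖F x‖ ≤ C) (hl : ∀ x, x ≤ c → F x = L) (hr : ∀ x, d < x → F x = L') (t : ℝ) :
    (Integrable fun y => F (y + t) - F y) ∧ ∫ y, (F (y + t) - F y) = t * (L' - L) := by
  obtain ⟨C, hC⟩ := hb
  -- Compare with a sharp step at `c`. The difference is integrable, so its increments integrate to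
  -- zero, and those of the step are explicit.
  set h : ℝ → ℂ := fun y => L + (Set.Ioi c).indicator (fun _ => L' - L) y with hh
  have hhm : Measurable h :=
    measurable_const.add (measurable_const.indicator measurableSet_Ioi)
  have hQ : Integrable fun y => F y - h y := by
    have h1 : (Set.Ioc c d).indicator (fun y => F y - h y) = fun y => F y - h y := by
      refine Set.indicator_eq_self.2 fun y hy => ?_
      by_contra hy'
      refine hy ?_
      rw [Set.mem_Ioc, not_and_or, not_lt, not_le] at hy'
      by_cases hc : y ≤ c
      · simp [hl _ hc, hh, hc]
      · have hd := hy'.resolve_left hc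
        simp [hr _ hd, hh, not_le.1 hc]
    rw [← h1, integrable_indicator_iff measurableSet_Ioc]
    refine Measure.integrableOn_of_bounded (M := C + (‖L‖ + ‖L' - L‖)) (by simp)
      (hF.sub hhm).aestronglyMeasurable (Eventually.of_forall fun y => ?_)
    refine (norm_sub_le _ _).trans (add_le_add (hC y) ((norm_add_le _ _).trans ?_))
    rw [Set.indicator_apply]
    split_ifs <;> simp
  have hH : (Integrable fun y => h (y + t) - h y) ∧ ∫ y, (h (y + t) - h y) = t * (L' - L) := by
    rcases le_total 0 t with ht | ht
    · have e1 : (fun y => h (y + t) - h y) = (Set.Ioc (c - t) c).indicator fun _ => L' - L := by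
        ext y
        simp only [hh, Set.indicator_apply, Set.mem_Ioi, Set.mem_Ioc]
        split_ifs <;> first | (ring; done) | (exfalso; grind)
      rw [e1, integrable_indicator_iff measurableSet_Ioc, integral_indicator measurableSet_Ioc]
      exact ⟨by simp, by simp [ht]⟩
    · have e1 : (fun y => h (y + t) - h y) = (Set.Ioc c (c - t)).indicator fun _ => -(L' - L) := by
        ext y
        simp only [hh, Set.indicator_apply, Set.mem_Ioi, Set.mem_Ioc]
        split_ifs <;> first | (ring; done) | (exfalso; grind)
      rw [e1, integrable_indicator_iff measurableSet_Ioc, integral_indicator measurableSet_Ioc]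
      exact ⟨by simp, by simp [ht]; ring⟩
  have e2 : (fun y => F (y + t) - F y) = fun y =>
      ((F (y + t) - h (y + t)) - (F y - h y)) + (h (y + t) - h y) := by
    ext y
    ring
  have e3 : Integrable fun y => (F (y + t) - h (y + t)) - (F y - h y) :=
    (hQ.comp_add_right t).sub hQ
  rw [e2]
  refine ⟨e3.add hH.1, ?_⟩
  rw [integral_add e3 hH.1, hH.2, integral_sub (hQ.comp_add_right t) hQ,
    integral_add_right_eq_self (fun y => F y - h y)]
  ring

theorem IsSwitch.integral_shift_sub (hP : IsSwitch 0 1 c d P) (hPm : Measurable P)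
    (t : ℝ) : ∫ y, (P (y + t) - P y) = t := by
  have h := (SpectralFlow.integral_shift_sub (F := fun x => (P x : ℂ)) (L := 0) (L' := 1) (c := c)
    (d := d) (Complex.measurable_ofReal.comp hPm) (by simpa using hP.bounded)
    (fun x hx => by rw [hP.left x hx, Complex.ofReal_zero])
    (fun x hx => by rw [hP.right x hx, Complex.ofReal_one]) t).2
  simp only [← Complex.ofReal_sub, integral_complex_ofReal] at h
  simpa using h

end Switch

/-! ### Multiplication operators -/

section MulOp

variable {K : Type*} [NormedAddCommGroup K] [InnerProductSpace ℂ K] [CompleteSpace K]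

theorem mulOp_inner {P : ℝ → ℝ} (hP : MemLp (fun x => (P x : ℂ)) ∞ (volume : Measure ℝ))
    (f g : L2 K) : ⟪mulOp K P f, g⟫_ℂ = ⟪f, mulOp K P g⟫_ℂ := by
  rw [L2.inner_def, L2.inner_def]
  refine integral_congr_ae ?_
  filter_upwards [mulOp_ae P hP f, mulOp_ae P hP g] with x h1 h2
  rw [h1, h2, inner_smul_left, inner_smul_right, Complex.conj_ofReal]

theorem adjoint_mulOp {P : ℝ → ℝ} (hP : MemLp (fun x => (P x : ℂ)) ∞ (volume : Measure ℝ)) :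
    ContinuousLinearMap.adjoint (mulOp K P) = mulOp K P :=
  ((ContinuousLinearMap.eq_adjoint_iff _ _).2 fun f g => mulOp_inner hP f g).symm

theorem adjoint_opComm_mulOp {P : ℝ → ℝ}
    (hP : MemLp (fun x => (P x : ℂ)) ∞ (volume : Measure ℝ)) (A : L2 K →L[ℂ] L2 K) :
    ContinuousLinearMap.adjoint (opComm A (mulOp K P)) =
      mulOp K P ∘L ContinuousLinearMap.adjoint A - ContinuousLinearMap.adjoint A ∘L mulOp K P := by
  rw [opComm, map_sub, ContinuousLinearMap.adjoint_comp, ContinuousLinearMap.adjoint_comp,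
    adjoint_mulOp hP]

/-- The indicator function of `[-N, N]`. -/
noncomputable def cutoff (N : ℕ) : ℝ → ℝ := (Set.Icc (-N : ℝ) N).indicator 1

theorem measurable_cutoff (N : ℕ) : Measurable (cutoff N) :=
  measurable_one.indicator measurableSet_Icc

theorem norm_cutoff_le (N : ℕ) (x : ℝ) : ‖(cutoff N x : ℂ)‖ ≤ 1 := by
  rw [cutoff, Set.indicator_apply]
  split_ifs <;> simp

theorem memLp_cutoff (N : ℕ) : MemLp (fun x => (cutoff N x : ℂ)) ∞ (volume : Measure ℝ) :=
  memLp_top_of_bound (Complex.measurable_ofReal.comp (measurable_cutoff N)).aestronglyMeasurable 1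
    (Eventually.of_forall (norm_cutoff_le N))

theorem eventually_cutoff_eq_one (x : ℝ) : ∀ᶠ N in atTop, cutoff N x = 1 := by
  obtain ⟨M, hM⟩ := exists_nat_ge |x|
  filter_upwards [eventually_ge_atTop M] with N hN
  have : |x| ≤ N := hM.trans (by exact_mod_cast hN)
  rw [cutoff, Set.indicator_of_mem (Set.mem_Icc.2 (abs_le.1 this)), Pi.one_apply]

theorem norm_mulOp_cutoff_le (N : ℕ) : ‖mulOp K (cutoff N)‖ ≤ 1 := by
  refine ContinuousLinearMap.opNorm_le_bound _ zero_le_one fun u => ?_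
  rw [one_mul]
  refine Lp.norm_le_norm_of_ae_le ?_
  filter_upwards [mulOp_ae _ (memLp_cutoff N) u] with x hx
  rw [hx, norm_smul]
  exact mul_le_of_le_one_left (norm_nonneg _) (norm_cutoff_le N x)

theorem tendsto_mulOp_cutoff (u : L2 K) :
    Tendsto (fun N => mulOp K (cutoff N) u) atTop (𝓝 u) := by
  have hsq : Tendsto (fun N => ‖mulOp K (cutoff N) u - u‖ₑ ^ 2) atTop (𝓝 0) := by
    have h1 : ∀ N, ‖mulOp K (cutoff N) u - u‖ₑ ^ 2 =
        ∫⁻ x, ‖((cutoff N x : ℂ) - 1) • u x‖ₑ ^ 2 := fun N => by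
      rw [enorm_sq_eq_lintegral]
      refine lintegral_congr_ae ?_
      filter_upwards [mulOp_ae _ (memLp_cutoff N) u, Lp.coeFn_sub (mulOp K (cutoff N) u) u]
        with x h1 h2
      rw [h2, Pi.sub_apply, h1, sub_smul, one_smul]
    simp_rw [h1]
    have h0 : ∫⁻ _ : ℝ, (0 : ℝ≥0∞) = 0 := lintegral_zero
    rw [← h0]
    refine tendsto_lintegral_of_dominated_convergence' (fun x => ‖u x‖ₑ ^ 2) (fun N => ?_)
      (fun N => Eventually.of_forall fun x => ?_) ?_ (Eventually.of_forall fun x => ?_)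
    · refine AEMeasurable.pow_const (AEStronglyMeasurable.enorm (AEStronglyMeasurable.smul ?_
        (Lp.aestronglyMeasurable u))) 2
      exact ((Complex.measurable_ofReal.comp (measurable_cutoff N)).sub_const
        1).aestronglyMeasurable
    · refine pow_le_pow_left' ?_ 2
      rw [← ofReal_norm, ← ofReal_norm]
      refine ENNReal.ofReal_le_ofReal ?_
      rw [norm_smul]
      refine mul_le_of_le_one_left (norm_nonneg _) ?_
      rw [cutoff, Set.indicator_apply]
      split_ifs <;> simp
    · rw [← enorm_sq_eq_lintegral]
      exact ENNReal.pow_ne_top enorm_ne_top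
    · refine tendsto_const_nhds.congr' ?_
      filter_upwards [eventually_cutoff_eq_one x] with N hN
      rw [hN]
      simp
  rw [tendsto_iff_norm_sub_tendsto_zero]
  have h2 : Tendsto (fun N => (‖mulOp K (cutoff N) u - u‖ₑ ^ 2).toReal) atTop (𝓝 0) := by
    simpa only [ENNReal.toReal_zero, Function.comp_def] using
      (ENNReal.tendsto_toReal ENNReal.zero_ne_top).comp hsq
  have h3 := (Real.continuous_sqrt.tendsto 0).comp h2
  rw [Real.sqrt_zero] at h3
  refine h3.congr fun N => ?_
  simp [ENNReal.toReal_pow, Real.sqrt_sq]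

end MulOp

/-! ### Hilbert-Schmidt densities of Fourier multipliers -/

section Density

variable {K : Type*} [NormedAddCommGroup K] [InnerProductSpace ℂ K] [CompleteSpace K]
  {ι : Type*} (e : HilbertBasis ι ℂ K)

/-- The squared Hilbert-Schmidt norm of a bounded operator on `K`. -/
noncomputable def hsSq (T : K →L[ℂ] K) : ℝ≥0∞ := ∑' n, ‖T (e n)‖ₑ ^ 2

/-- The Hilbert-Schmidt inner product of bounded operators on `K`. -/
noncomputable def hsInner (S T : K →L[ℂ] K) : ℂ := ∑' n, ⟪S (e n), T (e n)⟫_ℂ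

/-- The squared Hilbert-Schmidt norm of the convolution kernel of a Fourier multiplier. -/
noncomputable def dens (m : ℝ → K →L[ℂ] K) (t : ℝ) : ℝ≥0∞ := ∑' n, ‖kern e m n t‖ₑ ^ 2

/-- The Hilbert-Schmidt product of the convolution kernels of two Fourier multipliers. -/
noncomputable def kernProd (m₁ m : ℝ → K →L[ℂ] K) (t : ℝ) : ℂ :=
  ∑' n, ⟪kern e m₁ n t, kern e m n t⟫_ℂ

variable {e} [Countable ι]

theorem lintegral_tsum_fourierInv {h : ι → ℝ → K} (hh : ∀ n, BddSupp (h n)) :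
    ∫⁻ t, ∑' n, ‖𝓕⁻ (h n) t‖ₑ ^ 2 = ∫⁻ w, ∑' n, ‖h n w‖ₑ ^ 2 := by
  rw [lintegral_tsum fun n => ((hh n).continuous_fourierInv.enorm.measurable.pow_const 2).aemeasurable,
    lintegral_tsum fun n => (hh n).meas.enorm.pow_const 2]
  exact tsum_congr fun n => (hh n).lintegral_fourierInv

theorem measurable_dens {m : ℝ → K →L[ℂ] K} (h : ∀ v, BddSupp fun w => m w v) :
    Measurable (dens e m) :=
  Measurable.tsum fun n => (h (e n)).continuous_fourierInv.enorm.measurable.pow_const 2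

theorem lintegral_dens {m : ℝ → K →L[ℂ] K} (h : ∀ v, BddSupp fun w => m w v) :
    ∫⁻ t, dens e m t = ∫⁻ w, hsSq e (m w) :=
  lintegral_tsum_fourierInv fun n => h (e n)

variable {A A' : L2 K →L[ℂ] L2 K} {m m' : ℝ → K →L[ℂ] K}

theorem lintegral_hsSq_ne_top {m : ℝ → K →L[ℂ] K} (hs : ∃ R, ∀ w, R < |w| → m w = 0)
    (hC : ∃ C : ℝ≥0∞, C ≠ ⊤ ∧ ∀ w, ∑' n, ‖m w (e n)‖ₑ ^ 2 ≤ C) :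
    ∫⁻ w, hsSq e (m w) ≠ ⊤ := by
  obtain ⟨R, hR⟩ := hs
  obtain ⟨C, hC, hC'⟩ := hC
  refine ne_top_of_le_ne_top (b := ∫⁻ w, (Set.Icc (-R) R).indicator (fun _ => C) w) ?_
    (lintegral_mono fun w => ?_)
  · rw [lintegral_indicator_const measurableSet_Icc, Real.volume_Icc]
    exact ENNReal.mul_ne_top hC ENNReal.ofReal_ne_top
  · by_cases hw : w ∈ Set.Icc (-R) R
    · rw [Set.indicator_of_mem hw]
      exact hC' w
    · have : R < |w| := by
        by_contra h3
        exact hw (abs_le.1 (not_lt.1 h3))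
      rw [hR w this]
      simp [hsSq]

theorem IsMult.lintegral_hsSq_ne_top (h : IsMult e A m m') : ∫⁻ w, hsSq e (m w) ≠ ⊤ :=
  SpectralFlow.lintegral_hsSq_ne_top (h.supp.imp fun _ hR w hw => (hR w hw).1) h.hs

theorem IsMult.lintegral_hsSq_ne_top' (h : IsMult e A m m') : ∫⁻ w, hsSq e (m' w) ≠ ⊤ :=
  SpectralFlow.lintegral_hsSq_ne_top (h.supp.imp fun _ hR w hw => (hR w hw).2) h.hs'

theorem IsMult.lintegral_dens_ne_top (h : IsMult e A m m') : ∫⁻ t, dens e m t ≠ ⊤ := by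
  rw [lintegral_dens h.col]
  exact h.lintegral_hsSq_ne_top

theorem IsNuclear.tsum_enorm_sq_ne_top {E F : Type*} [NormedAddCommGroup E]
    [InnerProductSpace ℂ E] [CompleteSpace E] [NormedAddCommGroup F] [InnerProductSpace ℂ F]
    [CompleteSpace F] {T : E →L[ℂ] F} (h : IsNuclear T) {κ : Type*} (b : HilbertBasis κ ℂ E) :
    ∑' k, ‖T (b k)‖ₑ ^ 2 ≠ ⊤ := by
  have h1 := ENNReal.ofReal_tsum_of_nonneg (fun k => sq_nonneg ‖T (b k)‖) (h.summable_norm_sq b)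
  simp_rw [ENNReal.ofReal_pow (norm_nonneg _), ofReal_norm] at h1
  rw [← h1]
  exact ENNReal.ofReal_ne_top

variable [TopologicalSpace.SeparableSpace K] {P : ℝ → ℝ} {c d : ℝ}

theorem countable_basisSet_L2 : Countable (basisSet (L2 K)) := by
  have := UniformSpace.secondCountable_of_separable K
  have : Fact ((2 : ℝ≥0∞) ≠ ⊤) := ⟨by simp⟩
  exact HilbertBasis.countable_of_separable (hilbBasis (L2 K))

/-- The squared Hilbert-Schmidt norm of the commutator is the integral of `dens e m'` weighted by `∫
|P(y + t) - P(y)|² dy ≥ |t| - (d - c)`. Nuclearity thus yields half a derivative of the symbol in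
`L²`, the only regularity in `w` available for the projectors. -/
theorem IsMult.lintegral_mul_dens_ne_top (h : IsMult e A m m') (hP : IsSwitch 0 1 c d P)
    (hPm : Measurable P) (hn : IsNuclear (opComm A (mulOp K P))) :
    ∫⁻ t, ‖t‖ₑ * dens e m' t ≠ ⊤ := by
  have := countable_basisSet_L2 (K := K)
  have h1 := hn.tsum_enorm_sq_ne_top (hilbBasis (L2 K))
  rw [(h.rows.opComm (hP.memLp_top hPm)).tsum_enorm_sq (hilbBasis (L2 K))] at h1
  have hW : Measurable fun p : ℝ × ℝ => ‖P (p.1 + p.2) - P p.1‖ₑ ^ 2 := by fun_prop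
  have hWd : Measurable (Function.uncurry fun y t : ℝ =>
      ‖P (y + t) - P y‖ₑ ^ 2 * dens e m' t) :=
    Measurable.mul hW ((measurable_dens h.col').comp measurable_snd)
  have h2 : ∫⁻ y, ∑' n, ∫⁻ x, ‖((P x - P y : ℝ) : ℂ) • kern e m' n (x - y)‖ₑ ^ 2 =
      ∫⁻ t, (∫⁻ y, ‖P (y + t) - P y‖ₑ ^ 2) * dens e m' t := by
    calc _ = ∫⁻ y, ∫⁻ t, ‖P (y + t) - P y‖ₑ ^ 2 * dens e m' t := by
          refine lintegral_congr fun y => ?_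
          simp_rw [dens, ← ENNReal.tsum_mul_left]
          rw [lintegral_tsum]
          · refine tsum_congr fun n => ?_
            rw [← lintegral_add_left_eq_self _ y]
            refine lintegral_congr fun t => ?_
            rw [add_sub_cancel_left, enorm_smul, mul_pow]
            congr 2
            rw [← ofReal_norm, ← ofReal_norm, Complex.norm_real]
          · intro n
            refine Measurable.aemeasurable (Measurable.mul (hW.comp measurable_prodMk_left) ?_)
            exact (h.col' (e n)).continuous_fourierInv.enorm.measurable.pow_const 2
      _ = ∫⁻ t, ∫⁻ y, ‖P (y + t) - P y‖ₑ ^ 2 * dens e m' t :=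
          lintegral_lintegral_swap hWd.aemeasurable
      _ = _ := by
          refine lintegral_congr fun t => ?_
          have h4 : Measurable fun y => ‖P (y + t) - P y‖ₑ ^ 2 := by fun_prop
          rw [lintegral_mul_const _ h4]
  rw [h2] at h1
  have h3 : ∫⁻ t, dens e m' t ≠ ⊤ := by
    rw [lintegral_dens h.col']
    exact h.lintegral_hsSq_ne_top'
  refine ne_top_of_le_ne_top (ENNReal.add_ne_top.2 ⟨h1, ENNReal.mul_ne_top
    (ENNReal.ofReal_ne_top (r := d - c)) h3⟩) ?_
  rw [← lintegral_const_mul _ (measurable_dens h.col'),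
    ← lintegral_add_right _ ((measurable_dens h.col').const_mul _)]
  refine lintegral_mono fun t => ?_
  rw [← add_mul]
  refine mul_le_mul_left ?_ _
  calc ‖t‖ₑ = ENNReal.ofReal ((|t| - (d - c)) + (d - c)) := by
        rw [sub_add_cancel, ← ofReal_norm, Real.norm_eq_abs]
    _ ≤ _ := ENNReal.ofReal_add_le.trans
        (add_le_add_left (hP.le_lintegral_shift_sub_sq t) _)

end Density

/-! ### Integrability of kernel products -/

section TraceFormula

variable {K : Type*} [NormedAddCommGroup K] [InnerProductSpace ℂ K] [CompleteSpace K]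
  {ι : Type*} {e : HilbertBasis ι ℂ K} [Countable ι]

theorem measurable_kernProd {m₁ m : ℝ → K →L[ℂ] K}
    (h₁ : ∀ v, BddSupp fun w => m₁ w v) (h : ∀ v, BddSupp fun w => m w v) :
    Measurable (kernProd e m₁ m) :=
  Measurable.tsum fun n =>
    ((h₁ (e n)).continuous_fourierInv.inner (h (e n)).continuous_fourierInv).measurable

theorem enorm_tsum_le {α : Type*} (f : α → ℂ) : ‖∑' a, f a‖ₑ ≤ ∑' a, ‖f a‖ₑ := by
  by_cases hf : Summable fun a => ‖f a‖
  · rw [← ofReal_norm]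
    simp_rw [← ofReal_norm]
    rw [← ENNReal.ofReal_tsum_of_nonneg (fun _ => norm_nonneg _) hf]
    exact ENNReal.ofReal_le_ofReal (norm_tsum_le_tsum_norm hf)
  · rw [tsum_eq_zero_of_not_summable fun h => hf h.norm]
    simp

theorem tsum_enorm_inner_le {E : Type*} [NormedAddCommGroup E] [InnerProductSpace ℂ E]
    {α : Type*} (f g : α → E) :
    ∑' a, ‖⟪f a, g a⟫_ℂ‖ₑ ≤ ∑' a, ‖f a‖ₑ ^ 2 + ∑' a, ‖g a‖ₑ ^ 2 := by
  rw [← ENNReal.tsum_add]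
  exact ENNReal.tsum_le_tsum fun a => enorm_inner_le_add_sq _ _

theorem enorm_kernProd_le (m₁ m : ℝ → K →L[ℂ] K) (t : ℝ) :
    ‖kernProd e m₁ m t‖ₑ ≤ dens e m₁ t + dens e m t :=
  (enorm_tsum_le _).trans (tsum_enorm_inner_le _ _)

variable {A A' G : L2 K →L[ℂ] L2 K} {m m' mg mg' : ℝ → K →L[ℂ] K}

theorem lintegral_hsSq_comp_add (m : ℝ → K →L[ℂ] K) (η : ℝ) :
    ∫⁻ w, hsSq e (m (w + η)) = ∫⁻ w, hsSq e (m w) :=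
  lintegral_add_right_eq_self (fun w => hsSq e (m w)) η

/-- Plancherel, column by column: a shift of the symbol is a character on the kernel. The
correlation is therefore the Fourier transform of `kernProd`, and its derivative at `0` is a first
moment. -/
theorem IsMult.integral_hsInner (h : IsMult e A m m') (hg : IsMult e G mg mg') (η : ℝ) :
    ∫ w, hsInner e (mg' w) (m (w + η)) =
      ∫ t, (Real.fourierChar (-(η * t)) : ℂ) * kernProd e mg' m t := by
  have hc : ∀ n, BddSupp fun w => m (w + η) (e n) := fun n => (h.col (e n)).comp_add η
  have hc' : ∀ n, BddSupp fun w => mg' w (e n) := fun n => hg.col' (e n)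
  simp only [hsInner]
  rw [integral_tsum fun n => (hc' n).meas.inner (hc n).meas]
  · have e1 : ∀ t, (Real.fourierChar (-(η * t)) : ℂ) * kernProd e mg' m t =
        ∑' n, ⟪𝓕⁻ (fun w => mg' w (e n)) t, 𝓕⁻ (fun w => m (w + η) (e n)) t⟫_ℂ := fun t => by
      rw [kernProd, ← tsum_mul_left]
      refine tsum_congr fun n => ?_
      rw [fourierInv_comp_add (fun w => m w (e n)), Circle.smul_def, inner_smul_right]
      rfl
    simp_rw [e1]
    rw [integral_tsum fun n => ((hc' n).continuous_fourierInv.inner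
      (hc n).continuous_fourierInv).aestronglyMeasurable]
    · exact tsum_congr fun n => ((hc' n).integral_inner_fourierInv (hc n)).symm
    · refine ne_top_of_le_ne_top (ENNReal.add_ne_top.2 ⟨hg.lintegral_hsSq_ne_top',
        h.lintegral_hsSq_ne_top⟩) ?_
      rw [← lintegral_hsSq_comp_add m η]
      simp only [hsSq]
      rw [← lintegral_tsum_fourierInv hc', ← lintegral_tsum_fourierInv hc, ← lintegral_tsum,
        ← lintegral_add_left]
      · exact lintegral_mono fun t => tsum_enorm_inner_le _ _
      · exact Measurable.tsum fun n =>
          (hc' n).continuous_fourierInv.enorm.measurable.pow_const 2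
      · exact fun n => ((hc' n).continuous_fourierInv.inner
          (hc n).continuous_fourierInv).enorm.measurable.aemeasurable
  · refine ne_top_of_le_ne_top (ENNReal.add_ne_top.2 ⟨hg.lintegral_hsSq_ne_top',
      h.lintegral_hsSq_ne_top⟩) ?_
    rw [← lintegral_hsSq_comp_add m η]
    simp only [hsSq]
    rw [← lintegral_tsum fun n => ((hc' n).meas.inner (hc n).meas).enorm, ← lintegral_add_left']
    · exact lintegral_mono fun t => tsum_enorm_inner_le _ _
    · exact AEMeasurable.tsum fun n => (hc' n).meas.enorm.pow_const 2

theorem IsMult.lintegral_hsSq_sub (h : IsMult e A m m') (η : ℝ) :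
    ∫⁻ w, hsSq e (m (w + η) - m w) =
      ∫⁻ t, ‖(Real.fourierChar (-(η * t)) : ℂ) - 1‖ₑ ^ 2 * dens e m t := by
  have hc : ∀ n, BddSupp fun w => m (w + η) (e n) := fun n => (h.col (e n)).comp_add η
  have h1 := lintegral_tsum_fourierInv fun n => (hc n).sub (h.col (e n))
  have e1 : ∀ n t, 𝓕⁻ (fun w => m (w + η) (e n) - m w (e n)) t =
      ((Real.fourierChar (-(η * t)) : ℂ) - 1) • kern e m n t := fun n t => by
    have : 𝓕⁻ (fun w => m (w + η) (e n) - m w (e n)) t =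
        𝓕⁻ (fun w => m (w + η) (e n)) t - 𝓕⁻ (fun w => m w (e n)) t := by
      simp only [Real.fourierInv_eq, smul_sub]
      refine integral_sub ?_ ?_
      · simpa using (Real.fourierIntegral_convergent_iff (μ := volume)
          (f := fun w => m (w + η) (e n)) (-t)).2 (hc n).integrable
      · simpa using (Real.fourierIntegral_convergent_iff (μ := volume)
          (f := fun w => m w (e n)) (-t)).2 (h.col (e n)).integrable
    rw [this, fourierInv_comp_add (fun w => m w (e n)), sub_smul, one_smul]
    rfl
  simp_rw [e1] at h1
  simp only [hsSq, sub_apply]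
  rw [← h1]
  refine lintegral_congr fun t => ?_
  rw [dens, ← ENNReal.tsum_mul_left]
  exact tsum_congr fun n => by rw [enorm_smul, mul_pow]

/-- Product of the bounds `2π|s|` and `2`. Linear growth is what a first absolute moment can
dominate. -/
theorem norm_fourierChar_sub_one_sq_le (s : ℝ) :
    ‖(Real.fourierChar s : ℂ) - 1‖ ^ 2 ≤ 4 * Real.pi * |s| := by
  have h1 : ‖(Real.fourierChar s : ℂ) - 1‖ ≤ 2 * Real.pi * |s| := by
    have := Real.norm_exp_I_mul_ofReal_sub_one_le (x := 2 * Real.pi * s)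
    rw [Real.fourierChar_apply]
    convert this using 1
    · congr 3
      push_cast
      ring
    · rw [Real.norm_eq_abs, abs_mul, abs_of_pos Real.two_pi_pos]
  have h2 : ‖(Real.fourierChar s : ℂ) - 1‖ ≤ 2 := by
    refine (norm_sub_le _ _).trans ?_
    rw [Circle.norm_coe, norm_one]
    norm_num
  nlinarith [norm_nonneg ((Real.fourierChar s : ℂ) - 1)]

/-- The mean square modulus of continuity of a symbol whose kernel has a finite first moment is
`o(η)`. -/
theorem IsMult.tendsto_lintegral_hsSq_sub (h : IsMult e A m m')
    (h1 : ∫⁻ t, ‖t‖ₑ * dens e m t ≠ ⊤) :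
    Tendsto (fun η => ‖η‖ₑ⁻¹ * ∫⁻ w, hsSq e (m (w + η) - m w)) (𝓝[≠] 0) (𝓝 0) := by
  have hmeas : ∀ η : ℝ, Measurable fun t : ℝ =>
      ‖(Real.fourierChar (-(η * t)) : ℂ) - 1‖ₑ ^ 2 * dens e m t := fun η =>
    (Continuous.measurable (by fun_prop)).mul (measurable_dens h.col)
  have e1 : ∀ η : ℝ, ‖η‖ₑ⁻¹ * ∫⁻ w, hsSq e (m (w + η) - m w) = ∫⁻ t, ‖η‖ₑ⁻¹ *
      (‖(Real.fourierChar (-(η * t)) : ℂ) - 1‖ₑ ^ 2 * dens e m t) := fun η => by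
    rw [h.lintegral_hsSq_sub, lintegral_const_mul _ (hmeas η)]
  simp_rw [e1]
  rw [show (0 : ℝ≥0∞) = ∫⁻ _ : ℝ, 0 from lintegral_zero.symm]
  have hfin : ∀ᵐ t, dens e m t < ⊤ :=
    ae_lt_top (measurable_dens h.col) h.lintegral_dens_ne_top
  -- Two bounds share the work: `4π |t|` is independent of `η` and integrable against the density,
  -- while `|η| (2π t)²` gives the pointwise limit although it need not be integrable.
  refine tendsto_lintegral_filter_of_dominated_convergence
    (fun t => ENNReal.ofReal (4 * Real.pi) * (‖t‖ₑ * dens e m t))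
    (Eventually.of_forall fun η => ((hmeas η).const_mul _)) ?_ ?_ ?_
  · filter_upwards [self_mem_nhdsWithin] with η hη
    refine Eventually.of_forall fun t => ?_
    rw [← mul_assoc, ← mul_assoc]
    refine mul_le_mul_left ?_ _
    rw [← ofReal_norm, ← ofReal_norm, ← ofReal_norm, ← ENNReal.ofReal_inv_of_pos
      (norm_pos_iff.2 hη), ← ENNReal.ofReal_pow (norm_nonneg _),
      ← ENNReal.ofReal_mul (by positivity), ← ENNReal.ofReal_mul (by positivity)]
    refine ENNReal.ofReal_le_ofReal ?_
    rw [inv_mul_le_iff₀ (norm_pos_iff.2 hη)]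
    refine (norm_fourierChar_sub_one_sq_le _).trans_eq ?_
    rw [abs_neg, abs_mul, Real.norm_eq_abs, Real.norm_eq_abs]
    ring
  · rw [lintegral_const_mul]
    · exact ENNReal.mul_ne_top ENNReal.ofReal_ne_top h1
    · exact measurable_enorm.mul (measurable_dens h.col)
  · filter_upwards [hfin] with t ht
    have h2 : Tendsto (fun η : ℝ => ENNReal.ofReal (|η| * (2 * Real.pi * t) ^ 2) * dens e m t)
        (𝓝[≠] 0) (𝓝 0) := by
      rw [← zero_mul (dens e m t)]
      refine ENNReal.Tendsto.mul_const ?_ (Or.inr ht.ne)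
      rw [← ENNReal.ofReal_zero]
      refine ENNReal.tendsto_ofReal (Tendsto.mono_left ?_ nhdsWithin_le_nhds)
      have : Continuous fun η : ℝ => |η| * (2 * Real.pi * t) ^ 2 := by fun_prop
      simpa using this.tendsto 0
    refine tendsto_of_tendsto_of_tendsto_of_le_of_le' tendsto_const_nhds h2
      (Eventually.of_forall fun _ => zero_le) ?_
    filter_upwards [self_mem_nhdsWithin] with η hη
    rw [← mul_assoc]
    refine mul_le_mul_left ?_ _
    rw [← ofReal_norm, ← ofReal_norm, ← ENNReal.ofReal_inv_of_pos
      (norm_pos_iff.2 hη), ← ENNReal.ofReal_pow (norm_nonneg _),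
      ← ENNReal.ofReal_mul (by positivity)]
    refine ENNReal.ofReal_le_ofReal ?_
    rw [inv_mul_le_iff₀ (norm_pos_iff.2 hη)]
    have h3 : ‖(Real.fourierChar (-(η * t)) : ℂ) - 1‖ ≤ |2 * Real.pi * t| * |η| := by
      have := Real.norm_exp_I_mul_ofReal_sub_one_le (x := 2 * Real.pi * (-(η * t)))
      rw [Real.fourierChar_apply]
      convert this using 1
      · congr 3
        push_cast
        ring
      · rw [Real.norm_eq_abs, ← abs_mul, ← abs_neg]
        congr 1
        ring
    calc ‖(Real.fourierChar (-(η * t)) : ℂ) - 1‖ ^ 2 ≤ (|2 * Real.pi * t| * |η|) ^ 2 := by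
          gcongr
      _ = _ := by
          rw [mul_pow, sq_abs, Real.norm_eq_abs]
          ring

end TraceFormula

/-! ### Trace of a commutator of multipliers with a switch -/

section TraceFormula

variable {K : Type*} [NormedAddCommGroup K] [InnerProductSpace ℂ K] [CompleteSpace K]
  {ι : Type*} {e : HilbertBasis ι ℂ K} [Countable ι]
  {A A' G : L2 K →L[ℂ] L2 K} {m m' mg mg' : ℝ → K →L[ℂ] K} {P : ℝ → ℝ} {c d : ℝ}

theorem IsMult.lintegral_dens_ne_top' (h : IsMult e A m m') : ∫⁻ t, dens e m' t ≠ ⊤ := by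
  rw [lintegral_dens h.col']
  exact h.lintegral_hsSq_ne_top'

theorem lintegral_mul_enorm_kernProd_ne_top {m₁ m : ℝ → K →L[ℂ] K}
    (hc₁ : ∀ v, BddSupp fun w => m₁ w v)
    {ρ : ℝ → ℝ≥0∞} (hρ : Measurable ρ) (h₁ : ∫⁻ t, ρ t * dens e m₁ t ≠ ⊤)
    (h : ∫⁻ t, ρ t * dens e m t ≠ ⊤) :
    ∫⁻ t, ρ t * ‖kernProd e m₁ m t‖ₑ ≠ ⊤ := by
  refine ne_top_of_le_ne_top (ENNReal.add_ne_top.2 ⟨h₁, h⟩) ?_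
  have hm : Measurable fun t => ρ t * dens e m₁ t := hρ.mul (measurable_dens hc₁)
  rw [← lintegral_add_left hm]
  refine lintegral_mono fun t => ?_
  rw [← mul_add]
  exact mul_le_mul_right (enorm_kernProd_le _ _ _) _

theorem integrable_kernProd (h : IsMult e A m m') (hg : IsMult e G mg mg') :
    Integrable (kernProd e mg' m) := by
  refine ⟨(measurable_kernProd hg.col' h.col).aestronglyMeasurable, ?_⟩
  have := lintegral_mul_enorm_kernProd_ne_top (e := e) (m := m) hg.col' (ρ := fun _ => 1)
    measurable_const (by simpa using hg.lintegral_dens_ne_top')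
    (by simpa using h.lintegral_dens_ne_top)
  simp only [one_mul] at this
  exact this.lt_top

variable [TopologicalSpace.SeparableSpace K]

theorem integrable_mul_kernProd (hP : IsSwitch 0 1 c d P) (hPm : Measurable P)
    (h : IsMult e A m m') (hA' : IsMult e A' m' m) (hg : IsMult e G mg mg')
    (hn' : IsNuclear (opComm A' (mulOp K P))) (hgn : IsNuclear (opComm G (mulOp K P))) :
    Integrable fun t : ℝ => (t : ℂ) * kernProd e mg' m t := by
  refine ⟨(Complex.measurable_ofReal.mul
    (measurable_kernProd hg.col' h.col)).aestronglyMeasurable, ?_⟩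
  have := lintegral_mul_enorm_kernProd_ne_top (e := e) (m := m) hg.col' measurable_enorm
    (hg.lintegral_mul_dens_ne_top hP hPm hgn) (hA'.lintegral_mul_dens_ne_top hP hPm hn')
  refine lt_of_eq_of_lt (lintegral_congr fun t => ?_) this.lt_top
  rw [enorm_mul, ← ofReal_norm (t : ℂ), Complex.norm_real, ofReal_norm]

/-- This justifies Fubini in `(y, t)`: the increments of `P` have `L¹` norm `O(1 + |t|)`, and the
kernel product has finite absolute moments of orders zero and one. -/
theorem integrable_shift_mul_kernProd (hP : IsSwitch 0 1 c d P) (hPm : Measurable P)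
    (hcd : c ≤ d)
    (h : IsMult e A m m') (hA' : IsMult e A' m' m) (hg : IsMult e G mg mg')
    (hn' : IsNuclear (opComm A' (mulOp K P))) (hgn : IsNuclear (opComm G (mulOp K P))) :
    Integrable (fun p : ℝ × ℝ => ((P p.1 - P (p.1 + p.2) : ℝ) : ℂ) * kernProd e mg' m p.2)
      (volume.prod volume) := by
  have hk := measurable_kernProd (e := e) hg.col' h.col
  have hm : Measurable fun p : ℝ × ℝ =>
      ((P p.1 - P (p.1 + p.2) : ℝ) : ℂ) * kernProd e mg' m p.2 := by
    refine Measurable.mul ?_ (hk.comp measurable_snd)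
    exact Complex.measurable_ofReal.comp (by fun_prop)
  refine ⟨hm.aestronglyMeasurable, ?_⟩
  obtain ⟨C, hC0, hC⟩ := hP.lintegral_shift_sub_le hcd
  rw [HasFiniteIntegral, lintegral_prod_symm _ hm.enorm.aemeasurable]
  have h1 := (integrable_kernProd h hg).norm
  have h2 := (integrable_mul_kernProd hP hPm h hA' hg hn' hgn).norm
  refine lt_of_le_of_lt (lintegral_mono (g := fun t => ‖C * (‖kernProd e mg' m t‖ +
    ‖(t : ℂ) * kernProd e mg' m t‖)‖ₑ) fun t => ?_) ((h1.add h2).const_mul C).2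
  have e1 : ∀ y, ‖((P y - P (y + t) : ℝ) : ℂ) * kernProd e mg' m t‖ₑ =
      ‖P (y + t) - P y‖ₑ * ‖kernProd e mg' m t‖ₑ := fun y => by
    rw [enorm_mul, ← ofReal_norm ((P y - P (y + t) : ℝ) : ℂ), Complex.norm_real, ofReal_norm,
      enorm_sub_rev]
  simp_rw [e1]
  have hm1 : Measurable fun y => ‖P (y + t) - P y‖ₑ := by fun_prop
  rw [lintegral_mul_const _ hm1]
  refine (mul_le_mul_left (hC t) _).trans_eq ?_
  rw [← ofReal_norm, ← ENNReal.ofReal_mul (by positivity), ← ofReal_norm]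
  congr 1
  rw [Real.norm_of_nonneg (by positivity), norm_mul, Complex.norm_real, Real.norm_eq_abs]
  ring

/-- The trace of `[A, P] G` for Fourier multipliers `A`, `G` and a spatial switch function `P`. -/
theorem IsMult.opTrace_opComm_comp (hP : IsSwitch 0 1 c d P) (hPm : Measurable P) (hcd : c ≤ d)
    (h : IsMult e A m m') (hA' : IsMult e A' m' m)
    (hadj : A' = ContinuousLinearMap.adjoint A) (hg : IsMult e G mg mg')
    (hn : IsNuclear (opComm A (mulOp K P)))
    (hn' : IsNuclear (opComm A' (mulOp K P))) (hgn : IsNuclear (opComm G (mulOp K P))) :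
    opTrace (opComm A (mulOp K P) ∘L G) = -∫ t : ℝ, (t : ℂ) * kernProd e mg' m t := by
  have hcount := countable_basisSet_L2 (K := K)
  set b := hilbBasis (L2 K) with hb
  have hPt := hP.memLp_top hPm
  set k := kernProd e mg' m with hk
  have hki := integrable_kernProd h hg
  set Φ : ℝ → ℂ := fun y => ∫ t, ((P y - P (y + t) : ℝ) : ℂ) * k t with hΦ
  have hprod := integrable_shift_mul_kernProd hP hPm hcd h hA' hg hn' hgn
  have hΦi : Integrable Φ := hprod.integral_prod_left
  -- the truncated traces
  have htr : ∀ N : ℕ, opTrace (opComm A (mulOp K P) ∘L (mulOp K (cutoff N) ∘L G)) =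
      ∫ y, (cutoff N y : ℂ) * Φ y := by
    intro N
    have hX : Rows e (ContinuousLinearMap.adjoint (opComm A (mulOp K P))) fun n y x =>
        ((P y - P x : ℝ) : ℂ) • kern e m n (x - y) := by
      have e1 : (fun n y x => ((P y - P x : ℝ) : ℂ) • kern e m n (x - y)) =
          fun n y x => (P y : ℂ) • kern e m n (x - y) - (P x : ℂ) • kern e m n (x - y) := by
        funext n y x
        rw [← sub_smul, Complex.ofReal_sub]
      rw [adjoint_opComm_mulOp hPt, ← hadj, e1]
      exact (hA'.rows.mulOp_comp hPt).sub (hA'.rows.comp_mulOp hPt)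
    have hB := hg.rows.mulOp_comp (memLp_cutoff N)
    have hB2 : ∑' i, ‖(mulOp K (cutoff N) ∘L G) (b i)‖ₑ ^ 2 ≠ ⊤ := by
      rw [hB.tsum_enorm_sq b]
      have e1 : ∀ y, ∑' n, ∫⁻ x, ‖(cutoff N y : ℂ) • kern e mg' n (x - y)‖ₑ ^ 2 =
          (Set.Icc (-N : ℝ) N).indicator (fun _ => ∫⁻ t, dens e mg' t) y := fun y => by
        by_cases hy : y ∈ Set.Icc (-N : ℝ) N
        · rw [Set.indicator_of_mem hy, cutoff, Set.indicator_of_mem hy]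
          simp only [Pi.one_apply, Complex.ofReal_one, one_smul, dens]
          have hm : ∀ n, AEMeasurable (fun t => ‖kern e mg' n t‖ₑ ^ 2) volume := fun n =>
            ((hg.col' (e n)).continuous_fourierInv.enorm.measurable.pow_const 2).aemeasurable
          rw [lintegral_tsum hm]
          exact tsum_congr fun n =>
            lintegral_sub_right_eq_self (fun x => ‖kern e mg' n x‖ₑ ^ 2) y
        · rw [Set.indicator_of_notMem hy, cutoff, Set.indicator_of_notMem hy]
          simp
      simp_rw [e1]
      rw [lintegral_indicator_const measurableSet_Icc, Real.volume_Icc]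
      exact ENNReal.mul_ne_top hg.lintegral_dens_ne_top' ENNReal.ofReal_ne_top
    calc opTrace (opComm A (mulOp K P) ∘L (mulOp K (cutoff N) ∘L G))
        = ∑' i, ⟪ContinuousLinearMap.adjoint (opComm A (mulOp K P)) (b i),
            (mulOp K (cutoff N) ∘L G) (b i)⟫_ℂ := by
          refine tsum_congr fun i => ?_
          rw [ContinuousLinearMap.adjoint_inner_left]
          rfl
      _ = _ := by
          rw [hX.tsum_inner hB b (hn.adjoint.tsum_enorm_sq_ne_top b) hB2]
          refine integral_congr_ae (Eventually.of_forall fun y => ?_)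
          have e2 : ∀ n, ∫ x, ⟪(cutoff N y : ℂ) • kern e mg' n (x - y),
              ((P y - P x : ℝ) : ℂ) • kern e m n (x - y)⟫_ℂ = (cutoff N y : ℂ) *
                ∫ t, ((P y - P (y + t) : ℝ) : ℂ) * ⟪kern e mg' n t, kern e m n t⟫_ℂ := fun n => by
            rw [← integral_add_left_eq_self _ y, ← integral_const_mul]
            refine integral_congr_ae (Eventually.of_forall fun t => ?_)
            simp only [add_sub_cancel_left]
            rw [inner_smul_left, inner_smul_right, Complex.conj_ofReal]
          simp_rw [e2]
          rw [tsum_mul_left]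
          congr 1
          rw [← integral_tsum]
          · refine integral_congr_ae (Eventually.of_forall fun t => ?_)
            exact tsum_mul_left
          · intro n
            refine AEStronglyMeasurable.mul ?_ ((hg.col' (e n)).continuous_fourierInv.inner
              (h.col (e n)).continuous_fourierInv).aestronglyMeasurable
            exact (Complex.measurable_ofReal.comp (by fun_prop)).aestronglyMeasurable
          · obtain ⟨C, hC⟩ := hP.bounded
            have h3 : ∫⁻ t, ENNReal.ofReal (2 * C) * (dens e mg' t + dens e m t) ≠ ⊤ := by
              have hm : Measurable fun t => dens e mg' t + dens e m t :=
                (measurable_dens hg.col').add (measurable_dens h.col)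
              rw [lintegral_const_mul _ hm,
                lintegral_add_left (measurable_dens hg.col')]
              exact ENNReal.mul_ne_top ENNReal.ofReal_ne_top
                (ENNReal.add_ne_top.2 ⟨hg.lintegral_dens_ne_top', h.lintegral_dens_ne_top⟩)
            refine ne_top_of_le_ne_top h3 ?_
            rw [← lintegral_tsum]
            · refine lintegral_mono fun t => ?_
              simp_rw [enorm_mul]
              rw [ENNReal.tsum_mul_left]
              refine mul_le_mul' ?_ (tsum_enorm_inner_le _ _)
              rw [← ofReal_norm, Complex.norm_real]
              refine ENNReal.ofReal_le_ofReal ((norm_sub_le _ _).trans ?_)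
              have := hC y
              have := hC (y + t)
              simp only [Real.norm_eq_abs]
              linarith
            · intro n
              refine (AEStronglyMeasurable.mul ?_ ((hg.col' (e n)).continuous_fourierInv.inner
                (h.col (e n)).continuous_fourierInv).aestronglyMeasurable).enorm
              exact (Complex.measurable_ofReal.comp (by fun_prop)).aestronglyMeasurable
  -- A translation-invariant `G` need not be Hilbert-Schmidt on the whole line, whereas its
  -- truncations are. The cutoff is now removed on both sides, by dominated convergence for the
  -- integral and by strong convergence for the trace.
  have hlim1 : Tendsto (fun N : ℕ => ∫ y, (cutoff N y : ℂ) * Φ y) atTop (𝓝 (∫ y, Φ y)) := by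
    refine tendsto_integral_of_dominated_convergence (fun y => ‖Φ y‖) (fun N => ?_) hΦi.norm
      (fun N => Eventually.of_forall fun y => ?_) (Eventually.of_forall fun y => ?_)
    · exact (Complex.measurable_ofReal.comp (measurable_cutoff N)).aestronglyMeasurable.mul
        hΦi.aestronglyMeasurable
    · rw [norm_mul]
      exact mul_le_of_le_one_left (norm_nonneg _) (norm_cutoff_le N y)
    · refine tendsto_const_nhds.congr' ?_
      filter_upwards [eventually_cutoff_eq_one y] with N hN
      rw [hN, Complex.ofReal_one, one_mul]
  have hlim2 := hn.tendsto_opTrace_comp (B := G) (Bn := fun N => mulOp K (cutoff N) ∘L G)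
    (C := ‖G‖) (fun N => (ContinuousLinearMap.opNorm_comp_le _ _).trans
      (mul_le_of_le_one_left (norm_nonneg _) (norm_mulOp_cutoff_le N)))
    (fun x => tendsto_mulOp_cutoff (G x))
  simp_rw [htr] at hlim2
  rw [tendsto_nhds_unique hlim2 hlim1, hΦ, integral_integral_swap hprod, ← integral_neg]
  refine integral_congr_ae (Eventually.of_forall fun t => ?_)
  change ∫ y, ((P y - P (y + t) : ℝ) : ℂ) * k t = -((t : ℂ) * k t)
  rw [integral_mul_const, integral_complex_ofReal]
  have e3 : ∫ y, (P y - P (y + t)) = -t := by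
    refine Eq.trans ?_ (congrArg Neg.neg (hP.integral_shift_sub hPm t))
    rw [← integral_neg]
    exact integral_congr_ae (Eventually.of_forall fun y => (neg_sub _ _).symm)
  rw [e3]
  push_cast
  ring

/-- The trace of `[A, P] G` is a derivative of the correlation of the two symbols. -/
theorem IsMult.hasDerivAt_integral_hsInner (hP : IsSwitch 0 1 c d P) (hPm : Measurable P)
    (hcd : c ≤ d) (h : IsMult e A m m') (hA' : IsMult e A' m' m)
    (hadj : A' = ContinuousLinearMap.adjoint A) (hg : IsMult e G mg mg')
    (hn : IsNuclear (opComm A (mulOp K P)))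
    (hn' : IsNuclear (opComm A' (mulOp K P))) (hgn : IsNuclear (opComm G (mulOp K P))) :
    HasDerivAt (fun η => ∫ w, hsInner e (mg' w) (m (w + η)))
      (2 * Real.pi * Complex.I * opTrace (opComm A (mulOp K P) ∘L G)) 0 := by
  have hF : (fun η => ∫ w, hsInner e (mg' w) (m (w + η))) = 𝓕 (kernProd e mg' m) := by
    ext η
    rw [h.integral_hsInner hg, Real.fourier_eq]
    refine integral_congr_ae (Eventually.of_forall fun t => ?_)
    simp [Circle.smul_def]
  have h2 := integrable_mul_kernProd hP hPm h hA' hg hn' hgn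
  have h3 := Real.hasDerivAt_fourier (integrable_kernProd h hg)
    (h2.congr (Eventually.of_forall fun t => (Complex.real_smul).symm)) 0
  rw [hF]
  refine h3.congr_deriv ?_
  rw [h.opTrace_opComm_comp hP hPm hcd hA' hadj hg hn hn' hgn, mul_neg, ← integral_const_mul,
    ← integral_neg, Real.fourier_eq]
  refine integral_congr_ae (Eventually.of_forall fun t => ?_)
  simp
  ring

end TraceFormula

/-! ### Traces of finite sums of rank-one operators -/

section PointwiseTrace

variable {K : Type*} [NormedAddCommGroup K] [InnerProductSpace ℂ K]
  {ι : Type*} (e : HilbertBasis ι ℂ K) {A B : Type*} [Fintype A] [Fintype B]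

/-- The operator `∑ aₖ |vₖ⟩⟨vₖ|`. -/
noncomputable def sumProj (v : A → K) (a : A → ℂ) : K →L[ℂ] K :=
  ∑ k, a k • InnerProductSpace.rankOne ℂ (v k) (v k)

theorem sumProj_apply (v : A → K) (a : A → ℂ) (x : K) :
    sumProj v a x = ∑ k, (a k * ⟪v k, x⟫_ℂ) • v k := by
  simp [sumProj, mul_smul]

theorem hasSum_inner_sumProj (v : A → K) (v' : B → K) (a : A → ℂ) (b : B → ℂ) :
    HasSum (fun n => ⟪sumProj v a (e n), sumProj v' b (e n)⟫_ℂ)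
      (∑ k, ∑ j, starRingEnd ℂ (a k) * b j * ((‖⟪v k, v' j⟫_ℂ‖ ^ 2 : ℝ) : ℂ)) := by
  have e0 : ∀ n, ⟪sumProj v a (e n), sumProj v' b (e n)⟫_ℂ = ∑ k, ∑ j,
      starRingEnd ℂ (a k) * b j * (⟪v' j, e n⟫_ℂ * ⟪e n, v k⟫_ℂ) * ⟪v k, v' j⟫_ℂ := fun n => by
    rw [sumProj_apply, sumProj_apply, sum_inner]
    refine Finset.sum_congr rfl fun k _ => ?_
    rw [inner_sum]
    refine Finset.sum_congr rfl fun j _ => ?_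
    rw [inner_smul_left, inner_smul_right, map_mul, inner_conj_symm]
    ring
  simp_rw [e0]
  refine hasSum_sum fun k _ => hasSum_sum fun j _ => ?_
  have h1 := ((e.hasSum_inner_mul_inner (v' j) (v k)).mul_left (starRingEnd ℂ (a k) * b j)).mul_right
    ⟪v k, v' j⟫_ℂ
  have e1 : starRingEnd ℂ (a k) * b j * ((‖⟪v k, v' j⟫_ℂ‖ ^ 2 : ℝ) : ℂ) =
      starRingEnd ℂ (a k) * b j * ⟪v' j, v k⟫_ℂ * ⟪v k, v' j⟫_ℂ := by
    rw [mul_assoc _ ⟪v' j, v k⟫_ℂ, ← inner_conj_symm (v' j), mul_comm (starRingEnd ℂ ⟪v k, v' j⟫_ℂ),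
      Complex.mul_conj, Complex.normSq_eq_norm_sq]
  rw [e1]
  exact h1

theorem hsInner_sumProj (v : A → K) (v' : B → K) (a : A → ℂ) (b : B → ℂ) :
    hsInner e (sumProj v a) (sumProj v' b) =
      ∑ k, ∑ j, starRingEnd ℂ (a k) * b j * ((‖⟪v k, v' j⟫_ℂ‖ ^ 2 : ℝ) : ℂ) :=
  (hasSum_inner_sumProj e v v' a b).tsum_eq

theorem hsSq_eq_of_hasSum {T : K →L[ℂ] K} {r : ℝ}
    (h : HasSum (fun n => ⟪T (e n), T (e n)⟫_ℂ) (r : ℂ)) : hsSq e T = ENNReal.ofReal r := by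
  have h1 : HasSum (fun n => ‖T (e n)‖ ^ 2) r := by
    refine Complex.hasSum_ofReal.1 ?_
    simpa [inner_self_eq_norm_sq_to_K] using h
  rw [← h1.tsum_eq, ENNReal.ofReal_tsum_of_nonneg (fun _ => by positivity) h1.summable]
  refine tsum_congr fun n => ?_
  rw [ENNReal.ofReal_pow (norm_nonneg _), ofReal_norm]

theorem hsSq_sumProj (v : A → K) (a : A → ℂ) :
    hsSq e (sumProj v a) = ENNReal.ofReal
      (∑ k, ∑ j, starRingEnd ℂ (a k) * a j * ((‖⟪v k, v j⟫_ℂ‖ ^ 2 : ℝ) : ℂ)).re := by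
  refine hsSq_eq_of_hasSum e ?_
  have h := hasSum_inner_sumProj e v v a a
  set z := ∑ k, ∑ j, starRingEnd ℂ (a k) * a j * ((‖⟪v k, v j⟫_ℂ‖ ^ 2 : ℝ) : ℂ)
  have h2 := (Complex.hasSum_im h).tsum_eq
  have h3 : (z.re : ℂ) = z := by
    refine Complex.ext rfl ?_
    rw [← h2]
    simp [inner_self_eq_norm_sq_to_K, ← Complex.ofReal_pow]
  rwa [h3]

/-- Idempotency gives `∑ᵢ |⟨vᵢ, vₖ⟩|² = ⟨vₖ, T vₖ⟩ = ‖T vₖ‖²`, which is at most `1` by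
Cauchy-Schwarz. The term `i = k` already equals `1`, so nothing is left for the others. -/
theorem sumProj_comp_self_orthonormal (v : A → K) (hv : ∀ k, ‖v k‖ = 1)
    (h : sumProj v 1 ∘L sumProj v 1 = sumProj v 1) : Orthonormal ℂ v := by
  classical
  refine ⟨hv, fun j k hjk => ?_⟩
  set T := sumProj v 1 with hT
  have hadj : ∀ x y, ⟪T x, y⟫_ℂ = ⟪x, T y⟫_ℂ := fun x y => by
    simp only [hT, sumProj_apply, sum_inner, inner_sum, inner_smul_left, inner_smul_right,
      inner_conj_symm, Pi.one_apply, one_mul]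
    exact Finset.sum_congr rfl fun k _ => mul_comm _ _
  have h1 : ((∑ i, ‖⟪v i, v k⟫_ℂ‖ ^ 2 : ℝ) : ℂ) = ⟪v k, T (v k)⟫_ℂ := by
    simp only [hT, sumProj_apply, inner_sum, inner_smul_right, Pi.one_apply, one_mul]
    push_cast
    refine Finset.sum_congr rfl fun i _ => ?_
    rw [← inner_conj_symm (v k) (v i), Complex.mul_conj, Complex.normSq_eq_norm_sq]
    push_cast
    rfl
  have h2 : ⟪v k, T (v k)⟫_ℂ = ((‖T (v k)‖ ^ 2 : ℝ) : ℂ) := by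
    conv_lhs => rw [← h, ContinuousLinearMap.comp_apply, ← hadj, inner_self_eq_norm_sq_to_K]
    simp
  have h3 : ∑ i, ‖⟪v i, v k⟫_ℂ‖ ^ 2 = ‖T (v k)‖ ^ 2 := by
    exact_mod_cast h1.trans h2
  have h4 : ‖T (v k)‖ ^ 2 ≤ ‖T (v k)‖ := by
    have := norm_inner_le_norm (𝕜 := ℂ) (v k) (T (v k))
    rw [h2, hv, one_mul, Complex.norm_real, Real.norm_of_nonneg (by positivity)] at this
    exact this
  have h5 : ∑ i, ‖⟪v i, v k⟫_ℂ‖ ^ 2 ≤ 1 := by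
    rw [h3]
    nlinarith [norm_nonneg (T (v k))]
  have h6 : ∑ i ∈ {j, k}, ‖⟪v i, v k⟫_ℂ‖ ^ 2 ≤ ∑ i, ‖⟪v i, v k⟫_ℂ‖ ^ 2 :=
    Finset.sum_le_sum_of_subset_of_nonneg (Finset.subset_univ _) fun _ _ _ => by positivity
  rw [Finset.sum_pair hjk, inner_self_eq_norm_sq_to_K, hv] at h6
  norm_num at h6
  have h7 : ‖⟪v j, v k⟫_ℂ‖ ^ 2 ≤ 0 := by linarith
  exact norm_eq_zero.1 (by nlinarith [norm_nonneg ⟪v j, v k⟫_ℂ])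

theorem Orthonormal.sum_norm_inner_sq_le {v : A → K} (hv : Orthonormal ℂ v) (x : K) :
    ∑ k, ‖⟪v k, x⟫_ℂ‖ ^ 2 ≤ ‖x‖ ^ 2 :=
  hv.sum_inner_products_le x

/-- These are the two quadratic quantities that bound the error in `norm_coupling_sub_le`: one for
the levels themselves, the other for `x = x' = 1`, where projections are compared. -/
theorem hsSq_sumProj_sub {v v' : A → K} (hv : Orthonormal ℂ v) (hv' : Orthonormal ℂ v')
    (x x' : A → ℝ) :
    hsSq e (sumProj v' (fun k => (x' k : ℂ)) - sumProj v fun k => (x k : ℂ)) = ENNReal.ofReal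
      (∑ k, x k ^ 2 + ∑ k, x' k ^ 2 - 2 * ∑ k, ∑ j, x k * x' j * ‖⟪v k, v' j⟫_ℂ‖ ^ 2) := by
  classical
  refine hsSq_eq_of_hasSum e ?_
  simp only [sub_apply, inner_sub_left, inner_sub_right]
  set a : A → ℂ := fun k => (x k : ℂ)
  set a' : A → ℂ := fun k => (x' k : ℂ)
  have h := ((hasSum_inner_sumProj e v' v' a' a').sub (hasSum_inner_sumProj e v v' a a')).sub
    ((hasSum_inner_sumProj e v' v a' a).sub (hasSum_inner_sumProj e v v a a))
  have key : ∀ {u : A → K}, Orthonormal ℂ u → ∀ y : A → ℝ,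
      ∑ k, ∑ j, starRingEnd ℂ (y k : ℂ) * (y j : ℂ) * ((‖⟪u k, u j⟫_ℂ‖ ^ 2 : ℝ) : ℂ) =
        ((∑ k, y k ^ 2 : ℝ) : ℂ) := by
    intro u hu y
    push_cast
    refine Finset.sum_congr rfl fun k _ => ?_
    rw [Finset.sum_eq_single k (fun j _ hj => by simp [hu.inner_eq_zero hj.symm])
      (fun h => absurd (Finset.mem_univ k) h)]
    rw [inner_self_eq_norm_sq_to_K, hu.norm_eq_one]
    simp [sq]
  rw [key hv, key hv'] at h
  refine Eq.subst (motive := fun z => HasSum _ z) ?_ h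
  rw [Finset.sum_comm (f := fun k j => starRingEnd ℂ (a' k) * a j * _)]
  push_cast
  simp only [a, a', Complex.conj_ofReal, two_mul]
  have e1 : ∀ k j, (‖⟪v' j, v k⟫_ℂ‖ : ℂ) = ‖⟪v k, v' j⟫_ℂ‖ := fun k j => by
    rw [norm_inner_symm]
  simp only [e1]
  have e2 : ∑ k, ∑ j, (x' j : ℂ) * (x k : ℂ) * (‖⟪v k, v' j⟫_ℂ‖ : ℂ) ^ 2 =
    ∑ k, ∑ j, (x k : ℂ) * (x' j : ℂ) * (‖⟪v k, v' j⟫_ℂ‖ : ℂ) ^ 2 := by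
    simp only [mul_comm (x' _ : ℂ)]
  rw [e2]
  ring

/-- Spectral shift for a doubly substochastic coupling `p` of two finite sets of levels. -/
theorem norm_coupling_sub_le {p : A → A → ℝ} (hp : ∀ k j, 0 ≤ p k j) (hrow : ∀ k, ∑ j, p k j ≤ 1)
    (hcol : ∀ j, ∑ k, p k j ≤ 1) {f g Θ : ℝ → ℂ} {C : ℝ} (hC : 0 ≤ C)
    (h1 : ∀ x y, ‖g y * f x - g y * f y - (Θ x - Θ y)‖ ≤ C * (x - y) ^ 2)
    (h2 : ∀ x, ‖g x * f x‖ ≤ C) (h3 : ∀ x, ‖Θ x‖ ≤ C) (x x' : A → ℝ) :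
    ‖∑ k, ∑ j, g (x k) * f (x' j) * (p k j : ℂ) - ∑ k, g (x k) * f (x k) -
        ∑ k, (Θ (x' k) - Θ (x k))‖ ≤
      C * (∑ k, x k ^ 2 + ∑ k, x' k ^ 2 - 2 * ∑ k, ∑ j, x k * x' j * p k j) +
      2 * C * (∑ _k : A, (1 : ℝ) ^ 2 + ∑ _k : A, (1 : ℝ) ^ 2 - 2 * ∑ k, ∑ j, 1 * 1 * p k j) := by
  -- The row and column defects, that is, the mass left unmatched by the coupling. They are the only
  -- obstruction to writing `∑ Θ(x') - ∑ Θ(x)` as a sum over pairs weighted by `p`.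
  set b : A → ℝ := fun k => 1 - ∑ j, p k j with hb
  set a : A → ℝ := fun j => 1 - ∑ k, p k j with ha
  have hb0 : ∀ k, 0 ≤ b k := fun k => sub_nonneg.2 (hrow k)
  have ha0 : ∀ k, 0 ≤ a k := fun k => sub_nonneg.2 (hcol k)
  have sr : ∀ (h : A → ℂ), ∑ k, h k = ∑ k, ∑ j, h k * (p k j : ℂ) + ∑ k, h k * (b k : ℂ) := by
    intro h
    rw [← Finset.sum_add_distrib]
    refine Finset.sum_congr rfl fun k _ => ?_
    simp only [hb]
    push_cast
    rw [← Finset.mul_sum]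
    ring
  have sc : ∀ (h : A → ℂ), ∑ j, h j = ∑ k, ∑ j, h j * (p k j : ℂ) + ∑ j, h j * (a j : ℂ) := by
    intro h
    rw [Finset.sum_comm, ← Finset.sum_add_distrib]
    refine Finset.sum_congr rfl fun k _ => ?_
    simp only [ha]
    push_cast
    rw [← Finset.mul_sum]
    ring
  have e1 : ∑ k, ∑ j, g (x k) * f (x' j) * (p k j : ℂ) - ∑ k, g (x k) * f (x k) -
      ∑ k, (Θ (x' k) - Θ (x k)) =
      ∑ k, ∑ j, (g (x k) * f (x' j) - g (x k) * f (x k) - (Θ (x' j) - Θ (x k))) * (p k j : ℂ) -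
      ∑ k, g (x k) * f (x k) * (b k : ℂ) - ∑ j, Θ (x' j) * (a j : ℂ) +
      ∑ k, Θ (x k) * (b k : ℂ) := by
    rw [Finset.sum_sub_distrib, sr fun k => g (x k) * f (x k), sr fun k => Θ (x k),
      sc fun k => Θ (x' k)]
    simp only [sub_mul, Finset.sum_sub_distrib]
    ring
  have bnd : ∀ (h : A → ℂ) (r : A → ℝ), (∀ k, 0 ≤ r k) → (∀ k, ‖h k‖ ≤ C) →
      ‖∑ k, h k * (r k : ℂ)‖ ≤ C * ∑ k, r k := by
    intro h r hr hh
    rw [Finset.mul_sum]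
    refine (norm_sum_le _ _).trans (Finset.sum_le_sum fun k _ => ?_)
    rw [norm_mul, Complex.norm_real, Real.norm_of_nonneg (hr k)]
    exact mul_le_mul_of_nonneg_right (hh k) (hr k)
  have b1 : ‖∑ k, ∑ j, (g (x k) * f (x' j) - g (x k) * f (x k) - (Θ (x' j) - Θ (x k))) *
      (p k j : ℂ)‖ ≤ C * ∑ k, ∑ j, (x' j - x k) ^ 2 * p k j := by
    rw [Finset.mul_sum]
    refine (norm_sum_le _ _).trans (Finset.sum_le_sum fun k _ => ?_)
    rw [Finset.mul_sum]
    refine (norm_sum_le _ _).trans (Finset.sum_le_sum fun j _ => ?_)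
    rw [norm_mul, Complex.norm_real, Real.norm_of_nonneg (hp k j), ← mul_assoc]
    exact mul_le_mul_of_nonneg_right (h1 _ _) (hp k j)
  have b2 : ∑ k, ∑ j, (x' j - x k) ^ 2 * p k j ≤
      ∑ k, x k ^ 2 + ∑ k, x' k ^ 2 - 2 * ∑ k, ∑ j, x k * x' j * p k j := by
    have c1 : ∑ k, ∑ j, x k ^ 2 * p k j ≤ ∑ k, x k ^ 2 := Finset.sum_le_sum fun k _ => by
      rw [← Finset.mul_sum]
      exact mul_le_of_le_one_right (sq_nonneg _) (hrow k)
    have c2 : ∑ k, ∑ j, x' j ^ 2 * p k j ≤ ∑ k, x' k ^ 2 := by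
      rw [Finset.sum_comm]
      refine Finset.sum_le_sum fun k _ => ?_
      rw [← Finset.mul_sum]
      exact mul_le_of_le_one_right (sq_nonneg _) (hcol k)
    have c3 : ∑ k, ∑ j, (x' j - x k) ^ 2 * p k j = ∑ k, ∑ j, x k ^ 2 * p k j +
        ∑ k, ∑ j, x' j ^ 2 * p k j - 2 * ∑ k, ∑ j, x k * x' j * p k j := by
      simp only [Finset.mul_sum, ← Finset.sum_add_distrib, ← Finset.sum_sub_distrib]
      exact Finset.sum_congr rfl fun k _ => Finset.sum_congr rfl fun j _ => by ring
    linarith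
  have sb : ∑ k, b k = ∑ _k : A, (1 : ℝ) ^ 2 - ∑ k, ∑ j, 1 * 1 * p k j := by
    simp [hb]
  have sa : ∑ k, a k = ∑ _k : A, (1 : ℝ) ^ 2 - ∑ k, ∑ j, 1 * 1 * p k j := by
    simp only [ha, Finset.sum_sub_distrib, one_pow, one_mul]
    rw [Finset.sum_comm]
  rw [e1]
  have t1 := bnd (fun k => g (x k) * f (x k)) b hb0 fun k => h2 _
  have t2 := bnd (fun k => Θ (x' k)) a ha0 fun k => h3 _
  have t3 := bnd (fun k => Θ (x k)) b hb0 fun k => h3 _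
  have t4 := mul_le_mul_of_nonneg_left b2 hC
  have t5 : 0 ≤ C * ∑ k, b k := mul_nonneg hC (Finset.sum_nonneg fun k _ => hb0 k)
  -- The row defects enter twice and the column defects once. All three sums are equal, so they cost
  -- `3C` times the common defect, where the stated bound allows `4C`.
  refine (norm_add_le _ _).trans ?_
  refine (add_le_add ((norm_sub_le _ _).trans (add_le_add (norm_sub_le _ _) le_rfl)) le_rfl).trans ?_
  rw [sb] at t1 t3 t5
  rw [sa] at t2
  linarith

end PointwiseTrace

/-! ### Pointwise trace estimates for sums over branches -/

section Pointwise

variable {K : Type*} [NormedAddCommGroup K] [InnerProductSpace ℂ K]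
  {ι : Type*} (e : HilbertBasis ι ℂ K) {A : Type*} [Fintype A]

theorem sum_subtype_of_zero {M : Type*} [AddCommMonoid M] (p : A → Prop) [DecidablePred p]
    {F : A → M} (h : ∀ k, ¬p k → F k = 0) : ∑ k : {k // p k}, F k = ∑ k, F k := by
  rw [← Finset.sum_subtype (Finset.univ.filter p) (by simp) F]
  exact Finset.sum_subset (Finset.subset_univ _) fun k _ hk => h k (by simpa using hk)

theorem sumProj_subtype (p : A → Prop) [DecidablePred p] (v : A → K) {a : A → ℂ}
    (h : ∀ k, ¬p k → a k = 0) :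
    sumProj (fun k : {k // p k} => v k) (fun k => a k) = sumProj v a :=
  sum_subtype_of_zero p (F := fun k => a k • InnerProductSpace.rankOne ℂ (v k) (v k))
    fun k hk => by simp [h k hk]

/-- Among `J + 1` disjoint annuli, one avoids `J` given points. -/
theorem exists_free_annulus {J : ℕ} (x : Fin J → ℝ) {r δ : ℝ} (hδ : 0 < δ) :
    ∃ i : Fin (J + 1), ∀ k, x k ≤ r + i * δ ∨ r + (i + 1) * δ ≤ x k := by
  by_contra! h
  choose k h1 h2 using h
  have hinj : Function.Injective k := by
    intro i j hij
    by_contra hne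
    wlog hlt : i < j generalizing i j
    · exact this hij.symm (Ne.symm hne) (lt_of_le_of_ne (not_lt.1 hlt) (Ne.symm hne))
    have h3 := h2 i
    have h4 := h1 j
    rw [hij] at h3
    have h5 : ((i : ℕ) : ℝ) + 1 ≤ (j : ℕ) := by exact_mod_cast hlt
    nlinarith
  simpa using Fintype.card_le_of_injective k hinj

/-- The levels are separated by a gap containing no `x k`. The cutoff `X i` changes value inside
this gap, so its symbols are projections onto the cluster at both points, while `X i` and `y X i`
measure the displacement of the eigenspaces and of the levels. Off the cluster `f` and `g` vanish
and `Θ` does not change. Summing over all `i` avoids any dependence on which gap is free. -/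
theorem enorm_hsInner_sub_le {J : ℕ} {v v' : Fin J → K} (hv : ∀ k, ‖v k‖ = 1)
    (hv' : ∀ k, ‖v' k‖ = 1) {x x' : Fin J → ℝ} {μ r δ : ℝ} (hδ : 0 < δ)
    (hx : ∀ k, |x' k - x k| < δ) {X : Fin (J + 1) → ℝ → ℝ}
    (hX1 : ∀ (i : Fin (J + 1)) y, |y - μ| ≤ r + i * (3 * δ) + δ → X i y = 1)
    (hX0 : ∀ (i : Fin (J + 1)) y, r + i * (3 * δ) + 2 * δ ≤ |y - μ| → X i y = 0)
    (hi : ∀ i, sumProj v (fun k => (X i (x k) : ℂ)) ∘L sumProj v (fun k => (X i (x k) : ℂ)) =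
      sumProj v fun k => ((X i (x k) * X i (x k) : ℝ) : ℂ))
    (hi' : ∀ i, sumProj v' (fun k => (X i (x' k) : ℂ)) ∘L sumProj v' (fun k => (X i (x' k) : ℂ)) =
      sumProj v' fun k => ((X i (x' k) * X i (x' k) : ℝ) : ℂ))
    {f g Θ : ℝ → ℂ} (hf : ∀ y, r < |y - μ| → f y = 0) (hg : ∀ y, r < |y - μ| → g y = 0)
    (hΘ : ∀ y z, μ + r < y → μ + r < z → Θ y = Θ z)
    (hΘ' : ∀ y z, y < μ - r → z < μ - r → Θ y = Θ z) {C : ℝ} (hC : 0 ≤ C)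
    (h1 : ∀ x y, ‖g y * f x - g y * f y - (Θ x - Θ y)‖ ≤ C * (x - y) ^ 2)
    (h2 : ∀ x, ‖g x * f x‖ ≤ C) (h3 : ∀ x, ‖Θ x‖ ≤ C) :
    ‖hsInner e (sumProj v fun k => starRingEnd ℂ (g (x k))) (sumProj v' fun k => f (x' k)) -
        ∑ k, g (x k) * f (x k) - ∑ k, (Θ (x' k) - Θ (x k))‖ₑ ≤
      ENNReal.ofReal (2 * C) * ∑ i,
        (hsSq e (sumProj v' (fun k => (X i (x' k) : ℂ)) - sumProj v fun k => (X i (x k) : ℂ)) +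
        hsSq e (sumProj v' (fun k => ((x' k * X i (x' k) : ℝ) : ℂ)) -
          sumProj v fun k => ((x k * X i (x k) : ℝ) : ℂ))) := by
  classical
  -- The free annulus has width `3δ`: one `δ` on each side absorbs the displacement from `x` to
  -- `x'`, and the middle third is left for the cutoff to fall from `1` to `0`.
  obtain ⟨i, hfree⟩ := exists_free_annulus (fun k => |x k - μ|) (r := r) (δ := 3 * δ) (by linarith)
  have hiδ : 0 ≤ (i : ℝ) * (3 * δ) := by positivity
  set p : Fin J → Prop := fun k => |x k - μ| ≤ r + i * (3 * δ) with hp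
  have tri : ∀ k, |x' k - μ| ≤ |x k - μ| + |x' k - x k| := fun k => by
    have := abs_add_le (x k - μ) (x' k - x k)
    rwa [show x k - μ + (x' k - x k) = x' k - μ by ring] at this
  have tri' : ∀ k, |x k - μ| ≤ |x' k - μ| + |x' k - x k| := fun k => by
    have := abs_add_le (x' k - μ) (x k - x' k)
    rwa [show x' k - μ + (x k - x' k) = x k - μ by ring, abs_sub_comm (x k) (x' k)] at this
  have pin : ∀ k, p k → X i (x k) = 1 ∧ X i (x' k) = 1 := fun k hk =>
    ⟨hX1 i _ (by linarith [show |x k - μ| ≤ r + i * (3 * δ) from hk]),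
      hX1 i _ (by linarith [show |x k - μ| ≤ r + i * (3 * δ) from hk, tri k, hx k])⟩
  have pfar : ∀ k, ¬p k → r + i * (3 * δ) + 3 * δ ≤ |x k - μ| := fun k hk => by
    have := (hfree k).resolve_left hk
    linarith
  have pfar' : ∀ k, ¬p k → r + i * (3 * δ) + 2 * δ ≤ |x' k - μ| := fun k hk => by
    linarith [pfar k hk, tri' k, hx k]
  have pout : ∀ k, ¬p k → X i (x k) = 0 ∧ X i (x' k) = 0 := fun k hk =>
    ⟨hX0 i _ (by linarith [pfar k hk]), hX0 i _ (pfar' k hk)⟩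
  have fout : ∀ k, ¬p k → g (x k) = 0 ∧ f (x' k) = 0 ∧ f (x k) = 0 := fun k hk =>
    ⟨hg _ (by linarith [pfar k hk]), hf _ (by linarith [pfar' k hk]),
      hf _ (by linarith [pfar k hk])⟩
  have Θout : ∀ k, ¬p k → Θ (x' k) - Θ (x k) = 0 := fun k hk => by
    have h4 := abs_lt.1 (hx k)
    have h5 := pfar k hk
    rw [sub_eq_zero]
    rcases le_total 0 (x k - μ) with h6 | h6
    · rw [abs_of_nonneg h6] at h5
      exact hΘ _ _ (by linarith) (by linarith)
    · rw [abs_of_nonpos h6] at h5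
      exact hΘ' _ _ (by linarith) (by linarith)
  set u : {k // p k} → K := fun k => v k with hu
  set u' : {k // p k} → K := fun k => v' k with hu'
  -- On the cluster `X i = 1` and off it `X i = 0`, so multiplicativity of the symbol for `X i` says
  -- that the sum of the cluster's rank-one projectors is idempotent.
  have on : Orthonormal ℂ u := by
    refine sumProj_comp_self_orthonormal u (fun k => hv k) ?_
    have e1 : sumProj u 1 = sumProj v fun k => (X i (x k) : ℂ) := by
      rw [← sumProj_subtype p v fun k hk => by rw [(pout k hk).1, Complex.ofReal_zero]]
      congr 1
      ext k
      simp [(pin k k.2).1]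
    have e2 : sumProj u 1 = sumProj v fun k => ((X i (x k) * X i (x k) : ℝ) : ℂ) := by
      rw [← sumProj_subtype p v fun k hk => by rw [(pout k hk).1, zero_mul, Complex.ofReal_zero]]
      congr 1
      ext k
      simp [(pin k k.2).1]
    conv_rhs => rw [e2]
    rw [e1, hi]
  have on' : Orthonormal ℂ u' := by
    refine sumProj_comp_self_orthonormal u' (fun k => hv' k) ?_
    have e1 : sumProj u' 1 = sumProj v' fun k => (X i (x' k) : ℂ) := by
      rw [← sumProj_subtype p v' fun k hk => by rw [(pout k hk).2, Complex.ofReal_zero]]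
      congr 1
      ext k
      simp [(pin k k.2).2]
    have e2 : sumProj u' 1 = sumProj v' fun k => ((X i (x' k) * X i (x' k) : ℝ) : ℂ) := by
      rw [← sumProj_subtype p v' fun k hk => by rw [(pout k hk).2, zero_mul, Complex.ofReal_zero]]
      congr 1
      ext k
      simp [(pin k k.2).2]
    conv_rhs => rw [e2]
    rw [e1, hi']
  have key := norm_coupling_sub_le (A := {k // p k}) (p := fun k j => ‖⟪u k, u' j⟫_ℂ‖ ^ 2)
    (fun _ _ => by positivity)
    (fun k => by
      have := on'.sum_norm_inner_sq_le (u k)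
      simp_rw [norm_inner_symm (u' _)] at this
      simpa [on.norm_eq_one] using this)
    (fun j => by simpa [on'.norm_eq_one] using on.sum_norm_inner_sq_le (u' j))
    hC h1 h2 h3 (fun k => x k) (fun k => x' k)
  have s1 : hsInner e (sumProj v fun k => starRingEnd ℂ (g (x k))) (sumProj v' fun k => f (x' k)) =
      ∑ k : {k // p k}, ∑ j : {k // p k}, g (x k) * f (x' j) * ((‖⟪u k, u' j⟫_ℂ‖ ^ 2 : ℝ) : ℂ) := by
    rw [← sumProj_subtype p v fun k hk => by rw [(fout k hk).1, map_zero],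
      ← sumProj_subtype p v' fun k hk => (fout k hk).2.1, hsInner_sumProj]
    simp
    rfl
  have s2 := sum_subtype_of_zero p (F := fun k => g (x k) * f (x k)) fun k hk => by
    simp [(fout k hk).1]
  have s3 := sum_subtype_of_zero p (F := fun k => Θ (x' k) - Θ (x k)) Θout
  rw [← s1, s2, s3] at key
  have q1 : hsSq e (sumProj v' (fun k => (X i (x' k) : ℂ)) - sumProj v fun k => (X i (x k) : ℂ)) =
      ENNReal.ofReal (∑ _k : {k // p k}, (1 : ℝ) ^ 2 + ∑ _k : {k // p k}, (1 : ℝ) ^ 2 -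
        2 * ∑ k, ∑ j, 1 * 1 * ‖⟪u k, u' j⟫_ℂ‖ ^ 2) := by
    rw [← hsSq_sumProj_sub e on on' (fun _ => 1) fun _ => 1,
      ← sumProj_subtype p v fun k hk => by rw [(pout k hk).1, Complex.ofReal_zero],
      ← sumProj_subtype p v' fun k hk => by rw [(pout k hk).2, Complex.ofReal_zero]]
    congr 3
    · ext k
      rw [(pin k k.2).2]
    · ext k
      rw [(pin k k.2).1]
  have q2 : hsSq e (sumProj v' (fun k => ((x' k * X i (x' k) : ℝ) : ℂ)) -
          sumProj v fun k => ((x k * X i (x k) : ℝ) : ℂ)) =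
      ENNReal.ofReal (∑ k : {k // p k}, x k ^ 2 + ∑ k : {k // p k}, x' k ^ 2 -
        2 * ∑ k : {k // p k}, ∑ j : {k // p k}, x k * x' j * ‖⟪u k, u' j⟫_ℂ‖ ^ 2) := by
    rw [← hsSq_sumProj_sub e on on' (fun k => x k) fun k => x' k,
      ← sumProj_subtype p v fun k hk => by rw [(pout k hk).1, mul_zero, Complex.ofReal_zero],
      ← sumProj_subtype p v' fun k hk => by rw [(pout k hk).2, mul_zero, Complex.ofReal_zero]]
    congr 3
    · ext k
      rw [(pin k k.2).2, mul_one]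
    · ext k
      rw [(pin k k.2).1, mul_one]
  refine le_trans ?_ (mul_le_mul_right (Finset.single_le_sum (fun _ _ => zero_le)
    (Finset.mem_univ i)) _)
  rw [q1, q2, mul_add, ← ENNReal.ofReal_mul (by positivity), ← ENNReal.ofReal_mul (by positivity),
    ← ofReal_norm]
  refine (ENNReal.ofReal_le_ofReal key).trans ?_
  rw [add_comm]
  refine ENNReal.ofReal_add_le.trans (add_le_add le_rfl ?_)
  rw [mul_comm 2 C, mul_assoc, ENNReal.ofReal_mul hC, ENNReal.ofReal_mul hC]
  refine mul_le_mul_right ?_ _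
  set S := ∑ k : {k // p k}, x k ^ 2 + ∑ k : {k // p k}, x' k ^ 2 -
        2 * ∑ k : {k // p k}, ∑ j : {k // p k}, x k * x' j * ‖⟪u k, u' j⟫_ℂ‖ ^ 2
  rcases le_total 0 S with hS | hS
  · exact ENNReal.ofReal_le_ofReal (by linarith)
  · rw [ENNReal.ofReal_of_nonpos hS]
    exact zero_le

end Pointwise

/-! ### Transported test functions -/

section Transport

/-- The primitive `∫_μ^x f' g`. -/
noncomputable def transport (f g : ℝ → ℂ) (μ x : ℝ) : ℂ := ∫ s in μ..x, deriv f s * g s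

theorem IsTest.continuous_deriv_mul {α β : ℝ} {f g : ℝ → ℂ} (hf : IsTest α β f)
    (hg : IsTest α β g) : Continuous fun s => deriv f s * g s :=
  (hf.smooth.continuous_deriv (by simp)).mul hg.smooth.continuous

theorem IsTest.transport_sub {α β : ℝ} {f g : ℝ → ℂ} (hf : IsTest α β f) (hg : IsTest α β g)
    (μ x y : ℝ) : transport f g μ x - transport f g μ y = ∫ s in y..x, deriv f s * g s :=
  intervalIntegral.integral_interval_sub_left
    ((hf.continuous_deriv_mul hg).intervalIntegrable _ _)
    ((hf.continuous_deriv_mul hg).intervalIntegrable _ _)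

theorem IsTest.continuous_transport {α β : ℝ} {f g : ℝ → ℂ} (hf : IsTest α β f)
    (hg : IsTest α β g) (μ : ℝ) : Continuous (transport f g μ) :=
  intervalIntegral.continuous_primitive
    (fun a b => (hf.continuous_deriv_mul hg).intervalIntegrable a b) μ

theorem IsTest.exists_bound {α β : ℝ} {f : ℝ → ℂ} (hf : IsTest α β f) :
    ∃ C, 0 ≤ C ∧ ∀ x, ‖f x‖ ≤ C := by
  obtain ⟨C, hC⟩ := hf.compact.exists_bound_of_continuous hf.smooth.continuous
  exact ⟨C, (norm_nonneg _).trans (hC 0), hC⟩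

theorem IsTest.exists_bound_deriv {α β : ℝ} {f : ℝ → ℂ} (hf : IsTest α β f) :
    ∃ C, 0 ≤ C ∧ ∀ x, ‖deriv f x‖ ≤ C := by
  obtain ⟨C, hC⟩ := hf.compact.deriv.exists_bound_of_continuous
    (hf.smooth.continuous_deriv (by simp))
  exact ⟨C, (norm_nonneg _).trans (hC 0), hC⟩

/-- Freezing `g` at `y` leaves the error `∫ f'(s) (g(y) - g(s)) ds`, which is of second order in `x
- y`. One constant is made large enough for all three bounds. -/
theorem IsTest.exists_transport_bound {α β : ℝ} {f g : ℝ → ℂ} (hf : IsTest α β f)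
    (hg : IsTest α β g) (μ : ℝ) : ∃ C, 0 ≤ C ∧
      (∀ x y, ‖g y * f x - g y * f y - (transport f g μ x - transport f g μ y)‖ ≤
        C * (x - y) ^ 2) ∧ (∀ x, ‖g x * f x‖ ≤ C) ∧ ∀ x, ‖transport f g μ x‖ ≤ C := by
  obtain ⟨C₁, h₁, hC₁⟩ := hf.exists_bound
  obtain ⟨C₂, h₂, hC₂⟩ := hg.exists_bound
  obtain ⟨D₁, k₁, hD₁⟩ := hf.exists_bound_deriv
  obtain ⟨D₂, k₂, hD₂⟩ := hg.exists_bound_deriv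
  have hcont := hf.continuous_deriv_mul hg
  have hint : Integrable fun s => deriv f s * g s :=
    hcont.integrable_of_hasCompactSupport hg.compact.mul_left
  set I := ∫ s, ‖deriv f s * g s‖
  have hI : 0 ≤ I := integral_nonneg fun _ => norm_nonneg _
  have hdf : Differentiable ℝ f := hf.smooth.differentiable (by simp)
  have hdg : Differentiable ℝ g := hg.smooth.differentiable (by simp)
  refine ⟨D₁ * D₂ + C₂ * C₁ + I, by positivity, fun x y => ?_, fun x => ?_, fun x => ?_⟩
  · have hf' : ∫ s in y..x, deriv f s = f x - f y :=
      intervalIntegral.integral_deriv_eq_sub (fun s _ => hdf s)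
        ((hf.smooth.continuous_deriv (by simp)).intervalIntegrable _ _)
    have e1 : g y * f x - g y * f y - (transport f g μ x - transport f g μ y) =
        ∫ s in y..x, deriv f s * (g y - g s) := by
      rw [hf.transport_sub hg, ← mul_sub, ← hf', ← intervalIntegral.integral_const_mul,
        ← intervalIntegral.integral_sub]
      · refine intervalIntegral.integral_congr fun s _ => ?_
        ring
      · exact (continuous_const.mul
          (hf.smooth.continuous_deriv (by simp))).intervalIntegrable _ _
      · exact hcont.intervalIntegrable _ _
    rw [e1]
    have hb : ∀ s ∈ Set.uIoc y x, ‖deriv f s * (g y - g s)‖ ≤ D₁ * (D₂ * |x - y|) := by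
      intro s hs
      rw [norm_mul]
      refine mul_le_mul (hD₁ s) ?_ (norm_nonneg _) k₁
      refine (Convex.norm_image_sub_le_of_norm_deriv_le (fun z _ => hdg z) (fun z _ => hD₂ z)
        convex_univ (Set.mem_univ s) (Set.mem_univ y)).trans ?_
      refine mul_le_mul_of_nonneg_left ?_ k₂
      rw [Real.norm_eq_abs, abs_sub_comm]
      exact Set.abs_sub_left_of_mem_uIcc (Set.uIoc_subset_uIcc hs)
    refine (intervalIntegral.norm_integral_le_of_norm_le_const hb).trans ?_
    calc D₁ * (D₂ * |x - y|) * |x - y| = D₁ * D₂ * (x - y) ^ 2 := by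
          rw [← sq_abs (x - y)]
          ring
      _ ≤ _ := by
          refine mul_le_mul_of_nonneg_right ?_ (sq_nonneg _)
          have := mul_nonneg h₂ h₁
          linarith
  · rw [norm_mul]
    have := mul_le_mul (hC₂ x) (hC₁ x) (norm_nonneg _) h₂
    nlinarith [mul_nonneg k₁ k₂]
  · refine (intervalIntegral.norm_integral_le_integral_norm_uIoc).trans ?_
    have := setIntegral_le_integral (s := Set.uIoc μ x) hint.norm
      (Eventually.of_forall fun _ => norm_nonneg _)
    nlinarith [mul_nonneg k₁ k₂, mul_nonneg h₂ h₁]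

theorem transport_eq_of_zero {α β : ℝ} {f g : ℝ → ℂ} (hf : IsTest α β f) (hg : IsTest α β g)
    (μ : ℝ) {x y : ℝ} (h : ∀ s ∈ Set.uIcc y x, g s = 0) :
    transport f g μ x = transport f g μ y := by
  rw [← sub_eq_zero, hf.transport_sub hg]
  refine (intervalIntegral.integral_congr fun s hs => ?_).trans intervalIntegral.integral_zero
  rw [h s hs, mul_zero]

theorem IsTest.exists_radius {α β : ℝ} (hαβ : α < β) {f : ℝ → ℂ} (hf : IsTest α β f) :
    ∃ r, 0 < r ∧ r < (β - α) / 2 ∧ ∀ y, r < |y - (α + β) / 2| → f y = 0 := by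
  have h1 : tsupport f ⊆ Metric.ball ((α + β) / 2) ((β - α) / 2) := by
    rw [Real.ball_eq_Ioo]
    convert hf.support using 2 <;> ring
  obtain ⟨r, hr, h2⟩ := exists_pos_lt_subset_ball (by linarith) (isClosed_tsupport f) h1
  refine ⟨r, hr.1, hr.2, fun y hy => ?_⟩
  by_contra h3
  have := h2 (subset_tsupport f h3)
  rw [Metric.mem_ball, Real.dist_eq] at this
  linarith

theorem uniformContinuous_of_const_ends {ε : ℝ → ℝ} (hε : Continuous ε) {c d a b : ℝ}
    (hl : ∀ w, w ≤ c → ε w = a) (hr : ∀ w, d < w → ε w = b) : UniformContinuous ε := by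
  have hcd : c ≤ max c (d + 1) := le_max_left _ _
  have e1 : ε = fun w => ε (Set.projIcc c (max c (d + 1)) hcd w) := by
    ext w
    rcases le_or_gt w c with h | h
    · rw [Set.projIcc_of_le_left _ h, hl w h, hl c le_rfl]
    · rcases le_or_gt (max c (d + 1)) w with h' | h'
      · rw [Set.projIcc_of_right_le _ h', hr w (by linarith [le_max_right c (d + 1)]),
          hr _ (by linarith [le_max_right c (d + 1)])]
      · rw [Set.projIcc_of_mem _ ⟨h.le, h'.le⟩]
  rw [e1]
  exact (CompactSpace.uniformContinuous_of_continuous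
    (f := fun z : Set.Icc c (max c (d + 1)) => ε z) (hε.comp continuous_subtype_val)).comp (LipschitzWith.projIcc hcd).uniformContinuous

end Transport

/-! ### The trace density is a spectral flow -/

section SpectralFlowDerivative

variable {K : Type*} [NormedAddCommGroup K] [InnerProductSpace ℂ K]

/-- The symbol `∑ f(εₖ(w)) |vₖ(w)⟩⟨vₖ(w)|`. -/
noncomputable def sym {J : ℕ} (v : Fin J → ℝ → K) (ε : Fin J → ℝ → ℝ) (f : ℝ → ℂ) (w : ℝ) :
    K →L[ℂ] K :=
  sumProj (fun k => v k w) fun k => f (ε k w)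

variable [CompleteSpace K] {ι : Type*} {e : HilbertBasis ι ℂ K} [Countable ι]

theorem aemeasurable_hsSq {m : ℝ → K →L[ℂ] K} (h : ∀ v, BddSupp fun w => m w v) :
    AEMeasurable (fun w => hsSq e (m w)) volume :=
  AEMeasurable.tsum fun n => (h (e n)).meas.enorm.pow_const 2

theorem IsMult.integrable_hsInner {A G : L2 K →L[ℂ] L2 K} {m m' mg mg' : ℝ → K →L[ℂ] K}
    (h : IsMult e A m m') (hg : IsMult e G mg mg') (η : ℝ) :
    Integrable fun w => hsInner e (mg' w) (m (w + η)) := by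
  have hc : ∀ n, BddSupp fun w => m (w + η) (e n) := fun n => (h.col (e n)).comp_add η
  refine ⟨?_, ?_⟩
  · refine AEMeasurable.aestronglyMeasurable (AEMeasurable.tsum fun n => ?_)
    exact ((hg.col' (e n)).meas.inner (hc n).meas).aemeasurable
  · refine lt_of_le_of_lt (lintegral_mono fun w =>
      (enorm_tsum_le _).trans (tsum_enorm_inner_le _ _)) ?_
    rw [lintegral_add_left' (AEMeasurable.tsum fun n => (hg.col' (e n)).meas.enorm.pow_const 2)]
    exact ENNReal.add_lt_top.2 ⟨hg.lintegral_hsSq_ne_top'.lt_top,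
      ((lintegral_hsSq_comp_add (e := e) m η).trans_lt h.lintegral_hsSq_ne_top.lt_top)⟩

/-- Integrating the pointwise estimate leaves an error `o(η)` by `hω`. The increments of `Θ`
integrate to an exact multiple of `η`, because each level is constant near both ends of the line. No
continuity of `v` is used. -/
theorem hasDerivAt_integral_hsInner_sym {α β : ℝ} (hαβ : α < β) {J : ℕ} {v : Fin J → ℝ → K}
    (hv : ∀ k w, ‖v k w‖ = 1) {ε : Fin J → ℝ → ℝ} (hε : ∀ k, Continuous (ε k))
    {c d : ℝ} {a b : Fin J → ℝ} (hl : ∀ k w, w ≤ c → ε k w = a k)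
    (hr : ∀ k w, d < w → ε k w = b k)
    {op : (ℝ → ℂ) → L2 K →L[ℂ] L2 K}
    (hmult : ∀ f, IsTest α β f →
      IsMult e (op f) (sym v ε f) (sym v ε fun t => starRingEnd ℂ (f t)))
    (hmul : ∀ f, IsTest α β f → ∀ᵐ w, sym v ε f w ∘L sym v ε f w = sym v ε (fun t => f t * f t) w)
    (hω : ∀ f, IsTest α β f → Tendsto (fun η => ‖η‖ₑ⁻¹ * ∫⁻ w,
      hsSq e (sym v ε f (w + η) - sym v ε f w)) (𝓝[≠] 0) (𝓝 0))
    {f g : ℝ → ℂ} (hf : IsTest α β f) (hg : IsTest α β g) :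
    HasDerivAt (fun η => ∫ w, hsInner e (sym v ε (fun t => starRingEnd ℂ (g t)) w)
      (sym v ε f (w + η))) (∑ k, ∫ s in a k..b k, deriv f s * g s) 0 := by
  set μ := (α + β) / 2 with hμ
  set ℓ := (β - α) / 2 with hℓ
  obtain ⟨r₁, hr₁, hr₁', hf0⟩ := hf.exists_radius hαβ
  obtain ⟨r₂, hr₂, hr₂', hg0⟩ := hg.exists_radius hαβ
  set r := max r₁ r₂ with hrdef
  have hr0 : 0 < r := hr₁.trans_le (le_max_left _ _)
  have hrℓ : r < ℓ := max_lt hr₁' hr₂'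
  have hf1 : ∀ y, r < |y - μ| → f y = 0 := fun y hy => hf0 y ((le_max_left _ _).trans_lt hy)
  have hg1 : ∀ y, r < |y - μ| → g y = 0 := fun y hy => hg0 y ((le_max_right _ _).trans_lt hy)
  -- The shell between the supports of `f`, `g` and the ends of `(α, β)` is divided into `J + 1`
  -- annuli of width `3δ`, one more than the number of levels.
  set δ := (ℓ - r) / (3 * (J + 1)) with hδdef
  have hδ : 0 < δ := div_pos (by linarith) (by positivity)
  have hδJ : r + (J + 1) * (3 * δ) = ℓ := by
    rw [hδdef]
    field_simp
    ring
  -- smooth cutoffs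
  have hXr : ∀ i : Fin (J + 1), 0 ≤ ((i : ℕ) : ℝ) * (3 * δ) ∧
      r + ((i : ℕ) : ℝ) * (3 * δ) + 3 * δ ≤ ℓ := fun i => by
    have : ((i : ℕ) : ℝ) ≤ J := by exact_mod_cast Nat.lt_succ_iff.1 i.2
    refine ⟨by positivity, ?_⟩
    nlinarith
  let X : Fin (J + 1) → ContDiffBump μ := fun i =>
    ⟨r + ((i : ℕ) : ℝ) * (3 * δ) + δ, r + ((i : ℕ) : ℝ) * (3 * δ) + 2 * δ,
      by linarith [(hXr i).1], by linarith⟩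
  have hXs : ∀ i, tsupport (X i) ⊆ Set.Ioo α β := fun i => by
    rw [(X i).tsupport_eq, Real.closedBall_eq_Icc]
    have h1 : (X i).rOut < ℓ := by
      change r + ((i : ℕ) : ℝ) * (3 * δ) + 2 * δ < ℓ
      linarith [(hXr i).2]
    refine Set.Icc_subset_Ioo ?_ ?_ <;> simp only [hμ, hℓ] at * <;> linarith
  have tX : ∀ i, IsTest α β fun y => ((X i y : ℝ) : ℂ) := fun i =>
    ⟨Complex.ofRealCLM.contDiff.comp (X i).contDiff,
      (X i).hasCompactSupport.comp_left (g := Complex.ofReal) Complex.ofReal_zero,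
      (tsupport_comp_subset Complex.ofReal_zero (X i)).trans (hXs i)⟩
  have tY : ∀ i, IsTest α β fun y => ((y * X i y : ℝ) : ℂ) := fun i =>
    ⟨Complex.ofRealCLM.contDiff.comp (contDiff_id.mul (X i).contDiff),
      ((X i).hasCompactSupport.mul_left).comp_left (g := Complex.ofReal) Complex.ofReal_zero,
      (tsupport_comp_subset Complex.ofReal_zero (fun y => y * X i y)).trans
        ((tsupport_mul_subset_right).trans (hXs i))⟩
  set Θ := transport f g μ with hΘ
  obtain ⟨C, hC, h1, h2, h3⟩ := hf.exists_transport_bound hg μ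
  have hΘr : ∀ y z, μ + r < y → μ + r < z → Θ y = Θ z := fun y z hy hz =>
    transport_eq_of_zero hf hg μ fun s hs => hg1 s (by
      have := (Set.mem_uIcc.1 hs)
      refine lt_of_lt_of_le ?_ (le_abs_self _)
      rcases this with h | h <;> linarith [h.1])
  have hΘl : ∀ y z, y < μ - r → z < μ - r → Θ y = Θ z := fun y z hy hz =>
    transport_eq_of_zero hf hg μ fun s hs => hg1 s (by
      have := (Set.mem_uIcc.1 hs)
      refine lt_of_lt_of_le ?_ (neg_le_abs _)
      rcases this with h | h <;> linarith [h.2])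
  -- the pointwise estimate
  have hmulX : ∀ᵐ w, ∀ i, sym v ε (fun y => ((X i y : ℝ) : ℂ)) w ∘L
      sym v ε (fun y => ((X i y : ℝ) : ℂ)) w = sym v ε (fun y => ((X i y * X i y : ℝ) : ℂ)) w :=
    ae_all_iff.2 fun i => by simpa only [Complex.ofReal_mul] using hmul _ (tX i)
  set Ω : ℝ → ℝ → ℝ≥0∞ := fun η w => ∑ i,
    (hsSq e (sym v ε (fun y => ((X i y : ℝ) : ℂ)) (w + η) - sym v ε (fun y => ((X i y : ℝ) : ℂ)) w) +
      hsSq e (sym v ε (fun y => ((y * X i y : ℝ) : ℂ)) (w + η) -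
        sym v ε (fun y => ((y * X i y : ℝ) : ℂ)) w)) with hΩ
  set Q : ℝ → ℝ → ℂ := fun η w => hsInner e (sym v ε (fun t => starRingEnd ℂ (g t)) w)
    (sym v ε f (w + η)) with hQ
  have hpt : ∀ η : ℝ, (∀ k w, |ε k (w + η) - ε k w| < δ) → ∀ᵐ w,
      ‖Q η w - ∑ k, g (ε k w) * f (ε k w) - ∑ k, (Θ (ε k (w + η)) - Θ (ε k w))‖ₑ ≤
        ENNReal.ofReal (2 * C) * Ω η w := by
    intro η hη
    have hmulX' := (measurePreserving_add_right volume η).quasiMeasurePreserving.ae hmulX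
    filter_upwards [hmulX, hmulX'] with w hw hw'
    refine enorm_hsInner_sub_le e (fun k => hv k w) (fun k => hv k (w + η)) hδ
      (fun k => hη k w) (X := fun i => X i) (μ := μ) (r := r) (fun i y hy => ?_) (fun i y hy => ?_)
      hw hw' hf1 hg1 hΘr hΘl hC h1 h2 h3
    · exact (X i).one_of_mem_closedBall (by simpa [Real.dist_eq] using hy)
    · exact (X i).zero_of_le_dist (by simpa [Real.dist_eq] using hy)
  -- At `η = 0` the error term vanishes identically, so the estimate becomes an equality.
  have hQ0 : ∀ᵐ w, Q 0 w = ∑ k, g (ε k w) * f (ε k w) := by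
    filter_upwards [hpt 0 fun k w => by simpa using hδ] with w hw
    have hΩ0 : Ω 0 w = 0 := by simp [hΩ, hsSq]
    rw [hΩ0, mul_zero, nonpos_iff_eq_zero, enorm_eq_zero] at hw
    simpa [sub_eq_zero] using hw
  have hdiff : ∀ η : ℝ, (∀ k w, |ε k (w + η) - ε k w| < δ) →
      ‖(∫ w, Q η w) - (∫ w, Q 0 w) - η * ∑ k, (Θ (b k) - Θ (a k))‖ₑ ≤
        ENNReal.ofReal (2 * C) * ∫⁻ w, Ω η w := by
    intro η hη
    have hsh : ∀ k, (Integrable fun w => Θ (ε k (w + η)) - Θ (ε k w)) ∧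
        ∫ w, (Θ (ε k (w + η)) - Θ (ε k w)) = η * (Θ (b k) - Θ (a k)) := fun k =>
      integral_shift_sub (F := fun w => Θ (ε k w)) (c := c) (d := d)
        ((hf.continuous_transport hg μ).comp (hε k)).measurable ⟨C, fun w => h3 _⟩
        (fun w hw => by rw [hl k w hw]) (fun w hw => by rw [hr k w hw]) η
    have hi := (hmult f hf).integrable_hsInner (hmult g hg)
    have hi2 : Integrable fun w => Q η w - Q 0 w := (hi η).sub (hi 0)
    have e1 : (∫ w, Q η w) - (∫ w, Q 0 w) - η * ∑ k, (Θ (b k) - Θ (a k)) =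
        ∫ w, (Q η w - Q 0 w - ∑ k, (Θ (ε k (w + η)) - Θ (ε k w))) := by
      rw [integral_sub hi2 (integrable_finsetSum _ fun k _ => (hsh k).1),
        integral_sub (hi η) (hi 0), integral_finsetSum _ fun k _ => (hsh k).1, Finset.mul_sum]
      congr 1
      exact Finset.sum_congr rfl fun k _ => (hsh k).2.symm
    rw [e1]
    refine (enorm_integral_le_lintegral_enorm _).trans ?_
    rw [← lintegral_const_mul' _ _ ENNReal.ofReal_ne_top]
    refine lintegral_mono_ae ?_
    filter_upwards [hpt η hη, hQ0] with w hw hw0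
    rwa [hw0]
  have hΩlim : Tendsto (fun η => ‖η‖ₑ⁻¹ * ∫⁻ w, Ω η w) (𝓝[≠] 0) (𝓝 0) := by
    have hae : ∀ h, IsTest α β h → ∀ η, AEMeasurable (fun w =>
        hsSq e (sym v ε h (w + η) - sym v ε h w)) volume := fun h hh η =>
      aemeasurable_hsSq (m := fun w => sym v ε h (w + η) - sym v ε h w) fun x =>
        (((hmult h hh).col x).comp_add η).sub ((hmult h hh).col x)
    have e1 : (fun η => ‖η‖ₑ⁻¹ * ∫⁻ w, Ω η w) = fun η => ∑ i,
        (‖η‖ₑ⁻¹ * (∫⁻ w, hsSq e (sym v ε (fun y => ((X i y : ℝ) : ℂ)) (w + η) -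
          sym v ε (fun y => ((X i y : ℝ) : ℂ)) w)) +
        ‖η‖ₑ⁻¹ * ∫⁻ w, hsSq e (sym v ε (fun y => ((y * X i y : ℝ) : ℂ)) (w + η) -
          sym v ε (fun y => ((y * X i y : ℝ) : ℂ)) w)) := by
      ext η
      have h4 : ∀ i ∈ (Finset.univ : Finset (Fin (J + 1))), AEMeasurable (fun w =>
          hsSq e (sym v ε (fun y => ((X i y : ℝ) : ℂ)) (w + η) -
            sym v ε (fun y => ((X i y : ℝ) : ℂ)) w) +
          hsSq e (sym v ε (fun y => ((y * X i y : ℝ) : ℂ)) (w + η) -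
            sym v ε (fun y => ((y * X i y : ℝ) : ℂ)) w)) volume :=
        fun i _ => (hae _ (tX i) η).add (hae _ (tY i) η)
      rw [hΩ, lintegral_finsetSum' _ h4, Finset.mul_sum]
      refine Finset.sum_congr rfl fun i _ => ?_
      rw [lintegral_add_left' (hae _ (tX i) η), mul_add]
    rw [e1]
    have := tendsto_finsetSum (Finset.univ : Finset (Fin (J + 1)))
      fun i _ => (hω _ (tX i)).add (hω _ (tY i))
    simpa using this
  have hsmall : ∀ᶠ η in 𝓝 (0 : ℝ), ∀ k w, |ε k (w + η) - ε k w| < δ := by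
    refine eventually_all.2 fun k => ?_
    obtain ⟨η₀, hη₀, h⟩ := Metric.uniformContinuous_iff.1
      (uniformContinuous_of_const_ends (hε k) (hl k) (hr k)) δ hδ
    filter_upwards [Metric.ball_mem_nhds 0 hη₀] with η hη w
    exact h (by simpa [Real.dist_eq] using hη)
  have hc : (∑ k, ∫ s in a k..b k, deriv f s * g s) = ∑ k, (Θ (b k) - Θ (a k)) :=
    Finset.sum_congr rfl fun k _ => (hf.transport_sub hg μ _ _).symm
  rw [hc, hasDerivAt_iff_tendsto_slope_zero, tendsto_iff_edist_tendsto_0]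
  have hlim := ENNReal.Tendsto.const_mul (a := ENNReal.ofReal (2 * C)) hΩlim
    (Or.inr ENNReal.ofReal_ne_top)
  rw [mul_zero] at hlim
  refine tendsto_of_tendsto_of_tendsto_of_le_of_le' tendsto_const_nhds hlim
    (Eventually.of_forall fun _ => zero_le) ?_
  filter_upwards [self_mem_nhdsWithin, mem_nhdsWithin_of_mem_nhds hsmall] with η hη hη'
  have hη0 : (η : ℂ) ≠ 0 := Complex.ofReal_ne_zero.2 hη
  rw [edist_eq_enorm_sub]
  have e2 : η⁻¹ • ((∫ w, Q (0 + η) w) - ∫ w, Q 0 w) - ∑ k, (Θ (b k) - Θ (a k)) =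
      (η : ℂ)⁻¹ * ((∫ w, Q η w) - (∫ w, Q 0 w) - η * ∑ k, (Θ (b k) - Θ (a k))) := by
    rw [zero_add, Complex.real_smul, mul_sub (η : ℂ)⁻¹ (_ - _), inv_mul_cancel_left₀ hη0]
    push_cast
    rfl
  change ‖η⁻¹ • ((∫ w, Q (0 + η) w) - ∫ w, Q 0 w) - ∑ k, (Θ (b k) - Θ (a k))‖ₑ ≤ _
  rw [e2, enorm_mul, enorm_inv hη0, mul_left_comm]
  have e3 : ‖(η : ℂ)‖ₑ = ‖η‖ₑ := by
    rw [← ofReal_norm, Complex.norm_real, ofReal_norm]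
  rw [e3]
  exact mul_le_mul_right (hdiff η hη') _

end SpectralFlowDerivative

/-! ### Operations on test functions -/

section TestFunctions

variable {α β : ℝ} {f g : ℝ → ℂ}

theorem IsTest.eventuallyConst (hf : IsTest α β f) : EventuallyConst f 0 :=
  EventuallyConst.of_hasCompactSupport hf.smooth.continuous hf.compact

theorem IsTest.conj (hf : IsTest α β f) : IsTest α β fun t => starRingEnd ℂ (f t) :=
  ⟨Complex.conjCLE.contDiff.comp hf.smooth,
    hf.compact.comp_left (g := starRingEnd ℂ) (map_zero _),
    (tsupport_comp_subset (g := starRingEnd ℂ) (map_zero _) f).trans hf.support⟩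

theorem IsTest.mul_left (hf : IsTest α β f) (hg : ContDiff ℝ ∞ g) :
    IsTest α β fun t => g t * f t :=
  ⟨hg.mul hf.smooth, hf.compact.mul_left, (tsupport_mul_subset_right).trans hf.support⟩

theorem IsTest.eq_zero (hf : IsTest α β f) {x : ℝ} (hx : x ∉ Set.Ioo α β) : f x = 0 := by
  by_contra h
  exact hx (hf.support (subset_tsupport f h))

theorem IsTest.exists_plateau (hαβ : α < β) (hf : IsTest α β f) :
    ∃ χ : ℝ → ℂ, IsTest α β χ ∧ (∀ x, starRingEnd ℂ (χ x) = χ x) ∧ ∀ x, f x ≠ 0 → χ x = 1 := by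
  obtain ⟨r, hr, hr', h⟩ := hf.exists_radius hαβ
  let X : ContDiffBump ((α + β) / 2) := ⟨r, (r + (β - α) / 2) / 2, hr, by linarith⟩
  have hX : X.rOut < (β - α) / 2 := by
    change (r + (β - α) / 2) / 2 < _
    linarith
  refine ⟨fun y => ((X y : ℝ) : ℂ), ⟨Complex.ofRealCLM.contDiff.comp X.contDiff,
    X.hasCompactSupport.comp_left (g := Complex.ofReal) Complex.ofReal_zero,
    (tsupport_comp_subset Complex.ofReal_zero X).trans ?_⟩, fun x => Complex.conj_ofReal _,
    fun x hx => ?_⟩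
  · rw [X.tsupport_eq, Real.closedBall_eq_Icc]
    exact Set.Icc_subset_Ioo (by linarith) (by linarith)
  · change ((X x : ℝ) : ℂ) = 1
    rw [X.one_of_mem_closedBall, Complex.ofReal_one]
    by_contra h2
    rw [Metric.mem_closedBall, not_le, Real.dist_eq] at h2
    exact hx (h x h2)

theorem IsTest.exists_plateau_mul (hαβ : α < β) (hf : IsTest α β f) :
    ∃ χ : ℝ → ℂ, IsTest α β χ ∧ (∀ x, starRingEnd ℂ (χ x) = χ x) ∧
      (fun x => f x * χ x) = f := by
  obtain ⟨χ, h1, h2, h3⟩ := hf.exists_plateau hαβ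
  refine ⟨χ, h1, h2, funext fun x => ?_⟩
  by_cases hx : f x = 0
  · rw [hx, zero_mul]
  · rw [h3 x hx, mul_one]

end TestFunctions

/-! ### Commutators with a switch -/

section Commutators

variable {K : Type*} [NormedAddCommGroup K] [InnerProductSpace ℂ K] [CompleteSpace K]
  {H : L2 K →ₗ.[ℂ] L2 K} {α β : ℝ} {P : ℝ → ℝ}

/-- Commutators of functions of `H` with a switch function are nuclear. -/
theorem isNuclear_opComm_funCalc (hH : IsSelfAdjoint H) (hαβ : α < β)
    (hPt : MemLp (fun x => (P x : ℂ)) ∞ (volume : Measure ℝ))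
    (htc : ∀ Ψ Φ : ℝ → ℂ, IsTest α β Ψ → IsTest α β Φ →
      IsTraceClass (opComm (funCalc H Ψ) (mulOp K P) ∘L funCalc H Φ))
    {f : ℝ → ℂ} (hf : IsTest α β f) : IsNuclear (opComm (funCalc H f) (mulOp K P)) := by
  obtain ⟨χ, hχ, hχr, hfχ⟩ := hf.exists_plateau_mul hαβ
  obtain ⟨χ₁, hχ₁, -, hχχ₁⟩ := hχ.exists_plateau_mul hαβ
  set F := funCalc H f
  set X := funCalc H χ
  set X₁ := funCalc H χ₁
  set M := mulOp K P
  have e1 : F * X = F := by rw [← funCalc_mul hH hf.eventuallyConst hχ.eventuallyConst, hfχ]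
  have e2 : X * X₁ = X := by rw [← funCalc_mul hH hχ.eventuallyConst hχ₁.eventuallyConst, hχχ₁]
  have e3 : F * X₁ = F := by rw [← e1, mul_assoc, e2]
  have h1 : IsNuclear (opComm F M ∘L X₁) := (htc f χ₁ hf hχ₁).isNuclear
  -- The hypothesis only provides a function of `H` on the right of a commutator; the adjoint moves
  -- it to the left.
  have h2 : IsNuclear (F ∘L opComm X M) := by
    have h3 := (htc χ _ hχ hf.conj).isNuclear.adjoint.neg
    have hXa : ContinuousLinearMap.adjoint X = X := by
      rw [← funCalc_star hχ.eventuallyConst]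
      exact congrArg (funCalc H) (funext hχr)
    have hFa : ContinuousLinearMap.adjoint (funCalc H fun t => starRingEnd ℂ (f t)) = F := by
      rw [← funCalc_star hf.conj.eventuallyConst]
      exact congrArg (funCalc H) (funext fun t => Complex.conj_conj _)
    rw [ContinuousLinearMap.adjoint_comp, adjoint_opComm_mulOp hPt, hXa, hFa] at h3
    convert h3 using 1
    rw [← ContinuousLinearMap.comp_neg, neg_sub]
    rfl
  -- Since `F * (1 - X₁) = 0` and `X * (1 - X₁) = 0`, both `[F, M] (1 - X₁)` and `F [X, M] (1 - X₁)`
  -- reduce to `F M (1 - X₁)`.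
  have e4 : opComm F M = opComm F M ∘L X₁ + (F ∘L opComm X M) ∘L (1 - X₁) := by
    change F * M - M * F = (F * M - M * F) * X₁ + F * (X * M - M * X) * (1 - X₁)
    have : F * (X * M - M * X) * (1 - X₁) = F * X * M * (1 - X₁) - F * M * (X - X * X₁) := by
      noncomm_ring
    rw [this, e1, e2, sub_self, mul_zero, sub_zero, sub_mul, mul_assoc M F X₁, e3]
    noncomm_ring
  rw [e4]
  exact h1.add (h2.comp_right _)

end Commutators

/-! ### Unit eigenvectors of the branches -/

section Branches

variable {K : Type*} [NormedAddCommGroup K] [InnerProductSpace ℂ K]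

theorem exists_eq_rankOne [CompleteSpace K] {p : K →L[ℂ] K} (hp : IsStarProjection p)
    (h1 : Module.finrank ℂ (LinearMap.range (p : K →ₗ[ℂ] K)) = 1) :
    ∃ v : K, ‖v‖ = 1 ∧ p = InnerProductSpace.rankOne ℂ v v := by
  obtain ⟨⟨u, hu⟩, hu0, hspan⟩ := finrank_eq_one_iff'.1 h1
  have hu0' : u ≠ 0 := fun h => hu0 (Subtype.ext h)
  have hidem : ∀ x, p (p x) = p x := fun x => congr($(hp.isIdempotentElem.eq) x)
  have hadj : ∀ x y, ⟪p x, y⟫_ℂ = ⟪x, p y⟫_ℂ := fun x y => by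
    have := hp.isSelfAdjoint
    rw [← ContinuousLinearMap.adjoint_inner_right,
      ContinuousLinearMap.isSelfAdjoint_iff'.1 this]
  have hpu : p u = u := by
    obtain ⟨z, rfl⟩ := hu
    exact hidem z
  have hn : ‖u‖ ≠ 0 := norm_ne_zero_iff.2 hu0'
  refine ⟨((‖u‖ : ℂ)⁻¹) • u, ?_, ?_⟩
  · rw [norm_smul, norm_inv, Complex.norm_real, norm_norm, inv_mul_cancel₀ hn]
  · ext x
    obtain ⟨a, ha⟩ := hspan ⟨p x, x, rfl⟩
    have ha' : a • u = p x := congrArg Subtype.val ha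
    have h2 : a * (‖u‖ : ℂ) ^ 2 = ⟪u, x⟫_ℂ := by
      have h3 : ⟪u, p x⟫_ℂ = ⟪u, x⟫_ℂ := by rw [← hadj, hpu]
      rw [← h3, ← ha', inner_smul_right, inner_self_eq_norm_sq_to_K]
      rfl
    have hn' : (‖u‖ : ℂ) ≠ 0 := Complex.ofReal_ne_zero.2 hn
    rw [InnerProductSpace.rankOne_apply, inner_smul_left, smul_smul, ← h2, ← ha']
    congr 1
    rw [map_inv₀, Complex.conj_ofReal]
    field_simp

theorem ContinuousLinearMap.ext_hilbertBasis {ι E F : Type*} [NormedAddCommGroup E]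
    [InnerProductSpace ℂ E] [NormedAddCommGroup F] [NormedSpace ℂ F] (b : HilbertBasis ι ℂ E)
    {S T : E →L[ℂ] F} (h : ∀ i, S (b i) = T (b i)) : S = T := by
  ext x
  have h1 := (b.hasSum_repr x).mapL S
  have h2 := (b.hasSum_repr x).mapL T
  simp only [map_smul, h] at h1 h2
  exact h1.unique h2

/-- A symbol is determined by the corresponding multiplication operator. -/
theorem ae_eq_of_forall_L2 [CompleteSpace K] {ι : Type*} [Countable ι] (e : HilbertBasis ι ℂ K)
    {m m₂ : ℝ → K →L[ℂ] K} (h : ∀ g : L2 K, ∀ᵐ w, m w (g w) = m₂ w (g w)) :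
    ∀ᵐ w, m w = m₂ w := by
  have hfin : ∀ N : ℕ, volume (Set.Icc (-N : ℝ) N) ≠ ⊤ := fun N => by simp
  have h1 : ∀ᵐ w, ∀ (N : ℕ) n, w ∈ Set.Icc (-N : ℝ) N → m w (e n) = m₂ w (e n) := by
    refine ae_all_iff.2 fun N => ae_all_iff.2 fun n => ?_
    filter_upwards [h (indicatorConstLp 2 measurableSet_Icc (hfin N) (e n)),
      indicatorConstLp_coeFn (p := 2) (hs := measurableSet_Icc) (hμs := hfin N) (c := e n)]
      with w hw hw' hmem
    rwa [hw', Set.indicator_of_mem hmem] at hw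
  filter_upwards [h1] with w hw
  obtain ⟨N, hN⟩ := exists_nat_ge |w|
  exact ContinuousLinearMap.ext_hilbertBasis e fun n => hw N n (Set.mem_Icc.2 (abs_le.1 hN))

theorem quasiMeasurePreserving_mul_left {a : ℝ} (ha : a ≠ 0) :
    Measure.QuasiMeasurePreserving (fun w : ℝ => a * w) volume volume := by
  refine ⟨measurable_const_mul a, ?_⟩
  rw [Real.map_volume_mul_left ha]
  exact Measure.smul_absolutelyContinuous

/-- The level of a branch, as a function of the frequency `w = ξ / 2π`, clamped to `[α, β]`. -/
noncomputable def level (α β : ℝ) (E : ℝ → ℝ) (w : ℝ) : ℝ := max α (min β (E (2 * Real.pi * w)))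

theorem IsTest.apply_level {α β : ℝ} {f : ℝ → ℂ} (hαβ : α < β) (hf : IsTest α β f) (E : ℝ → ℝ)
    (w : ℝ) : f (level α β E w) = f (E (2 * Real.pi * w)) := by
  rw [level]
  rcases le_or_gt (E (2 * Real.pi * w)) α with h | h
  · rw [min_eq_right (h.trans hαβ.le), max_eq_left h, hf.eq_zero (by simp),
      hf.eq_zero fun h' => absurd h'.1 (not_lt.2 h)]
  · rcases le_or_gt β (E (2 * Real.pi * w)) with h' | h'
    · rw [min_eq_left h', max_eq_right hαβ.le, hf.eq_zero (by simp),
        hf.eq_zero fun h'' => absurd h''.2 (not_lt.2 h')]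
    · rw [min_eq_right h'.le, max_eq_right h.le]

/-- A continuous branch crossing `(α, β)` on a bounded set leaves it through one of its ends. -/
theorem eventually_level_atTop {α β : ℝ} (hαβ : α < β) {E : ℝ → ℝ} (hE : Continuous E) {R : ℝ}
    (hR : ∀ ξ, R < ξ → E ξ ∉ Set.Ioo α β) :
    (branchEnd α β E atTop = α ∧ ∀ ξ, R < ξ → E ξ ≤ α) ∨
      (branchEnd α β E atTop = β ∧ ∀ ξ, R < ξ → β ≤ E ξ) := by
  have hcase : (∀ ξ, R < ξ → E ξ ≤ α) ∨ ∀ ξ, R < ξ → β ≤ E ξ := by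
    by_contra! h
    obtain ⟨⟨ξ, hξ, h1⟩, η, hη, h2⟩ := h
    have hpre : (E '' Set.Ioi R).OrdConnected :=
      (isPreconnected_Ioi.image E hE.continuousOn).ordConnected
    have h1' : β ≤ E ξ := by
      by_contra h3
      exact hR ξ hξ ⟨h1, not_le.1 h3⟩
    have h2' : E η ≤ α := by
      by_contra h3
      exact hR η hη ⟨not_le.1 h3, h2⟩
    obtain ⟨ζ, hζ, h4⟩ := hpre.out ⟨η, hη, rfl⟩ ⟨ξ, hξ, rfl⟩
      (show (α + β) / 2 ∈ Set.Icc (E η) (E ξ) from ⟨by linarith, by linarith⟩)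
    exact hR ζ hζ (by rw [h4]; constructor <;> linarith)
  refine hcase.imp (fun h => ⟨?_, h⟩) fun h => ⟨?_, h⟩
  · exact if_pos ((eventually_gt_atTop R).mono h)
  · refine if_neg fun h' => ?_
    obtain ⟨ξ, h1, h2⟩ := (h'.and (eventually_gt_atTop R)).exists
    linarith [h ξ h2]

theorem eventually_level_atBot {α β : ℝ} (hαβ : α < β) {E : ℝ → ℝ} (hE : Continuous E) {R : ℝ}
    (hR : ∀ ξ, ξ < R → E ξ ∉ Set.Ioo α β) :
    (branchEnd α β E atBot = α ∧ ∀ ξ, ξ < R → E ξ ≤ α) ∨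
      (branchEnd α β E atBot = β ∧ ∀ ξ, ξ < R → β ≤ E ξ) := by
  have h1 : branchEnd α β E atBot = branchEnd α β (fun ξ => E (-ξ)) atTop := by
    have : (∀ᶠ ξ in atBot, E ξ ≤ α) ↔ ∀ᶠ ξ in atTop, E (-ξ) ≤ α := by
      rw [← Filter.map_neg_atTop]
      exact Iff.rfl
    by_cases h : ∀ᶠ ξ in atBot, E ξ ≤ α
    · exact (if_pos h).trans (if_pos (this.1 h)).symm
    · exact (if_neg h).trans (if_neg (mt this.2 h)).symm
  rw [h1]
  have h2 := eventually_level_atTop hαβ (E := fun ξ => E (-ξ)) (hE.comp continuous_neg) (R := -R)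
    fun ξ hξ => hR _ (by linarith)
  refine h2.imp (fun h => ⟨h.1, fun ξ hξ => ?_⟩) fun h => ⟨h.1, fun ξ hξ => ?_⟩
  · simpa using h.2 (-ξ) (by linarith)
  · simpa using h.2 (-ξ) (by linarith)

end Branches

/-! ### Symbols built from the branches -/

section BranchSymbols

variable {K : Type*} [NormedAddCommGroup K] [InnerProductSpace ℂ K] [CompleteSpace K]
  {H : L2 K →ₗ.[ℂ] L2 K} {α β : ℝ} {J : ℕ} {E : Fin J → ℝ → ℝ} {Pr : Fin J → ℝ → K →L[ℂ] K}

theorem HasBranches.exists_crossing_bound (hE : HasBranches H α β E Pr) :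
    ∃ R, 0 ≤ R ∧ ∀ k ξ, R < |ξ| → E k ξ ∉ Set.Ioo α β := by
  choose R hR using fun k => (Metric.isBounded_iff_subset_closedBall 0).1 (hE.bounded_crossing k)
  refine ⟨∑ k, |R k|, Finset.sum_nonneg fun k _ => abs_nonneg _, fun k ξ hξ hmem => ?_⟩
  have h1 := hR k hmem
  rw [Metric.mem_closedBall, dist_zero_right, Real.norm_eq_abs] at h1
  have h2 := Finset.single_le_sum (f := fun k => |R k|) (fun k _ => abs_nonneg _)
    (Finset.mem_univ k)
  linarith [le_abs_self (R k)]

theorem continuous_level {e : ℝ → ℝ} (he : Continuous e) : Continuous (level α β e) :=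
  continuous_const.max (continuous_const.min (he.comp (continuous_const.mul continuous_id)))

variable {v : Fin J → ℝ → K}

theorem sym_level_apply (hαβ : α < β)
    (hvP : ∀ k ξ, Pr k ξ = InnerProductSpace.rankOne ℂ (v k ξ) (v k ξ)) {f : ℝ → ℂ}
    (hf : IsTest α β f) (w : ℝ) (x : K) :
    sym (fun k w => v k (2 * Real.pi * w)) (fun k => level α β (E k)) f w x =
      ∑ k, f (E k (2 * Real.pi * w)) • Pr k (2 * Real.pi * w) x := by
  rw [sym, sumProj_apply]
  refine Finset.sum_congr rfl fun k _ => ?_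
  rw [hf.apply_level hαβ, hvP, InnerProductSpace.rankOne_apply, mul_smul]

theorem sym_level_eq_zero (hαβ : α < β) {R : ℝ}
    (hR : ∀ k ξ, R < |ξ| → E k ξ ∉ Set.Ioo α β) {f : ℝ → ℂ}
    (hf : IsTest α β f) {w : ℝ} (hw : R / (2 * Real.pi) < |w|) :
    sym (fun k w => v k (2 * Real.pi * w)) (fun k => level α β (E k)) f w = 0 := by
  have h1 : R < |2 * Real.pi * w| := by
    rw [abs_mul, abs_of_pos Real.two_pi_pos]
    rwa [div_lt_iff₀' Real.two_pi_pos] at hw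
  rw [sym, sumProj]
  refine Finset.sum_eq_zero fun k _ => ?_
  rw [hf.apply_level hαβ, hf.eq_zero (hR k _ h1), zero_smul]

theorem HasBranches.bddSupp_sym (hE : HasBranches H α β E Pr) (hαβ : α < β)
    (hv : ∀ k ξ, ‖v k ξ‖ = 1)
    (hvP : ∀ k ξ, Pr k ξ = InnerProductSpace.rankOne ℂ (v k ξ) (v k ξ)) {f : ℝ → ℂ}
    (hf : IsTest α β f) (x : K) :
    BddSupp fun w => sym (fun k w => v k (2 * Real.pi * w)) (fun k => level α β (E k)) f w x := by
  obtain ⟨R, -, hR⟩ := hE.exists_crossing_bound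
  obtain ⟨C, hC, hfC⟩ := hf.exists_bound
  refine ⟨?_, ⟨∑ _k : Fin J, C * ‖x‖, fun w => ?_⟩, ⟨R / (2 * Real.pi), fun w hw => ?_⟩⟩
  · simp_rw [sym_level_apply hαβ hvP hf]
    refine Finset.aestronglyMeasurable_fun_sum _ fun k _ => AEStronglyMeasurable.smul ?_ ?_
    · exact (hf.smooth.continuous.comp ((hE.smooth k).continuous.comp
        (continuous_const.mul continuous_id))).aestronglyMeasurable
    · exact (hE.measurable k x).comp_quasiMeasurePreserving
        (quasiMeasurePreserving_mul_left Real.two_pi_pos.ne')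
  · rw [sym_level_apply hαβ hvP hf]
    refine (norm_sum_le _ _).trans (Finset.sum_le_sum fun k _ => ?_)
    rw [norm_smul]
    refine mul_le_mul (hfC _) ?_ (norm_nonneg _) hC
    rw [hvP, InnerProductSpace.rankOne_apply, norm_smul, hv, mul_one]
    simpa [hv] using norm_inner_le_norm (𝕜 := ℂ) (v k (2 * Real.pi * w)) x
  · rw [sym_level_eq_zero hαβ hR hf hw]
    rfl

theorem exists_hsSq_sym_le {ι : Type*} (e : HilbertBasis ι ℂ K) (hv : ∀ k ξ, ‖v k ξ‖ = 1)
    (ε : Fin J → ℝ → ℝ) {f : ℝ → ℂ} (hf : IsTest α β f) :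
    ∃ C : ℝ≥0∞, C ≠ ⊤ ∧ ∀ w, ∑' n, ‖sym v ε f w (e n)‖ₑ ^ 2 ≤ C := by
  obtain ⟨C, hC, hfC⟩ := hf.exists_bound
  refine ⟨ENNReal.ofReal (∑ _k : Fin J, ∑ _j : Fin J, C * C * 1), ENNReal.ofReal_ne_top,
    fun w => ?_⟩
  refine (hsSq_sumProj e (fun k => v k w) fun k => f (ε k w)).trans_le
    (ENNReal.ofReal_le_ofReal ((Complex.re_le_norm _).trans ?_))
  refine (norm_sum_le _ _).trans (Finset.sum_le_sum fun k _ =>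
    (norm_sum_le _ _).trans (Finset.sum_le_sum fun j _ => ?_))
  rw [norm_mul, norm_mul, RCLike.norm_conj, Complex.norm_real, Real.norm_of_nonneg (by positivity)]
  have h1 := norm_inner_le_norm (𝕜 := ℂ) (v k w) (v j w)
  rw [hv, hv, one_mul] at h1
  exact mul_le_mul (mul_le_mul (hfC _) (hfC _) (norm_nonneg _) hC)
    (pow_le_one₀ (norm_nonneg _) h1) (by positivity) (mul_nonneg hC hC)

theorem sym_conj_inner (v : Fin J → ℝ → K) (ε : Fin J → ℝ → ℝ) (f : ℝ → ℂ) (w : ℝ) (x y : K) :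
    ⟪sym v ε (fun t => starRingEnd ℂ (f t)) w x, y⟫_ℂ = ⟪x, sym v ε f w y⟫_ℂ := by
  simp only [sym, sumProj_apply, sum_inner, inner_sum, inner_smul_left, inner_smul_right, map_mul,
    inner_conj_symm, Complex.conj_conj]
  exact Finset.sum_congr rfl fun k _ => by ring

theorem HasBranches.isMult (hE : HasBranches H α β E Pr) (hαβ : α < β)
    {ι : Type*} (e : HilbertBasis ι ℂ K) (hv : ∀ k ξ, ‖v k ξ‖ = 1)
    (hvP : ∀ k ξ, Pr k ξ = InnerProductSpace.rankOne ℂ (v k ξ) (v k ξ)) {f : ℝ → ℂ}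
    (hf : IsTest α β f) :
    IsMult e (funCalc H f)
      (sym (fun k w => v k (2 * Real.pi * w)) (fun k => level α β (E k)) f)
      (sym (fun k w => v k (2 * Real.pi * w)) (fun k => level α β (E k))
        fun t => starRingEnd ℂ (f t)) := by
  obtain ⟨R, -, hR⟩ := hE.exists_crossing_bound
  refine ⟨hE.bddSupp_sym hαβ hv hvP hf, hE.bddSupp_sym hαβ hv hvP hf.conj,
    fun w x y => sym_conj_inner _ _ _ _ _ _, ⟨R / (2 * Real.pi), fun w hw =>
      ⟨sym_level_eq_zero hαβ hR hf hw, sym_level_eq_zero hαβ hR hf.conj hw⟩⟩,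
    exists_hsSq_sym_le e (fun k w => hv k _) _ hf, exists_hsSq_sym_le e (fun k w => hv k _) _ hf.conj,
    fun u => ?_⟩
  filter_upwards [hE.decomposition f hf u] with w hw
  rw [hw, sym_level_apply hαβ hvP hf]

/-- The branch projectors are not assumed mutually orthogonal. What replaces this is `f(H)² =
(f²)(H)`, read on symbols almost everywhere. -/
theorem HasBranches.sym_mul_self [TopologicalSpace.SeparableSpace K]
    (hH : IsSelfAdjoint H) (hE : HasBranches H α β E Pr) (hαβ : α < β)
    (hv : ∀ k ξ, ‖v k ξ‖ = 1)
    (hvP : ∀ k ξ, Pr k ξ = InnerProductSpace.rankOne ℂ (v k ξ) (v k ξ)) {f : ℝ → ℂ}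
    (hf : IsTest α β f) :
    ∀ᵐ w, sym (fun k w => v k (2 * Real.pi * w)) (fun k => level α β (E k)) f w ∘L
        sym (fun k w => v k (2 * Real.pi * w)) (fun k => level α β (E k)) f w =
      sym (fun k w => v k (2 * Real.pi * w)) (fun k => level α β (E k)) (fun t => f t * f t) w := by
  have : Countable (basisSet K) := HilbertBasis.countable_of_separable (hilbBasis K)
  refine ae_eq_of_forall_L2 (hilbBasis K) fun g => ?_
  have h1 := hE.isMult hαβ (hilbBasis K) hv hvP hf
  have h2 := hE.isMult hαβ (hilbBasis K) hv hvP (hf.mul_left hf.smooth)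
  set u : L2 K := 𝓕⁻ g
  have hu : (𝓕 u : L2 K) = g := FourierTransform.fourier_fourierInv_eq g
  have h3 := funCalc_mul hH hf.eventuallyConst hf.eventuallyConst
  filter_upwards [h1.apply u, h1.apply (funCalc H f u), h2.apply u] with w e1 e2 e3
  rw [hu] at e1 e3
  rw [ContinuousLinearMap.comp_apply, ← e1, ← e2, ← e3, h3]
  rfl

theorem HasBranches.exists_ends (hE : HasBranches H α β E Pr) (hαβ : α < β) :
    ∃ c d, (∀ k w, w ≤ c → level α β (E k) w = branchEnd α β (E k) atBot) ∧
      ∀ k w, d < w → level α β (E k) w = branchEnd α β (E k) atTop := by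
  obtain ⟨R, hR0, hR⟩ := hE.exists_crossing_bound
  have hval : ∀ x, (x ≤ α → max α (min β x) = α) ∧ (β ≤ x → max α (min β x) = β) := fun x =>
    ⟨fun h => by rw [min_eq_right (h.trans hαβ.le), max_eq_left h],
      fun h => by rw [min_eq_left h, max_eq_right hαβ.le]⟩
  -- The left condition is on a closed half-line while the branches are controlled for `ξ < -R`
  -- strictly, hence the extra `1`.
  refine ⟨-(R + 1) / (2 * Real.pi), R / (2 * Real.pi), fun k w hw => ?_, fun k w hw => ?_⟩
  · have h1 : 2 * Real.pi * w < -R := by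
      rw [le_div_iff₀' Real.two_pi_pos] at hw
      linarith
    rcases eventually_level_atBot hαβ (hE.smooth k).continuous (R := -R) (fun ξ hξ => hR k ξ (by
      rw [abs_of_neg (by linarith)]
      linarith)) with h | h
    · rw [h.1, level, (hval _).1 (h.2 _ h1)]
    · rw [h.1, level, (hval _).2 (h.2 _ h1)]
  · have h1 : R < 2 * Real.pi * w := by
      rwa [div_lt_iff₀' Real.two_pi_pos] at hw
    rcases eventually_level_atTop hαβ (hE.smooth k).continuous (R := R) (fun ξ hξ => hR k ξ
      (hξ.trans_le (le_abs_self _))) with h | h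
    · rw [h.1, level, (hval _).1 (h.2 _ h1)]
    · rw [h.1, level, (hval _).2 (h.2 _ h1)]

/-- The trace of `[f(H), P] g(H)` is a sum of boundary terms of the branches. The
spatial switch function `P` may differ from the one, `Q`, whose commutators are all nuclear. -/
theorem HasBranches.opTrace_opComm [TopologicalSpace.SeparableSpace K]
    (hH : IsSelfAdjoint H) (hE : HasBranches H α β E Pr) (hαβ : α < β)
    {Q : ℝ → ℝ} {c d : ℝ} (hQm : Measurable Q) (hQ : IsSwitch 0 1 c d Q)
    (hn : ∀ f : ℝ → ℂ, IsTest α β f → IsNuclear (opComm (funCalc H f) (mulOp K Q)))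
    {P : ℝ → ℝ} {c' d' : ℝ} (hPm : Measurable P) (hcd : c' ≤ d') (hP : IsSwitch 0 1 c' d' P)
    {f g : ℝ → ℂ} (hf : IsTest α β f) (hg : IsTest α β g)
    (hfP : IsNuclear (opComm (funCalc H f) (mulOp K P)))
    (hgP : IsNuclear (opComm (funCalc H g) (mulOp K P))) :
    2 * Real.pi * Complex.I * opTrace (opComm (funCalc H f) (mulOp K P) ∘L funCalc H g) =
      ∑ k, ∫ s in (branchEnd α β (E k) atBot)..(branchEnd α β (E k) atTop),
        deriv f s * g s := by
  have : Countable (basisSet K) := HilbertBasis.countable_of_separable (hilbBasis K)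
  choose v hv hvP using fun k ξ => exists_eq_rankOne (hE.projector k ξ) (hE.rank_one k ξ)
  obtain ⟨a, b, hl, hr⟩ := hE.exists_ends hαβ
  have hmult : ∀ f, IsTest α β f → IsMult (hilbBasis K) (funCalc H f)
      (sym (fun k w => v k (2 * Real.pi * w)) (fun k => level α β (E k)) f)
      (sym (fun k w => v k (2 * Real.pi * w)) (fun k => level α β (E k))
        fun t => starRingEnd ℂ (f t)) := fun f hf => hE.isMult hαβ (hilbBasis K) hv hvP hf
  have hconj : ∀ f, IsTest α β f → IsMult (hilbBasis K) (funCalc H fun t => starRingEnd ℂ (f t))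
      (sym (fun k w => v k (2 * Real.pi * w)) (fun k => level α β (E k))
        fun t => starRingEnd ℂ (f t))
      (sym (fun k w => v k (2 * Real.pi * w)) (fun k => level α β (E k)) f) := fun f hf =>
    (hmult f hf).swap (hmult _ hf.conj).apply
  -- Frequency side: the regularity of every symbol comes from `Q`. The symbol of `f(H)` is the
  -- adjoint symbol of the conjugate function, whence `hconj`.
  have h1 := hasDerivAt_integral_hsInner_sym (e := hilbBasis K) hαβ
    (v := fun k w => v k (2 * Real.pi * w)) (fun k w => hv k _)
    (ε := fun k => level α β (E k)) (fun k => continuous_level (hE.smooth k).continuous) hl hr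
    (op := funCalc H) hmult (fun f hf => hE.sym_mul_self hH hαβ hv hvP hf)
    (fun f hf => (hmult f hf).tendsto_lintegral_hsSq_sub
      ((hconj f hf).lintegral_mul_dens_ne_top hQ hQm (hn _ hf.conj))) hf hg
  have hfP' : IsNuclear (opComm (funCalc H fun t => starRingEnd ℂ (f t)) (mulOp K P)) := by
    have h3 := hfP.adjoint.neg
    rwa [adjoint_opComm_mulOp (hP.memLp_top hPm), neg_sub,
      ← funCalc_star hf.eventuallyConst] at h3
  -- Position side: only the commutators of `f(H)`, its adjoint and `g(H)` with `P` enter.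
  -- Uniqueness of the derivative then gives the formula.
  have h2 := (hmult f hf).hasDerivAt_integral_hsInner hP hPm hcd (hconj f hf)
    (funCalc_star hf.eventuallyConst) (hmult g hg) hfP
    hfP' hgP
  exact h2.unique h1

end BranchSymbols

/-! ### Energy switches along branches -/

section Switches

variable {α β : ℝ} {φ : ℝ → ℝ}

theorem isTest_deriv (hφ : ContDiff ℝ ∞ φ) (hφΔ : tsupport (deriv φ) ⊆ Set.Ioo α β) :
    IsTest α β fun h => ((deriv φ h : ℝ) : ℂ) := by
  have hc : HasCompactSupport (deriv φ) :=
    HasCompactSupport.of_support_subset_isCompact isCompact_Icc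
      (((subset_tsupport _).trans hφΔ).trans Set.Ioo_subset_Icc_self)
  exact ⟨Complex.ofRealCLM.contDiff.comp ((contDiff_infty_iff_deriv.1 hφ).2),
    hc.comp_left (g := Complex.ofReal) Complex.ofReal_zero,
    (tsupport_comp_subset Complex.ofReal_zero _).trans hφΔ⟩

theorem switch_eq_one_of_le (hφ : Continuous φ) (hφs : IsSwitch 0 1 α β φ) {x : ℝ} (hx : β ≤ x) :
    φ x = 1 := by
  rcases hx.lt_or_eq with h | rfl
  · exact hφs.right x h
  · have h1 : Tendsto φ (𝓝[>] β) (𝓝 (φ β)) := hφ.continuousWithinAt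
    have h2 : Tendsto φ (𝓝[>] β) (𝓝 1) := tendsto_const_nhds.congr' (by
      filter_upwards [self_mem_nhdsWithin] with y hy
      exact (hφs.right y hy).symm)
    exact tendsto_nhds_unique h1 h2

theorem hasDerivAt_expFun (hφ : ContDiff ℝ ∞ φ) (x : ℝ) :
    HasDerivAt (expFun φ) (2 * Real.pi * Complex.I * ((deriv φ x : ℝ) : ℂ) * expFun φ x) x := by
  have h1 : HasDerivAt (fun x => ((φ x : ℝ) : ℂ)) ((deriv φ x : ℝ) : ℂ) x :=
    ((hφ.differentiable (by simp)) x).hasDerivAt.ofReal_comp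
  have h2 := (h1.const_mul (2 * Real.pi * Complex.I)).cexp
  refine h2.congr_deriv ?_
  rw [expFun, mul_comm]

theorem conj_mul_expFun (φ : ℝ → ℝ) (x : ℝ) : starRingEnd ℂ (expFun φ x) * expFun φ x = 1 := by
  rw [expFun, ← Complex.exp_conj, ← Complex.exp_add]
  simp [Complex.conj_ofNat]

theorem expFun_eq_one {x : ℝ} (h : φ x = 0 ∨ φ x = 1) : expFun φ x = 1 := by
  rcases h with h | h <;> simp [expFun, h, Complex.exp_two_pi_mul_I]

/-- Vanishing outside `(α, β)` would not keep the closed support inside the open interval. Since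
`φ'` is supported strictly inside, `φ` already equals `0` or `1` before reaching the ends. -/
theorem isTest_expFun_sub_one (hαβ : α < β) (hφ : ContDiff ℝ ∞ φ) (hφs : IsSwitch 0 1 α β φ)
    (hφΔ : tsupport (deriv φ) ⊆ Set.Ioo α β) : IsTest α β fun h => expFun φ h - 1 := by
  obtain ⟨r, hr, hr', h0⟩ := (isTest_deriv hφ hφΔ).exists_radius hαβ
  have h0' : ∀ y, r < |y - (α + β) / 2| → deriv φ y = 0 := fun y hy =>
    Complex.ofReal_eq_zero.1 (h0 y hy)
  have hd : Continuous (deriv φ) := hφ.continuous_deriv (by simp)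
  have hconst : ∀ x y, (∀ s ∈ Set.uIcc x y, r < |s - (α + β) / 2|) → φ x = φ y := by
    intro x y h
    have h1 := intervalIntegral.integral_deriv_eq_sub (f := φ) (a := x) (b := y)
      (fun s _ => hφ.differentiable (by simp) s) (hd.intervalIntegrable _ _)
    rw [intervalIntegral.integral_congr (g := fun _ => 0) fun s hs => h0' s (h s hs),
      intervalIntegral.integral_zero] at h1
    linarith
  have hsupp : Function.support (fun h => expFun φ h - 1) ⊆
      Metric.closedBall ((α + β) / 2) r := by
    intro y hy
    by_contra h
    rw [Metric.mem_closedBall, not_le, Real.dist_eq] at h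
    refine hy (sub_eq_zero.2 (expFun_eq_one ?_))
    rcases lt_abs.1 h with h1 | h1
    · right
      rw [hconst y (max y β) fun s hs => ?_, switch_eq_one_of_le hφ.continuous hφs (le_max_right _ _)]
      rw [Set.uIcc_of_le (le_max_left _ _)] at hs
      exact (h1.trans_le (by linarith [hs.1])).trans_le (le_abs_self _)
    · left
      rw [hconst y (min y α) fun s hs => ?_, hφs.left _ (min_le_right _ _)]
      rw [Set.uIcc_of_ge (min_le_left _ _)] at hs
      exact (h1.trans_le (by linarith [hs.2])).trans_le (neg_le_abs _)
  have hball : Metric.closedBall ((α + β) / 2) r ⊆ Set.Ioo α β := by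
    rw [Real.closedBall_eq_Icc]
    exact Set.Icc_subset_Ioo (by linarith) (by linarith)
  refine ⟨?_, HasCompactSupport.of_support_subset_isCompact (isCompact_closedBall _ _) hsupp,
    (closure_minimal hsupp Metric.isClosed_closedBall).trans hball⟩
  refine ContDiff.sub (ContDiff.cexp (contDiff_const.mul ?_)) contDiff_const
  exact Complex.ofRealCLM.contDiff.comp hφ

variable {e : ℝ → ℝ}

/-- The total variation of a switch function along a branch. -/
theorem integral_deriv_switch_comp (hαβ : α < β) (hφ : ContDiff ℝ ∞ φ)
    (hφs : IsSwitch 0 1 α β φ) (he : ContDiff ℝ ∞ e)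
    (hb : Bornology.IsBounded {ξ : ℝ | e ξ ∈ Set.Ioo α β}) :
    ∫ ξ, deriv (φ ∘ e) ξ = φ (branchEnd α β e atTop) - φ (branchEnd α β e atBot) := by
  obtain ⟨R, hR⟩ := (Metric.isBounded_iff_subset_closedBall 0).1 hb
  have hR' : ∀ ξ, R < |ξ| → e ξ ∉ Set.Ioo α β := fun ξ hξ h => by
    have := hR h
    rw [Metric.mem_closedBall, dist_zero_right, Real.norm_eq_abs] at this
    linarith
  have hφβ := fun x hx => switch_eq_one_of_le (x := x) hφ.continuous hφs hx
  have htop : ∀ ξ, R < ξ → (φ ∘ e) ξ = φ (branchEnd α β e atTop) := fun ξ hξ => by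
    rcases eventually_level_atTop hαβ he.continuous
      (fun ξ hξ => hR' ξ (hξ.trans_le (le_abs_self _))) with h | h
    · rw [h.1, Function.comp_apply, hφs.left _ (h.2 ξ hξ), hφs.left _ le_rfl]
    · rw [h.1, Function.comp_apply, hφβ _ (h.2 ξ hξ), hφβ _ le_rfl]
  have hbot : ∀ ξ, ξ < -R → (φ ∘ e) ξ = φ (branchEnd α β e atBot) := fun ξ hξ => by
    rcases eventually_level_atBot hαβ he.continuous (R := -R)
      (fun ξ hξ => hR' ξ (lt_of_lt_of_le (by linarith) (neg_le_abs _))) with h | h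
    · rw [h.1, Function.comp_apply, hφs.left _ (h.2 ξ hξ), hφs.left _ le_rfl]
    · rw [h.1, Function.comp_apply, hφβ _ (h.2 ξ hξ), hφβ _ le_rfl]
  have hsm : ContDiff ℝ ∞ (φ ∘ e) := hφ.comp he
  have hcs : HasCompactSupport (deriv (φ ∘ e)) := by
    refine HasCompactSupport.intro (isCompact_Icc (a := -R) (b := R)) fun ξ hξ => ?_
    rw [Set.mem_Icc, not_and_or, not_le, not_le] at hξ
    have : φ ∘ e =ᶠ[𝓝 ξ] fun _ => (φ ∘ e) ξ := by
      rcases hξ with h | h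
      · filter_upwards [Iio_mem_nhds h] with η hη
        rw [hbot η hη, hbot ξ h]
      · filter_upwards [Ioi_mem_nhds h] with η hη
        rw [htop η hη, htop ξ h]
    rw [this.deriv_eq, deriv_const]
  refine integral_of_hasDerivAt_of_tendsto
    (fun ξ => (hsm.differentiable (by simp) ξ).hasDerivAt)
    ((hsm.continuous_deriv (by simp)).integrable_of_hasCompactSupport hcs)
    (tendsto_const_nhds.congr' ?_) (tendsto_const_nhds.congr' ?_)
  · filter_upwards [eventually_lt_atBot (-R)] with ξ hξ
    exact (hbot ξ hξ).symm
  · filter_upwards [eventually_gt_atTop R] with ξ hξ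
    exact (htop ξ hξ).symm

theorem winding_expFun_comp (hφ : ContDiff ℝ ∞ φ) (he : ContDiff ℝ ∞ e) :
    winding (expFun φ ∘ e) = ((∫ ξ, deriv (φ ∘ e) ξ : ℝ) : ℂ) := by
  have h1 : ∀ ξ, starRingEnd ℂ ((expFun φ ∘ e) ξ) * deriv (expFun φ ∘ e) ξ =
      2 * Real.pi * Complex.I * ((deriv (φ ∘ e) ξ : ℝ) : ℂ) := fun ξ => by
    have h2 := hasDerivAt_expFun (hφ.comp he) ξ
    have h3 : expFun (φ ∘ e) = expFun φ ∘ e := rfl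
    rw [h3] at h2
    rw [h2.deriv, mul_left_comm, ← h3, conj_mul_expFun, mul_one]
  rw [winding]
  simp_rw [h1]
  rw [integral_const_mul, integral_complex_ofReal, ← mul_assoc, one_div, inv_mul_cancel₀, one_mul]
  exact Complex.two_pi_I_ne_zero

theorem branchEnd_eq_or (α β : ℝ) (e : ℝ → ℝ) (l : Filter ℝ) :
    branchEnd α β e l = α ∨ branchEnd α β e l = β := by
  rw [branchEnd]
  split_ifs <;> simp

theorem sum_switch_branchEnd (hαβ : α < β) (hφ : ContDiff ℝ ∞ φ) (hφs : IsSwitch 0 1 α β φ)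
    {J : ℕ} (E : Fin J → ℝ → ℝ) :
    ∑ j, (φ (branchEnd α β (E j) atTop) - φ (branchEnd α β (E j) atBot)) =
      (((Nat.card {j : Fin J //
            branchEnd α β (E j) atBot = α ∧ branchEnd α β (E j) atTop = β} : ℤ) -
        (Nat.card {j : Fin J //
            branchEnd α β (E j) atBot = β ∧ branchEnd α β (E j) atTop = α} : ℤ) : ℤ) : ℝ) := by
  classical
  have hβ := switch_eq_one_of_le hφ.continuous hφs (le_refl β)
  have hα := hφs.left α le_rfl
  have h1 : ∀ j, φ (branchEnd α β (E j) atTop) - φ (branchEnd α β (E j) atBot) =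
      (if branchEnd α β (E j) atBot = α ∧ branchEnd α β (E j) atTop = β then 1 else 0) -
      (if branchEnd α β (E j) atBot = β ∧ branchEnd α β (E j) atTop = α then 1 else 0) := fun j => by
    rcases branchEnd_eq_or α β (E j) atTop with h | h <;>
      rcases branchEnd_eq_or α β (E j) atBot with h' | h' <;>
      simp [h, h', hα, hβ, hαβ.ne, hαβ.ne']
  simp_rw [h1]
  rw [Finset.sum_sub_distrib, Finset.sum_boole, Finset.sum_boole, Nat.card_eq_fintype_card,
    Nat.card_eq_fintype_card, Fintype.card_subtype, Fintype.card_subtype]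
  push_cast
  rfl

end Switches

/-! ### The conductivity and the index -/

section Conductivity

variable {K : Type*} [NormedAddCommGroup K] [InnerProductSpace ℂ K] [CompleteSpace K]
  [TopologicalSpace.SeparableSpace K] {H : L2 K →ₗ.[ℂ] L2 K} {α β : ℝ} {J : ℕ}
  {E : Fin J → ℝ → ℝ} {Pr : Fin J → ℝ → K →L[ℂ] K} {φ : ℝ → ℝ} {Q : ℝ → ℝ} {c d : ℝ}

/-- As `f χ = f`, one has `T = T χ(H)`, and cyclicity moves `χ(H)` to the left of the unbounded `H`,
where it is absorbed into the bounded operator `(t χ)(H)`. Only commutators of test functions of `H`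
remain. -/
theorem IsCurrentOperator.opTrace_eq {V : Type*} [NormedAddCommGroup V] [InnerProductSpace ℂ V]
    [CompleteSpace V] {H : V →ₗ.[ℂ] V} (hH : IsSelfAdjoint H) {P T : V →L[ℂ] V} {f χ : ℝ → ℂ}
    (hf : IsTest α β f) (hχ : IsTest α β χ) (hfχ : (fun x => f x * χ x) = f)
    (hT : IsCurrentOperator H P (funCalc H f) T) (hTn : IsNuclear T)
    (hn : ∀ g, IsTest α β g → IsNuclear (opComm (funCalc H g) P)) :
    opTrace T = Complex.I * (opTrace (opComm (funCalc H fun t => (t : ℂ) * χ t) P ∘L funCalc H f) -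
      opTrace (opComm (funCalc H χ) P ∘L funCalc H fun t => (t : ℂ) * f t)) := by
  have hid : ContDiff ℝ ∞ (fun t : ℝ => (t : ℂ)) := Complex.ofRealCLM.contDiff
  have htχ := hχ.mul_left hid
  have htf := hf.mul_left hid
  set F := funCalc H f
  set X := funCalc H χ
  set F₁ := funCalc H fun t => (t : ℂ) * f t
  set X₁ := funCalc H fun t => (t : ℂ) * χ t
  have e1 : F * X = F := by rw [← funCalc_mul hH hf.eventuallyConst hχ.eventuallyConst, hfχ]
  have hχf : (fun x => χ x * f x) = f := by
    rw [← hfχ]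
    funext x
    rw [← congrFun hfχ x]
    simp only [congrFun hfχ x]
    rw [mul_comm, congrFun hfχ x]
  have e2 : X * F₁ = F₁ := by
    rw [← funCalc_mul hH hχ.eventuallyConst htf.eventuallyConst]
    refine congrArg (funCalc H) (funext fun t => ?_)
    rw [mul_left_comm, congrFun hχf t]
  have e3 : X₁ * F = F₁ := by
    rw [← funCalc_mul hH htχ.eventuallyConst hf.eventuallyConst]
    refine congrArg (funCalc H) (funext fun t => ?_)
    rw [mul_assoc, congrFun hχf t]
  have hHF : ∀ v (h : F v ∈ H.domain), H ⟨F v, h⟩ = F₁ v := fun v h => by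
    obtain ⟨h', e⟩ := apply_funCalc hH hf.smooth.continuous hf.compact v
    exact e
  have hTX : T ∘L X = T := by
    ext v
    have e4 : F (X v) = F v := congr($e1 v)
    obtain ⟨h1, h2, e5⟩ := hT (X v)
    obtain ⟨h1', h2', e6⟩ := hT v
    rw [ContinuousLinearMap.comp_apply, e5, e6]
    simp only [e4]
  -- The terms with `P` on the left cancel, since `X₁ * F` and `X * F₁` are both `F₁`.
  have hXT : X ∘L T = Complex.I • (opComm X₁ P ∘L F - opComm X P ∘L F₁) := by
    have e7 : X ∘L T = Complex.I • (X₁ * P * F - X * P * F₁) := by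
      ext v
      obtain ⟨h1, h2, e5⟩ := hT v
      have e8 := funCalc_apply hH hχ.smooth.continuous hχ.compact ⟨P (F v), h2⟩
      rw [ContinuousLinearMap.comp_apply, e5, map_smul, map_sub, e8, hHF]
      rfl
    rw [e7]
    congr 1
    change _ = (X₁ * P - P * X₁) * F - (X * P - P * X) * F₁
    rw [sub_mul, sub_mul, mul_assoc P X₁, mul_assoc P X, e2, e3]
    abel
  rw [← hTX, opTrace_comp_comm hTn X, hXT, opTrace_smul, opTrace_sub]
  · exact (hn _ htχ).comp_right _
  · exact (hn _ hχ).comp_right _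
  · exact ((hn _ htχ).comp_right _).sub ((hn _ hχ).comp_right _)

theorem HasBranches.two_pi_mul_opTrace (hαβ : α < β) (hH : IsSelfAdjoint H)
    (hE : HasBranches H α β E Pr) (hφ : ContDiff ℝ ∞ φ)
    (hφΔ : tsupport (deriv φ) ⊆ Set.Ioo α β) (hQm : Measurable Q) (hcd : c ≤ d)
    (hQ : IsSwitch 0 1 c d Q)
    (hn : ∀ f : ℝ → ℂ, IsTest α β f → IsNuclear (opComm (funCalc H f) (mulOp K Q)))
    {T : L2 K →L[ℂ] L2 K}
    (hT : IsCurrentOperator H (mulOp K Q) (funCalc H (fun h => ((deriv φ h : ℝ) : ℂ))) T)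
    (hTn : IsNuclear T) :
    2 * Real.pi * opTrace T =
      ∑ j, ((φ (branchEnd α β (E j) atTop) - φ (branchEnd α β (E j) atBot) : ℝ) : ℂ) := by
  have hf := isTest_deriv hφ hφΔ
  obtain ⟨χ, hχ, -, hfχ⟩ := hf.exists_plateau_mul hαβ
  have hid : ContDiff ℝ ∞ (fun t : ℝ => (t : ℂ)) := Complex.ofRealCLM.contDiff
  have htχ := hχ.mul_left hid
  have htf := hf.mul_left hid
  have k1 := hE.opTrace_opComm hH hαβ hQm hQ hn hQm hcd hQ htχ hf (hn _ htχ) (hn _ hf)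
  have k2 := hE.opTrace_opComm hH hαβ hQm hQ hn hQm hcd hQ hχ htf (hn _ hχ) (hn _ htf)
  have hT' := hT.opTrace_eq hH hf hχ hfχ hTn hn
  have hd : Continuous (deriv φ) := hφ.continuous_deriv (by simp)
  -- The derivatives of `χ` cancel: `(s χ)' φ' - χ' s φ' = χ φ' = φ'`.
  have key : ∀ a b : ℝ, (∫ s in a..b, deriv (fun t : ℝ => (t : ℂ) * χ t) s * ((deriv φ s : ℝ) : ℂ)) -
      (∫ s in a..b, deriv χ s * ((s : ℂ) * ((deriv φ s : ℝ) : ℂ))) = ((φ b - φ a : ℝ) : ℂ) := by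
    intro a b
    rw [← intervalIntegral.integral_sub
      ((htχ.continuous_deriv_mul hf).intervalIntegrable _ _)
      ((hχ.continuous_deriv_mul htf).intervalIntegrable _ _),
      ← intervalIntegral.integral_deriv_eq_sub (fun s _ => hφ.differentiable (by simp) s)
        (hd.intervalIntegrable _ _), ← intervalIntegral.integral_ofReal]
    refine intervalIntegral.integral_congr fun s _ => ?_
    have h1 : HasDerivAt (fun t : ℝ => (t : ℂ)) 1 s := Complex.ofRealCLM.hasDerivAt
    have h2 := h1.mul ((hχ.smooth.differentiable (by simp)) s).hasDerivAt
    have h3 : deriv (fun t : ℝ => (t : ℂ) * χ t) s = 1 * χ s + (s : ℂ) * deriv χ s := h2.deriv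
    have h4 := congrFun hfχ s
    rw [h3, ← sub_eq_zero]
    linear_combination h4
  have h5 : 2 * Real.pi * opTrace T =
      2 * Real.pi * Complex.I * opTrace (opComm (funCalc H fun t => (t : ℂ) * χ t) (mulOp K Q) ∘L
        funCalc H fun h => ((deriv φ h : ℝ) : ℂ)) -
      2 * Real.pi * Complex.I * opTrace (opComm (funCalc H χ) (mulOp K Q) ∘L
        funCalc H fun t => (t : ℂ) * ((deriv φ t : ℝ) : ℂ)) := by
    rw [hT']
    ring
  rw [h5, k1, k2, ← Finset.sum_sub_distrib]
  exact Finset.sum_congr rfl fun j _ => key _ _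

theorem isSwitch_heaviside (x₀ : ℝ) : IsSwitch 0 1 x₀ x₀ (heaviside x₀) := by
  refine ⟨⟨1, fun x => ?_⟩, fun x hx => if_neg (not_lt.2 hx), fun x hx => if_pos hx⟩
  rw [heaviside]
  split_ifs <;> simp

theorem measurable_heaviside (x₀ : ℝ) : Measurable (heaviside x₀) :=
  Measurable.ite measurableSet_Ioi measurable_const measurable_const

/-- `U` itself is not a test function of `H`, but `u = U - 1` is and has the same commutator with
the Heaviside projection. The index `Tr U*[U, P]` splits into `Tr u*[u, P]` and `Tr [U, P]`, and the
latter vanishes by assumption. -/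
theorem HasBranches.index_compression (hαβ : α < β) (hH : IsSelfAdjoint H)
    (hE : HasBranches H α β E Pr) (hφ : ContDiff ℝ ∞ φ) (hφs : IsSwitch 0 1 α β φ)
    (hφΔ : tsupport (deriv φ) ⊆ Set.Ioo α β) (hQm : Measurable Q)
    (hQ : IsSwitch 0 1 c d Q)
    (hn : ∀ f : ℝ → ℂ, IsTest α β f → IsNuclear (opComm (funCalc H f) (mulOp K Q))) (x₀ : ℝ)
    (hC : IsNuclear (opComm (funCalc H (expFun φ)) (mulOp K (heaviside x₀))))
    (hC0 : opTrace (opComm (funCalc H (expFun φ)) (mulOp K (heaviside x₀))) = 0) :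
    (compression (mulOp K (heaviside x₀)) (funCalc H (expFun φ))).IsFredholm ∧
      (fredholmIndex (compression (mulOp K (heaviside x₀)) (funCalc H (expFun φ))) : ℂ) =
        ∑ j, ((φ (branchEnd α β (E j) atTop) - φ (branchEnd α β (E j) atBot) : ℝ) : ℂ) := by
  have hu := isTest_expFun_sub_one hαβ hφ hφs hφΔ
  set P := heaviside x₀
  have hPt := (isSwitch_heaviside x₀).memLp_top (measurable_heaviside x₀)
  have h1 := EventuallyConst.const (1 : ℂ)
  have hUe : EventuallyConst (expFun φ) 1 := by
    have := hu.eventuallyConst.add h1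
    simpa using this
  have hU : funCalc H (expFun φ) = funCalc H (fun h => expFun φ h - 1) + 1 := by
    have := funCalc_add hH hu.eventuallyConst h1
    simpa [funCalc_const hH] using this
  set U := funCalc H (expFun φ)
  set u := funCalc H fun h => expFun φ h - 1
  set M := mulOp K P
  have hMM : M * M = M := by
    ext1 f
    refine Lp.ext ?_
    filter_upwards [mulOp_ae P hPt f, mulOp_ae P hPt (M f)] with x e1 e2
    change (M (M f) : L2 K) x = _
    rw [e2, e1, smul_smul]
    congr 1
    simp only [P, heaviside]
    split_ifs <;> simp
  have hstar := funCalc_star hUe (H := H)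
  have hUU : ContinuousLinearMap.adjoint U * U = 1 := by
    rw [← hstar, ← funCalc_mul hH hUe.star hUe]
    have : (fun t => star (expFun φ t) * expFun φ t) = fun _ => (1 : ℂ) :=
      funext fun t => conj_mul_expFun φ t
    rw [this, funCalc_const hH, one_smul]
  have hUU' : U * ContinuousLinearMap.adjoint U = 1 := by
    rw [← hstar, ← funCalc_commute hH hUe.star hUe, hstar, hUU]
  obtain ⟨hF, hidx⟩ := compression_fredholm hMM hUU hUU' hC
  refine ⟨hF, ?_⟩
  have hcomm : opComm U M = opComm u M := by
    change U * M - M * U = u * M - M * u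
    rw [hU]
    noncomm_ring
  rw [hcomm] at hC hC0 hidx
  set G := funCalc H fun t => starRingEnd ℂ (expFun φ t - 1)
  have hG : ContinuousLinearMap.adjoint u = G := (funCalc_star hu.eventuallyConst).symm
  have hGP : IsNuclear (opComm G M) := by
    have h3 := hC.adjoint.neg
    rwa [adjoint_opComm_mulOp hPt, neg_sub, hG] at h3
  have hUG : ContinuousLinearMap.adjoint U = G + 1 := by
    rw [hU, map_add, hG, ContinuousLinearMap.adjoint_one]
  have hsplit : ContinuousLinearMap.adjoint U ∘L opComm u M = G ∘L opComm u M + opComm u M := by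
    rw [hUG]
    exact add_one_mul G (opComm u M)
  rw [hidx, hsplit, opTrace_add (hC.comp_left G) hC, hC0, add_zero, ← opTrace_comp_comm hC G]
  have k := hE.opTrace_opComm hH hαβ hQm hQ hn (measurable_heaviside x₀) le_rfl
    (isSwitch_heaviside x₀) hu hu.conj hC hGP
  have hd : Continuous (deriv φ) := hφ.continuous_deriv (by simp)
  have hder : ∀ s, deriv (fun h => expFun φ h - 1) s =
      2 * Real.pi * Complex.I * ((deriv φ s : ℝ) : ℂ) * expFun φ s := fun s =>
    ((hasDerivAt_expFun hφ s).sub_const 1).deriv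
  have hone : ∀ l (j : Fin J), expFun φ (branchEnd α β (E j) l) = 1 := fun l j =>
    expFun_eq_one ((branchEnd_eq_or α β (E j) l).imp (fun h => by rw [h, hφs.left α le_rfl])
      fun h => by rw [h, switch_eq_one_of_le hφ.continuous hφs le_rfl])
  -- As `U` has modulus one, the integrand is `2πi φ' - u'`. The exact term `u'` contributes nothing
  -- because `u` vanishes at both `α` and `β`.
  have key : ∀ j, ∫ s in (branchEnd α β (E j) atBot)..(branchEnd α β (E j) atTop),
      deriv (fun h => expFun φ h - 1) s * starRingEnd ℂ (expFun φ s - 1) =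
      2 * Real.pi * Complex.I *
        ((φ (branchEnd α β (E j) atTop) - φ (branchEnd α β (E j) atBot) : ℝ) : ℂ) := by
    intro j
    have e1 : ∀ s, deriv (fun h => expFun φ h - 1) s * starRingEnd ℂ (expFun φ s - 1) =
        2 * Real.pi * Complex.I * ((deriv φ s : ℝ) : ℂ) -
          deriv (fun h => expFun φ h - 1) s := fun s => by
      rw [hder, map_sub, map_one]
      linear_combination (2 * Real.pi * Complex.I * ((deriv φ s : ℝ) : ℂ)) * conj_mul_expFun φ s
    simp_rw [e1]
    have i1 : Continuous fun s => 2 * Real.pi * Complex.I * ((deriv φ s : ℝ) : ℂ) :=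
      continuous_const.mul (Complex.continuous_ofReal.comp hd)
    have i2 : Continuous (deriv fun h => expFun φ h - 1) := hu.smooth.continuous_deriv (by simp)
    rw [intervalIntegral.integral_sub (i1.intervalIntegrable _ _) (i2.intervalIntegrable _ _),
      intervalIntegral.integral_const_mul, intervalIntegral.integral_ofReal,
      intervalIntegral.integral_deriv_eq_sub (fun s _ => hφ.differentiable (by simp) s)
        (hd.intervalIntegrable _ _),
      intervalIntegral.integral_deriv_eq_sub (fun s _ => hu.smooth.differentiable (by simp) s)
        (i2.intervalIntegrable _ _), hone, hone]
    simp
  rw [Finset.sum_congr rfl fun j _ => key j, ← Finset.mul_sum] at k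
  exact mul_left_cancel₀ Complex.two_pi_I_ne_zero k

end Conductivity

end SpectralFlow

/-! ### Quantization of the conductivity and its equality with the Toeplitz index. -/

theorem corollary3p2 {K : Type*} [NormedAddCommGroup K] [InnerProductSpace ℂ K]
    [CompleteSpace K] [TopologicalSpace.SeparableSpace K]
    -- the Hamiltonian
    (H : L2 K →ₗ.[ℂ] L2 K) (hH : IsSelfAdjoint H) (hinv : TranslationInvariant H)
    -- the energy interval and the spectral branches
    (α β : ℝ) (hαβ : α < β) (J : ℕ) (E : Fin J → ℝ → ℝ) (Pr : Fin J → ℝ → K →L[ℂ] K)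
    (hE : HasBranches H α β E Pr)
    -- the smooth switch function in energy
    (φ : ℝ → ℝ) (hφ : ContDiff ℝ ∞ φ) (hφs : IsSwitch 0 1 α β φ)
    (hφΔ : tsupport (deriv φ) ⊆ Set.Ioo α β)
    -- the switch function in space
    (P : ℝ → ℝ) (hPm : Measurable P) (c d : ℝ) (hcd : c ≤ d) (hP : IsSwitch 0 1 c d P)
    -- trace-class assumptions; `T = i [H, P] φ'(H)`, with trace the observable `σ_I`
    (htc : ∀ Ψ Φ : ℝ → ℂ, IsTest α β Ψ → IsTest α β Φ →
      IsTraceClass (opComm (funCalc H Ψ) (mulOp K P) ∘L funCalc H Φ))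
    (T : L2 K →L[ℂ] L2 K)
    (hT : IsCurrentOperator H (mulOp K P) (funCalc H (fun h => ((deriv φ h : ℝ) : ℂ))) T)
    (hTtc : IsTraceClass T) :
    (2 * Real.pi * opTrace T = ∑ j, ((∫ ξ : ℝ, deriv (φ ∘ E j) ξ : ℝ) : ℂ)) ∧
    (2 * Real.pi * opTrace T =
      ∑ j, ((φ (branchEnd α β (E j) atTop) - φ (branchEnd α β (E j) atBot) : ℝ) : ℂ)) ∧
    (2 * Real.pi * opTrace T =
      (((Nat.card {j : Fin J //
            branchEnd α β (E j) atBot = α ∧ branchEnd α β (E j) atTop = β} : ℤ) -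
        (Nat.card {j : Fin J //
            branchEnd α β (E j) atBot = β ∧ branchEnd α β (E j) atTop = α} : ℤ) : ℤ) : ℂ)) ∧
    ∀ x₀ : ℝ,
      IsTraceClass (opComm (funCalc H (expFun φ)) (mulOp K (heaviside x₀))) →
      opTrace (opComm (funCalc H (expFun φ)) (mulOp K (heaviside x₀))) = 0 →
        (compression (mulOp K (heaviside x₀)) (funCalc H (expFun φ))).IsFredholm ∧
        (fredholmIndex (compression (mulOp K (heaviside x₀)) (funCalc H (expFun φ))) : ℂ) =
          ∑ j, winding (expFun φ ∘ E j) ∧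
        ∑ j, winding (expFun φ ∘ E j) = 2 * Real.pi * opTrace T := by
  have hn : ∀ f : ℝ → ℂ, IsTest α β f → IsNuclear (opComm (funCalc H f) (mulOp K P)) := fun f hf =>
    isNuclear_opComm_funCalc hH hαβ (hP.memLp_top hPm) htc hf
  have hmain := hE.two_pi_mul_opTrace hαβ hH hφ hφΔ hPm hcd hP hn hT hTtc.isNuclear
  have hint : ∀ j, ∫ ξ, deriv (φ ∘ E j) ξ =
      φ (branchEnd α β (E j) atTop) - φ (branchEnd α β (E j) atBot) := fun j =>
    integral_deriv_switch_comp hαβ hφ hφs (hE.smooth j) (hE.bounded_crossing j)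
  have hw : ∀ j, winding (expFun φ ∘ E j) =
      ((φ (branchEnd α β (E j) atTop) - φ (branchEnd α β (E j) atBot) : ℝ) : ℂ) := fun j => by
    rw [winding_expFun_comp hφ (hE.smooth j), hint]
  refine ⟨?_, hmain, ?_, fun x₀ hC hC0 => ?_⟩
  · simp only [hint]
    exact hmain
  · rw [hmain, ← Complex.ofReal_sum, sum_switch_branchEnd hαβ hφ hφs E, Complex.ofReal_intCast]
  · obtain ⟨h1, h2⟩ := hE.index_compression hαβ hH hφ hφs hφΔ hPm hP hn x₀ hC.isNuclear hC0
    simp only [hw]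
    exact ⟨h1, h2, hmain.symm⟩
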